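/- Let $\pi:(0,\infty)\to\mathbb{R}$ be a probability density on $(0,\infty)$ such that (a) $\inf_{x\in C}\pi(x)>0$ for every (non-empty) compact $C\subset(0,\infty)$; (b) there is $c>0$ with $\int_0^x\pi(z)\,dz\le c\,x\,\pi(x)$ for all sufficiently small $x>0$; (c) $\pi$ is piecewise Lipschitz continuous: there are points $x_i>0$, $i\in\mathbb{Z}$, with $x_i<x_{i+1}$, $x_i\to0$ as $i\to-\infty$ and $x_i\to\infty$ as $i\to\infty$ such that $\pi|_{(x_i,x_{i+1})}$ is Lipschitz continuous, with a constant $K_i$, for every $i\in\mathbb{Z}$. Let $\mu$ be a probability measure on $(0,\infty)$ with $\inf\operatorname{supp}(\mu)>0$, let $\overline F_\mu(x):=\mu((x,\infty))$, and define the drift $$\phi(x):=-\frac{\int_0^x\overline F_\mu(x-u)\,\pi(u)\,du}{\pi(x)}\,\mathbf 1_{(0,\infty)}(x),\qquad x\in\mathbb{R}.$$ Let $(\Omega,\mathcal F,(\mathcal F_t)_{t\ge0},\mathbb P)$ be a filtered probability space satisfying the usual conditions, and let $L=(L_t)_{t\ge0}$ be an $(\mathcal F_t)$-adapted compound Poisson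 process with intensity $1$ and jump distribution $\mu$, i.e. $L_t=\sum_{k=1}^{N_t}\xi_k$ with a Poisson process $N$ of rate $1$ and i.i.d. random variables $\xi_k\sim\mu$ independent of $N$. For $x>0$ let $(X_t)_{t\ge0}$ under $\mathbb P^x$ be the strong (adapted) solution of $$dX_t=\phi(X_t)\,dt+dL_t,\qquad X_0=x,$$ that is, almost surely $X_t=x+\int_0^t\phi(X_s)\,ds+L_t$ for all $t\ge0$. A probability measure $\nu$ on $(0,\infty)$ is called invariant if $\int_{(0,\infty)}\mathbb P^x(X_t\in B)\,\nu(dx)=\nu(B)$ for all $t\ge0$ and all Borel sets $B\subseteq(0,\infty)$. It is called infinitesimally invariant if for every $f\in C_c^\infty((0,\infty))$ the limit $\mathcal A f(x):=\lim_{t\downarrow0}\frac1t\big(\mathbb E^x f(X_t)-f(x)\big)$ exists for all $x>0$, $\mathcal A f$ is $\nu$-integrable, and $\int_0^\infty\mathcal A f(x)\,\nu(dx)=0$. Then every invariant probability measure of the solution is infinitesimally invariant, and $\boldsymbol\pi(dx):=\pi(x)\,dx$ is the unique invariant probability measure: $\boldsymbol\pi$ is invariant, and every invariant probability measure equals $\boldsymbol\pi$.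 -/

import Mathlib

open MeasureTheory ProbabilityTheory Set Filter
open scoped Topology NNReal ENNReal

namespace LevyLangevin

noncomputable section

/-! ### The target density, the jump law and the drift -/

/-- The target measure `π(x) dx` on `(0,∞)`, regarded as a measure on `ℝ` that is carried by
`(0,∞)`. The values of `π` outside `(0,∞)` never matter. -/
def targetMeasure (π : ℝ → ℝ) : Measure ℝ :=
  (volume.restrict (Ioi (0 : ℝ))).withDensity fun x => ENNReal.ofReal (π x)

/-- `π` is piecewise Lipschitz continuous on `(0,∞)`: there is a strictly increasing two-sided
sequence of partition points in `(0,∞)` whose unique accumulation point is `0` (that is, the points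
tend to `0` at `-∞` and to `∞` at `+∞`), and `π` is Lipschitz on each open interval between
neighbouring points. The Lipschitz constant may depend on the interval, and nothing is required
at the partition points. -/
def IsPiecewiseLipschitz (π : ℝ → ℝ) : Prop :=
  ∃ p : ℤ → ℝ, (∀ i, 0 < p i) ∧ StrictMono p ∧
    Tendsto p atBot (𝓝 0) ∧ Tendsto p atTop atTop ∧
    ∀ i, ∃ K : ℝ≥0, LipschitzOnWith K π (Ioo (p i) (p (i + 1)))

/-- The standing assumptions on the target density `π` on `(0,∞)`. (Strict positivity of `π` and
full support of the target measure are contained in `inf_pos`.) -/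
structure TargetAssumptions (π : ℝ → ℝ) : Prop where
  /-- `π` is a probability density on `(0,∞)`. -/
  lintegral_eq_one : ∫⁻ x in Ioi (0 : ℝ), ENNReal.ofReal (π x) = 1
  /-- `π` is bounded away from `0` on every compact subset of `(0,∞)`. -/
  inf_pos : ∀ C : Set ℝ, IsCompact C → C ⊆ Ioi 0 → ∃ ε > 0, ∀ x ∈ C, ε ≤ π x
  /-- `∫₀ˣ π(z) dz ≤ c x π(x)` for all sufficiently small `x > 0`. -/
  near_zero : ∃ c > 0, ∀ᶠ x in 𝓝[>] (0 : ℝ), ∫ z in (0 : ℝ)..x, π z ≤ c * x * π x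
  /-- `π` is piecewise Lipschitz continuous. -/
  piecewise_lipschitz : IsPiecewiseLipschitz π

/-- The tail function `F̄_μ(x) = μ((x,∞))`. -/
def tail (μ : Measure ℝ) (x : ℝ) : ℝ := μ.real (Ioi x)

/-- The convolution of functions on `(0,∞)`:
`(F̄_μ ∗ g)(x) = ∫₀ˣ F̄_μ(x - u) g(u) du` for `x > 0`. -/
def tailConv (μ : Measure ℝ) (g : ℝ → ℝ) (x : ℝ) : ℝ :=
  ∫ u in (0 : ℝ)..x, tail μ (x - u) * g u

/-- The drift coefficient `φ(x) = -(F̄_μ ∗ π)(x) / π(x) · 1_{(0,∞)}(x)`. -/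
def drift (μ : Measure ℝ) (π : ℝ → ℝ) : ℝ → ℝ :=
  (Ioi (0 : ℝ)).indicator fun x => -(tailConv μ π x / π x)

/-! ### The driving noise and the stochastic differential equation -/

variable {Ω : Type*} {mΩ : MeasurableSpace Ω}

/-- The usual conditions: `𝓕` is right continuous, and every `P`-null set (measurable or not)
belongs to `𝓕 0`. -/
structure UsualConditions (𝓕 : Filtration ℝ≥0 mΩ) (P : Measure Ω) : Prop where
  rightContinuous : 𝓕.IsRightContinuous
  complete : ∀ s : Set Ω, P s = 0 → MeasurableSet[𝓕 0] s

/-- `N` is a Poisson process with rate `1`. -/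
structure IsUnitPoissonProcess (N : ℝ≥0 → Ω → ℕ) (P : Measure Ω) : Prop where
  measurable : ∀ t, Measurable (N t)
  zero : ∀ᵐ ω ∂P, N 0 ω = 0
  mono : ∀ᵐ ω ∂P, Monotone fun t => N t ω
  rightCont : ∀ᵐ ω ∂P, ∀ t, ContinuousWithinAt (fun s => N s ω) (Ici t) t
  increments_law : ∀ s t : ℝ≥0, s ≤ t →
    P.map (fun ω => (N t ω : ℝ) - (N s ω : ℝ)) =
      (poissonMeasure (t - s)).map (fun n : ℕ => (n : ℝ))
  increments_indep : HasIndepIncrements (fun t ω => (N t ω : ℝ)) P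

/-- `L` is a compound Poisson process with intensity `1` and jump distribution `μ`: almost surely
`L t = ξ_1 + ⋯ + ξ_{N t}` for all `t`, where `N` is a Poisson process with rate `1` and the
`ξ_k` are i.i.d. with law `μ` and (as a family) independent of the process `N`. -/
def IsCompoundPoisson (μ : Measure ℝ) (L : ℝ≥0 → Ω → ℝ) (P : Measure Ω) : Prop :=
  ∃ (N : ℝ≥0 → Ω → ℕ) (ξ : ℕ → Ω → ℝ),
    IsUnitPoissonProcess N P ∧
    (∀ k, Measurable (ξ k)) ∧
    (∀ k, P.map (ξ k) = μ) ∧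
    iIndepFun ξ P ∧
    IndepFun (fun ω k => ξ k ω) (fun ω t => N t ω) P ∧
    ∀ᵐ ω ∂P, ∀ t, L t ω = ∑ k ∈ Finset.range (N t ω), ξ k ω

/-- `X` is a strong solution of `dX_t = φ(X_t) dt + dL_t`, `X_0 = x`, on the given filtered
probability space with the given noise `L`: it is adapted, and almost surely, for all `t ≥ 0`,
`X_t = x + ∫₀ᵗ φ(X_s) ds + L_t`, where the integral exists as a Lebesgue integral. -/
structure IsStrongSolution (φ : ℝ → ℝ) (L : ℝ≥0 → Ω → ℝ) (𝓕 : Filtration ℝ≥0 mΩ)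
    (P : Measure Ω) (x : ℝ) (X : ℝ≥0 → Ω → ℝ) : Prop where
  adapted : Adapted 𝓕 X
  eqn : ∀ᵐ ω ∂P, ∀ t : ℝ≥0,
    IntervalIntegrable (fun s : ℝ => φ (X s.toNNReal ω)) volume 0 t ∧
    X t ω = x + (∫ s in (0 : ℝ)..t, φ (X s.toNNReal ω)) + L t ω

/-! ### Invariance

In the following, `X x` is the process started at `x > 0`, so that `ℙˣ(X_t ∈ B) = P (X x t ∈ B)`
and `𝔼ˣ f(X_t) = ∫ f(X x t) dP`. The state space is `(0,∞)`. -/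

/-- `ν` is an invariant distribution on `(0,∞)`: a probability measure carried by `(0,∞)`
with `∫_{(0,∞)} ℙˣ(X_t ∈ B) ν(dx) = ν(B)` for all `t ≥ 0` and all Borel sets `B ⊆ (0,∞)`. -/
structure IsInvariantDistribution (X : ℝ → ℝ≥0 → Ω → ℝ) (P : Measure Ω) (ν : Measure ℝ) : Prop where
  prob : IsProbabilityMeasure ν
  carried : ν (Iic 0) = 0
  invariant : ∀ (t : ℝ≥0) (B : Set ℝ), MeasurableSet B → B ⊆ Ioi 0 →
    ∫⁻ x in Ioi (0 : ℝ), P {ω | X x t ω ∈ B} ∂ν = ν B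

/-- The difference quotient `(𝔼ˣ f(X_t) - f(x)) / t`. -/
def genQuotient (X : ℝ → ℝ≥0 → Ω → ℝ) (P : Measure Ω) (f : ℝ → ℝ) (x : ℝ) (t : ℝ≥0) : ℝ :=
  ((∫ ω, f (X x t ω) ∂P) - f x) / t

/-- The domain of the pointwise infinitesimal generator: `f ∈ C₀((0,∞))` (continuous on `(0,∞)`
and vanishing at both ends `0` and `∞`) such that `lim_{t → 0} (𝔼ˣ f(X_t) - f(x)) / t` exists
for every `x ∈ (0,∞)`. -/
structure MemGeneratorDomain (X : ℝ → ℝ≥0 → Ω → ℝ) (P : Measure Ω) (f : ℝ → ℝ) : Prop where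
  continuousOn : ContinuousOn f (Ioi 0)
  zero_at_zero : Tendsto f (𝓝[>] 0) (𝓝 0)
  zero_at_top : Tendsto f atTop (𝓝 0)
  exists_lim : ∀ x > 0, ∃ a : ℝ, Tendsto (genQuotient X P f x) (𝓝[>] 0) (𝓝 a)

/-- The pointwise infinitesimal generator
`𝒜 f (x) = lim_{t → 0} (𝔼ˣ f(X_t) - f(x)) / t`, meaningful for `f` in the domain and `x > 0`. -/
def generator (X : ℝ → ℝ≥0 → Ω → ℝ) (P : Measure Ω) (f : ℝ → ℝ) (x : ℝ) : ℝ :=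
  limUnder (𝓝[>] (0 : ℝ≥0)) (genQuotient X P f x)

/-- Test functions: smooth functions with compact support contained in `(0,∞)`. -/
structure IsTestFunction (f : ℝ → ℝ) : Prop where
  smooth : ContDiff ℝ (⊤ : ℕ∞) f
  compact : HasCompactSupport f
  support : tsupport f ⊆ Ioi 0

/-- `ν` is infinitesimally invariant: a probability measure carried by `(0,∞)` such that every
test function `f` is in the domain of the pointwise generator, `𝒜 f` is `ν`-integrable, and
`∫_{(0,∞)} 𝒜 f dν = 0`. -/
structure IsInfinitesimallyInvariant (X : ℝ → ℝ≥0 → Ω → ℝ) (P : Measure Ω)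
    (ν : Measure ℝ) : Prop where
  prob : IsProbabilityMeasure ν
  carried : ν (Iic 0) = 0
  mem_domain : ∀ f, IsTestFunction f → MemGeneratorDomain X P f
  integrable : ∀ f, IsTestFunction f → IntegrableOn (generator X P f) (Ioi 0) ν
  integral_eq_zero : ∀ f, IsTestFunction f → ∫ x in Ioi (0 : ℝ), generator X P f x ∂ν = 0

end

end LevyLangevin

open LevyLangevin

namespace LevyLangevin

noncomputable section

/-! ### The target density -/

/-! The drift is chosen so that mass balances at every level: under the density `π` the downward
flux through `z` is `π z * |φ z| = tailConv μ π z`, which is exactly the rate at which jumps carry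
mass from below `z` to above `z`. The work lies in turning this balance into invariance although `φ`
may be discontinuous and unbounded.

The device is the clock `H`, with `H' = π / tailConv = -1/φ` off a countable set. Between jumps `H
(X t)` decreases at unit speed. On `(0, a]`, where `a > 0` bounds the jumps from below, `tailConv`
is the target distribution function `F`, so there `H = log F` up to a constant; hence `H → -∞` at
`0` and the flow never reaches `0`. This determines every solution explicitly from the jump times
and sizes (`IsClock.eq_jumpPosition`), makes it a function of the past of the noise, and gives a
jointly measurable version in the starting point.

A short time step is split according to zero, one or at least two jumps; for antitone test functions
of `H` this gives two-sided bounds (`forward_bounds`), and in the limit Duhamel's formula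
(`IsForward.duhamel`) `P(H(X_t) ≤ r) = e^{-t} P(H(X_0) ≤ r + t) + ∫₀ᵗ e^{-(t-s)} P(H(X_s + Y) ≤ r +
t - s) ds`, with `Y` of law `μ` independent of `X_s`. A law for which this holds as a constant
family is called stationary.

Invariance of the target: its distribution function `A` in clock time satisfies `A' = A - Q`, where
`Q` is the one after an added jump; this is the flux balance, and it integrates to stationarity.
Duhamel's formula contracts sup distances on `[0, T]` by the factor `1 - e^{-T}`, so the process
started from a stationary law keeps it.

Uniqueness: an invariant law is stationary. Below level `a` the jump term vanishes, so stationarity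
fixes a law there up to a factor; since jumps are at least `a`, the same factor propagates from `(0,
ka]` to `(0, (k+1)a]`, and total mass makes it `1`.

Infinitesimal invariance: a test function is Lipschitz with respect to the clock, so its difference
quotients are bounded uniformly in the starting point. They converge at every point, since the clock
has left derivatives everywhere, and they have integral `0` under an invariant law; dominated
convergence concludes. -/

theorem exists_mem_Ioc_of_tendsto {p : ℤ → ℝ} (hbot : Tendsto p atBot (𝓝 0))
    (htop : Tendsto p atTop atTop) (hmono : StrictMono p) {z : ℝ} (hz : 0 < z) :
    ∃ i, z ∈ Ioc (p i) (p (i + 1)) := by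
  obtain ⟨i₀, hi₀⟩ := (hbot.eventually (gt_mem_nhds hz)).exists
  obtain ⟨j₀, hj₀⟩ := (htop.eventually (eventually_ge_atTop z)).exists
  obtain ⟨i, hi, hmax⟩ := Int.exists_greatest_of_bdd (P := fun i => p i < z)
    ⟨j₀, fun i hi => (hmono.lt_iff_lt.1 (hi.trans_le hj₀)).le⟩ ⟨i₀, hi₀⟩
  refine ⟨i, hi, not_lt.1 fun h => ?_⟩
  have := hmax _ h
  omega

namespace TargetAssumptions

variable {π : ℝ → ℝ}

theorem pos (hπ : TargetAssumptions π) {z : ℝ} (hz : 0 < z) : 0 < π z := by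
  obtain ⟨ε, hε, h⟩ := hπ.inf_pos {z} isCompact_singleton (by simpa using hz)
  exact hε.trans_le (h z rfl)

theorem exists_countable_continuousAt (hπ : TargetAssumptions π) :
    ∃ E : Set ℝ, E.Countable ∧ ∀ z > 0, z ∉ E → ContinuousAt π z := by
  obtain ⟨p, -, hmono, hbot, htop, hlip⟩ := hπ.piecewise_lipschitz
  refine ⟨range p, countable_range p, fun z hz hE => ?_⟩
  obtain ⟨i, hi⟩ := exists_mem_Ioc_of_tendsto hbot htop hmono hz
  obtain ⟨K, hK⟩ := hlip i
  have hz' : z < p (i + 1) := lt_of_le_of_ne hi.2 fun h => hE ⟨_, h.symm⟩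
  exact hK.continuousOn.continuousAt (Ioo_mem_nhds hi.1 hz')

/-- The flow moves downwards, so only the behaviour of `π` to the left of `z` matters for the
generator, even when `z` is a partition point. The value `ρ z` need not be `π z`; its positivity is
inherited from the lower bound on `Icc (p i) z` by closure. -/
theorem exists_left_extension (hπ : TargetAssumptions π) {z : ℝ} (hz : 0 < z) :
    ∃ w ρ, 0 < w ∧ w < z ∧ Continuous ρ ∧ 0 < ρ z ∧ EqOn π ρ (Ioo w z) := by
  obtain ⟨p, hpos, hmono, hbot, htop, hlip⟩ := hπ.piecewise_lipschitz
  obtain ⟨i, hi⟩ := exists_mem_Ioc_of_tendsto hbot htop hmono hz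
  obtain ⟨K, hK⟩ := hlip i
  obtain ⟨ρ, hρ, hEq⟩ := hK.extend_real
  have hEq' : EqOn π ρ (Ioo (p i) z) := hEq.mono (Ioo_subset_Ioo_right hi.2)
  refine ⟨p i, ρ, hpos i, hi.1, hρ.continuous, ?_, hEq'⟩
  obtain ⟨ε, hε, h⟩ := hπ.inf_pos (Icc (p i) z) isCompact_Icc fun x hx => (hpos i).trans_le hx.1
  have hmem : z ∈ closure (Ioo (p i) z) := by
    rw [closure_Ioo hi.1.ne]; exact right_mem_Icc.2 hi.1.le
  refine hε.trans_le ?_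
  exact closure_minimal (fun x hx => by
    rw [mem_preimage, mem_Ici, ← hEq' hx]; exact h x (Ioo_subset_Icc_self hx))
    (isClosed_Ici.preimage hρ.continuous) hmem

theorem aestronglyMeasurable (hπ : TargetAssumptions π) :
    AEStronglyMeasurable π (volume.restrict (Ioi (0 : ℝ))) := by
  obtain ⟨E, hE, hc⟩ := hπ.exists_countable_continuousAt
  have h : AEStronglyMeasurable π (volume.restrict (Ioi (0 : ℝ) \ E)) :=
    ContinuousOn.aestronglyMeasurable (fun z hz => (hc z hz.1 hz.2).continuousWithinAt)
      (measurableSet_Ioi.diff hE.measurableSet)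
  rwa [Measure.restrict_congr_set (sdiff_null_ae_eq_self (hE.measure_zero volume))] at h

theorem integrableOn (hπ : TargetAssumptions π) : IntegrableOn π (Ioi 0) := by
  refine ⟨hπ.aestronglyMeasurable, ?_⟩
  rw [hasFiniteIntegral_iff_ofReal, hπ.lintegral_eq_one]
  · exact ENNReal.one_lt_top
  · filter_upwards [ae_restrict_mem measurableSet_Ioi] with z hz using (hπ.pos hz).le

theorem intervalIntegrable (hπ : TargetAssumptions π) {x y : ℝ} (hx : 0 ≤ x) (hy : 0 ≤ y) :
    IntervalIntegrable π volume x y := by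
  rw [intervalIntegrable_iff]
  refine hπ.integrableOn.mono_set fun z hz => ?_
  rcases mem_uIoc.1 hz with h | h
  exacts [hx.trans_lt h.1, hy.trans_lt h.1]

theorem isProbabilityMeasure (hπ : TargetAssumptions π) :
    IsProbabilityMeasure (targetMeasure π) :=
  ⟨by simpa [targetMeasure] using hπ.lintegral_eq_one⟩

theorem targetMeasure_Iic_zero (π : ℝ → ℝ) : targetMeasure π (Iic 0) = 0 := by
  rw [targetMeasure, withDensity_apply _ measurableSet_Iic,
    Measure.restrict_restrict measurableSet_Iic, Iic_inter_Ioi, Ioc_self]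
  simp

theorem targetMeasure_absolutelyContinuous (π : ℝ → ℝ) : targetMeasure π ≪ volume :=
  (withDensity_absolutelyContinuous _ _).trans Measure.restrict_le_self.absolutelyContinuous

theorem setIntegral_targetMeasure (hπ : TargetAssumptions π) {s : Set ℝ} (hs : MeasurableSet s)
    (f : ℝ → ℝ) :
    ∫ u in s, f u ∂(targetMeasure π) = ∫ u in s ∩ Ioi 0, π u * f u := by
  rw [targetMeasure, setIntegral_withDensity_eq_setIntegral_toReal_smul₀ (g := f) _ _ hs,
    Measure.restrict_restrict hs]
  · refine setIntegral_congr_fun (hs.inter measurableSet_Ioi) fun u hu => ?_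
    simp [ENNReal.toReal_ofReal (hπ.pos hu.2).le]
  · exact (hπ.aestronglyMeasurable.aemeasurable.ennreal_ofReal).mono_measure
      Measure.restrict_le_self
  · exact ae_of_all _ fun _ => ENNReal.ofReal_lt_top

theorem real_Iic_eq_integral (hπ : TargetAssumptions π) {z : ℝ} (hz : 0 ≤ z) :
    (targetMeasure π).real (Iic z) = ∫ u in (0 : ℝ)..z, π u := by
  have h := hπ.setIntegral_targetMeasure (measurableSet_Iic (a := z)) fun _ => 1
  rw [inter_comm, Ioi_inter_Iic] at h
  rw [intervalIntegral.integral_of_le hz]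
  simpa using h

theorem real_Iic_of_nonpos (π : ℝ → ℝ) {z : ℝ} (hz : z ≤ 0) :
    (targetMeasure π).real (Iic z) = 0 := by
  rw [measureReal_def, measure_mono_null (Iic_subset_Iic.2 hz) (targetMeasure_Iic_zero π)]
  rfl

theorem real_Iic_sub (hπ : TargetAssumptions π) {w z : ℝ} (hw : 0 ≤ w) (hz : 0 ≤ z) :
    (targetMeasure π).real (Iic z) - (targetMeasure π).real (Iic w) = ∫ u in w..z, π u := by
  rw [hπ.real_Iic_eq_integral hz, hπ.real_Iic_eq_integral hw,
    intervalIntegral.integral_interval_sub_left (hπ.intervalIntegrable le_rfl hz)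
      (hπ.intervalIntegrable le_rfl hw)]

theorem real_Iic_strictMono (hπ : TargetAssumptions π) {w z : ℝ} (hz : 0 < z) (hwz : w < z) :
    (targetMeasure π).real (Iic w) < (targetMeasure π).real (Iic z) := by
  have key : ∀ {w z : ℝ}, 0 ≤ w → w < z →
      (targetMeasure π).real (Iic w) < (targetMeasure π).real (Iic z) := fun {w z} hw h => by
    rw [← sub_pos, hπ.real_Iic_sub hw (hw.trans h.le)]
    exact intervalIntegral.intervalIntegral_pos_of_pos_on
      (hπ.intervalIntegrable hw (hw.trans h.le)) (fun u hu => hπ.pos (hw.trans_lt hu.1)) h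
  rcases le_total 0 w with hw | hw
  · exact key hw hwz
  · rw [real_Iic_of_nonpos π hw, ← real_Iic_of_nonpos π le_rfl]
    exact key le_rfl hz

theorem continuous_real_Iic (hπ : TargetAssumptions π) :
    Continuous fun z => (targetMeasure π).real (Iic z) := by
  have h : (fun z => (targetMeasure π).real (Iic z)) =
      fun z => ∫ u in (0 : ℝ)..z, (Ioi (0 : ℝ)).indicator π u := by
    funext z
    rcases le_total 0 z with hz | hz
    · rw [hπ.real_Iic_eq_integral hz]
      refine intervalIntegral.integral_congr_ae (ae_of_all _ fun u hu => ?_)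
      rw [uIoc_of_le hz] at hu
      rw [indicator_of_mem (show u ∈ Ioi (0 : ℝ) from hu.1)]
    · rw [real_Iic_of_nonpos π hz, intervalIntegral.integral_symm,
        intervalIntegral.integral_of_le hz, setIntegral_eq_zero_of_forall_eq_zero, neg_zero]
      intro u hu
      rw [indicator_of_notMem (by simpa using hu.2)]
  rw [h]
  exact intervalIntegral.continuous_primitive
    (fun _ _ => ((integrable_indicator_iff measurableSet_Ioi).2 hπ.integrableOn).intervalIntegrable)
    0

theorem hasDerivAt_real_Iic (hπ : TargetAssumptions π) {z : ℝ} (hz : 0 < z)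
    (hc : ContinuousAt π z) :
    HasDerivAt (fun z => (targetMeasure π).real (Iic z)) (π z) z := by
  have hm : StronglyMeasurableAtFilter π (𝓝 z) :=
    ⟨Ioi 0, Ioi_mem_nhds hz, hπ.aestronglyMeasurable⟩
  refine (intervalIntegral.integral_hasDerivAt_right
    (hπ.intervalIntegrable le_rfl hz.le) hm hc).congr_of_eventuallyEq ?_
  filter_upwards [Ioi_mem_nhds hz] with w hw using hπ.real_Iic_eq_integral (le_of_lt hw)

/-! ### The tail convolution -/

variable {μ : Measure ℝ} [IsProbabilityMeasure μ]

/-- Since `F̄_μ` is one minus the distribution function of `μ`, Fubini gives this form: the mass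
below `z` before a jump minus the mass below `z` after it. It is what links the drift to the
stationary equation. -/
theorem tailConv_eq (hπ : TargetAssumptions π) {a : ℝ} (ha : 0 < a) (hμa : ∀ᵐ y ∂μ, a ≤ y)
    {z : ℝ} (hz : 0 < z) :
    tailConv μ π z =
      (targetMeasure π).real (Iic z) - ∫ y, (targetMeasure π).real (Iic (z - y)) ∂μ := by
  have := hπ.isProbabilityMeasure
  have hswap : ∫ y, (targetMeasure π).real (Iic (z - y)) ∂μ =
      ∫ u, μ.real (Iic (z - u)) ∂(targetMeasure π) := by
    have hS : MeasurableSet {q : ℝ × ℝ | q.1 + q.2 ≤ z} :=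
      measurableSet_le (by fun_prop) measurable_const
    have h := integral_integral_swap (μ := μ) (ν := targetMeasure π)
      (f := fun y u => {q : ℝ × ℝ | q.1 + q.2 ≤ z}.indicator (fun _ => (1 : ℝ)) (y, u))
      ((integrable_const (1 : ℝ)).indicator hS)
    convert h using 1
    · refine integral_congr_ae (ae_of_all _ fun y => ?_)
      have e : (fun u => {q : ℝ × ℝ | q.1 + q.2 ≤ z}.indicator (fun _ => (1 : ℝ)) (y, u)) =
          (Iic (z - y)).indicator fun _ => (1 : ℝ) := by
        funext u; simp [indicator, le_sub_iff_add_le']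
      simp only [e, integral_indicator measurableSet_Iic]
      simp
    · refine integral_congr_ae (ae_of_all _ fun u => ?_)
      have e : (fun y => {q : ℝ × ℝ | q.1 + q.2 ≤ z}.indicator (fun _ => (1 : ℝ)) (y, u)) =
          (Iic (z - u)).indicator fun _ => (1 : ℝ) := by
        funext y; simp [indicator, le_sub_iff_add_le]
      simp only [e, integral_indicator measurableSet_Iic]
      simp
  have hmeas : Measurable fun u => μ.real (Iic (z - u)) :=
    Antitone.measurable fun u v huv => measureReal_mono (Iic_subset_Iic.2 (by linarith))
  have hsupp : ∫ u, μ.real (Iic (z - u)) ∂(targetMeasure π) =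
      ∫ u in Iic z, μ.real (Iic (z - u)) ∂(targetMeasure π) := by
    refine (setIntegral_eq_integral_of_forall_compl_eq_zero fun u hu => ?_).symm
    rw [measureReal_def, measure_mono_null (Iic_subset_Iic.2 (show z - u ≤ 0 from ?_)) ?_]
    · rfl
    · have : z < u := by simpa using hu
      linarith
    · refine measure_eq_zero_iff_ae_notMem.2 ?_
      filter_upwards [hμa] with y hy
      simpa using ha.trans_le hy
  have hone : (targetMeasure π).real (Iic z) = ∫ _ in Iic z, (1 : ℝ) ∂(targetMeasure π) := by simp
  have hint : IntegrableOn (fun u => μ.real (Iic (z - u))) (Iic z) (targetMeasure π) :=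
    Integrable.of_bound hmeas.aestronglyMeasurable 1 (ae_of_all _ fun u => by
      rw [Real.norm_of_nonneg measureReal_nonneg]; exact measureReal_le_one)
  rw [hswap, hsupp, hone, ← integral_sub (integrable_const _) hint,
    hπ.setIntegral_targetMeasure measurableSet_Iic, inter_comm, Ioi_inter_Iic, tailConv,
    intervalIntegral.integral_of_le hz.le]
  refine setIntegral_congr_fun measurableSet_Ioc fun u _ => ?_
  have : tail μ (z - u) = 1 - μ.real (Iic (z - u)) := by
    rw [tail, ← compl_Iic, probReal_compl_eq_one_sub measurableSet_Iic]
  simp only [this]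
  ring

theorem continuous_tailConv_aux (hπ : TargetAssumptions π) :
    Continuous fun z => (targetMeasure π).real (Iic z) -
      ∫ y, (targetMeasure π).real (Iic (z - y)) ∂μ := by
  have := hπ.isProbabilityMeasure
  refine hπ.continuous_real_Iic.sub (continuous_of_dominated (bound := fun _ => 1)
    (fun z => (hπ.continuous_real_Iic.comp (by fun_prop)).aestronglyMeasurable)
    (fun z => ae_of_all _ fun y => ?_)
    (integrable_const _) (ae_of_all _ fun y => hπ.continuous_real_Iic.comp (by fun_prop)))
  rw [Real.norm_of_nonneg measureReal_nonneg]
  exact measureReal_le_one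

theorem integrable_real_Iic_sub (hπ : TargetAssumptions π) (z : ℝ) :
    Integrable (fun y => (targetMeasure π).real (Iic (z - y))) μ := by
  have := hπ.isProbabilityMeasure
  refine Integrable.of_bound (hπ.continuous_real_Iic.comp (by fun_prop)).aestronglyMeasurable 1
    (ae_of_all _ fun y => ?_)
  rw [Real.norm_of_nonneg measureReal_nonneg]
  exact measureReal_le_one

theorem continuousOn_tailConv (hπ : TargetAssumptions π) {a : ℝ} (ha : 0 < a)
    (hμa : ∀ᵐ y ∂μ, a ≤ y) :
    ContinuousOn (tailConv μ π) (Ioi 0) :=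
  (continuous_tailConv_aux hπ).continuousOn.congr fun _ hz => tailConv_eq hπ ha hμa hz

theorem tailConv_le_one (hπ : TargetAssumptions π) {a : ℝ} (ha : 0 < a)
    (hμa : ∀ᵐ y ∂μ, a ≤ y) {z : ℝ} (hz : 0 < z) : tailConv μ π z ≤ 1 := by
  have := hπ.isProbabilityMeasure
  rw [tailConv_eq hπ ha hμa hz]
  have h1 : (targetMeasure π).real (Iic z) ≤ 1 := measureReal_le_one
  have h2 : 0 ≤ ∫ y, (targetMeasure π).real (Iic (z - y)) ∂μ :=
    integral_nonneg fun _ => measureReal_nonneg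
  linarith

/-- Jumps are at least `a`, so the subtracted average is at most the target mass of `Iic (z - a)`,
which is strictly smaller than that of `Iic z`. -/
theorem tailConv_pos (hπ : TargetAssumptions π) {a : ℝ} (ha : 0 < a) (hμa : ∀ᵐ y ∂μ, a ≤ y)
    {z : ℝ} (hz : 0 < z) : 0 < tailConv μ π z := by
  have := hπ.isProbabilityMeasure
  rw [tailConv_eq hπ ha hμa hz, sub_pos]
  calc ∫ y, (targetMeasure π).real (Iic (z - y)) ∂μ
      ≤ ∫ _, (targetMeasure π).real (Iic (z - a)) ∂μ := by
        refine integral_mono_ae (integrable_real_Iic_sub hπ z) (integrable_const _) ?_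
        filter_upwards [hμa] with y hy
        exact measureReal_mono (Iic_subset_Iic.2 (by linarith))
    _ = (targetMeasure π).real (Iic (z - a)) := by simp
    _ < _ := hπ.real_Iic_strictMono hz (by linarith)

theorem tailConv_eq_of_le (hπ : TargetAssumptions π) {a : ℝ} (ha : 0 < a) (hμa : ∀ᵐ y ∂μ, a ≤ y)
    {z : ℝ} (hz : 0 < z) (hza : z ≤ a) : tailConv μ π z = (targetMeasure π).real (Iic z) := by
  rw [tailConv_eq hπ ha hμa hz, sub_eq_self]
  refine integral_eq_zero_of_ae ?_
  filter_upwards [hμa] with y hy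
  exact real_Iic_of_nonpos π (by linarith)

end TargetAssumptions
end

noncomputable section

/-! ### The clock of the deterministic flow -/

/-- The time that the flow `x' = φ(x)` needs to go down from `z > 0` to `1`. -/
def clock (μ : Measure ℝ) (π : ℝ → ℝ) : ℝ → ℝ :=
  (Ioi (0 : ℝ)).indicator fun z => ∫ u in (1 : ℝ)..z, π u / tailConv μ π u

theorem clock_of_pos (μ : Measure ℝ) (π : ℝ → ℝ) {z : ℝ} (hz : 0 < z) :
    clock μ π z = ∫ u in (1 : ℝ)..z, π u / tailConv μ π u :=
  indicator_of_mem (show z ∈ Ioi (0 : ℝ) from hz) _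

/-- `H` is a clock for the autonomous equation `x' = φ(x)` on `(0,∞)`: along solutions, `H` decreases
at unit speed, and `0` is not reached in finite time. -/
structure IsClock (φ H : ℝ → ℝ) : Prop where
  neg : ∀ z > 0, φ z < 0
  measurable : Measurable H
  exists_countable : ∃ E : Set ℝ, E.Countable ∧ ∀ z > 0, z ∉ E →
    ContinuousAt φ z ∧ HasDerivAt H (-(φ z)⁻¹) z
  continuousOn : ContinuousOn H (Ioi 0)
  strictMonoOn : StrictMonoOn H (Ioi 0)
  tendsto_zero : Tendsto H (𝓝[>] 0) atBot

namespace TargetAssumptions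

variable {π : ℝ → ℝ} {μ : Measure ℝ} [IsProbabilityMeasure μ] {a : ℝ}

theorem integrableOn_rate (hπ : TargetAssumptions π) (ha : 0 < a) (hμa : ∀ᵐ y ∂μ, a ≤ y)
    {x y : ℝ} (hx : 0 < x) (hy : 0 < y) :
    IntervalIntegrable (fun u => π u / tailConv μ π u) volume x y := by
  have hsub : uIcc x y ⊆ Ioi 0 := fun u hu => (lt_min hx hy).trans_le hu.1
  refine IntervalIntegrable.mul_continuousOn (hπ.intervalIntegrable hx.le hy.le) ?_
  exact ((continuousOn_tailConv hπ ha hμa).mono hsub).inv₀ fun u hu =>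
    (tailConv_pos hπ ha hμa (hsub hu)).ne'

theorem rate_pos (hπ : TargetAssumptions π) (ha : 0 < a) (hμa : ∀ᵐ y ∂μ, a ≤ y) {z : ℝ}
    (hz : 0 < z) : 0 < π z / tailConv μ π z :=
  div_pos (hπ.pos hz) (tailConv_pos hπ ha hμa hz)

theorem clock_sub (hπ : TargetAssumptions π) (ha : 0 < a) (hμa : ∀ᵐ y ∂μ, a ≤ y)
    {x y : ℝ} (hx : 0 < x) (hy : 0 < y) :
    clock μ π y - clock μ π x = ∫ u in x..y, π u / tailConv μ π u := by
  rw [clock_of_pos μ π hx, clock_of_pos μ π hy]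
  exact intervalIntegral.integral_interval_sub_left (hπ.integrableOn_rate ha hμa one_pos hy)
    (hπ.integrableOn_rate ha hμa one_pos hx)

theorem clock_strictMonoOn (hπ : TargetAssumptions π) (ha : 0 < a) (hμa : ∀ᵐ y ∂μ, a ≤ y) :
    StrictMonoOn (clock μ π) (Ioi 0) := by
  intro x hx y hy hxy
  rw [← sub_pos, hπ.clock_sub ha hμa hx hy]
  exact intervalIntegral.intervalIntegral_pos_of_pos_on (hπ.integrableOn_rate ha hμa hx hy)
    (fun u hu => hπ.rate_pos ha hμa (lt_trans hx hu.1)) hxy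

theorem clock_continuousOn (hπ : TargetAssumptions π) (ha : 0 < a) (hμa : ∀ᵐ y ∂μ, a ≤ y) :
    ContinuousOn (clock μ π) (Ioi 0) := by
  intro z hz
  have hz : 0 < z := hz
  have h1 : 0 < min (z / 2) 1 := by positivity
  have h := intervalIntegral.continuousOn_primitive_interval' (a := 1)
    (hπ.integrableOn_rate ha hμa h1 (show 0 < max (2 * z) 1 by positivity)) ?_
  · refine ((h.continuousAt ?_).congr ?_).continuousWithinAt
    · rw [uIcc_of_le (by simp)]
      exact Icc_mem_nhds (by simp [hz]) (by simp [hz])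
    · filter_upwards [Ioi_mem_nhds hz] with w hw using (clock_of_pos μ π hw).symm
  · rw [uIcc_of_le (by simp)]
    exact ⟨by simp, by simp⟩

theorem hasDerivAt_clock (hπ : TargetAssumptions π) (ha : 0 < a) (hμa : ∀ᵐ y ∂μ, a ≤ y)
    {z : ℝ} (hz : 0 < z) (hc : ContinuousAt π z) :
    HasDerivAt (clock μ π) (π z / tailConv μ π z) z := by
  have hg : ContinuousAt (tailConv μ π) z :=
    (continuousOn_tailConv hπ ha hμa).continuousAt (Ioi_mem_nhds hz)
  refine (intervalIntegral.integral_hasDerivAt_right (hπ.integrableOn_rate ha hμa one_pos hz) ?_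
    (hc.div hg (tailConv_pos hπ ha hμa hz).ne')).congr_of_eventuallyEq ?_
  swap
  · filter_upwards [Ioi_mem_nhds hz] with w hw using clock_of_pos μ π hw
  exact ⟨Ioi 0, Ioi_mem_nhds hz, (hπ.aestronglyMeasurable.aemeasurable.div
    ((continuousOn_tailConv hπ ha hμa).aemeasurable measurableSet_Ioi)).aestronglyMeasurable⟩

/-- For `u ≤ a` the tail convolution is the distribution function `F`, so the rate is `F'/F`.
Discontinuities of `π` are countable and do not disturb the fundamental theorem of calculus. As `F →
0` at `0`, the flow needs infinite time to get there. -/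
theorem clock_eq_log (hπ : TargetAssumptions π) (ha : 0 < a) (hμa : ∀ᵐ y ∂μ, a ≤ y)
    {z : ℝ} (hz : 0 < z) (hza : z ≤ a) :
    clock μ π z = clock μ π a + Real.log ((targetMeasure π).real (Iic z)) -
      Real.log ((targetMeasure π).real (Iic a)) := by
  obtain ⟨E, hE, hc⟩ := hπ.exists_countable_continuousAt
  have hFpos : ∀ u > 0, 0 < (targetMeasure π).real (Iic u) := fun u hu => by
    have := hπ.real_Iic_strictMono hu hu
    rwa [real_Iic_of_nonpos π le_rfl] at this
  have h := integral_eq_of_hasDerivAt_off_countable_of_le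
    (fun u => Real.log ((targetMeasure π).real (Iic u))) (fun u => π u / tailConv μ π u) hza hE
    (fun u hu => (hπ.continuous_real_Iic.continuousAt.log
      (hFpos u (hz.trans_le hu.1)).ne').continuousWithinAt) ?_
    (hπ.integrableOn_rate ha hμa hz ha)
  · rw [← hπ.clock_sub ha hμa hz ha] at h
    linarith
  · intro u hu
    have hu0 : 0 < u := hz.trans hu.1.1
    rw [tailConv_eq_of_le hπ ha hμa hu0 hu.1.2.le]
    exact (hπ.hasDerivAt_real_Iic hu0 (hc u hu0 hu.2)).log (hFpos u hu0).ne'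

theorem clock_tendsto_zero (hπ : TargetAssumptions π) (ha : 0 < a) (hμa : ∀ᵐ y ∂μ, a ≤ y) :
    Tendsto (clock μ π) (𝓝[>] 0) atBot := by
  have hFpos : ∀ u > 0, 0 < (targetMeasure π).real (Iic u) := fun u hu => by
    have := hπ.real_Iic_strictMono hu hu
    rwa [real_Iic_of_nonpos π le_rfl] at this
  have h0 : Tendsto (fun z => (targetMeasure π).real (Iic z)) (𝓝[>] 0) (𝓝[>] 0) := by
    refine tendsto_nhdsWithin_iff.2 ⟨?_, ?_⟩
    · have := hπ.continuous_real_Iic.tendsto 0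
      rw [real_Iic_of_nonpos π le_rfl] at this
      exact this.mono_left nhdsWithin_le_nhds
    · filter_upwards [self_mem_nhdsWithin] with z hz using hFpos z hz
  have h1 := tendsto_atBot_add_const_right _
    (clock μ π a - Real.log ((targetMeasure π).real (Iic a))) (Real.tendsto_log_nhdsGT_zero.comp h0)
  refine h1.congr' ?_
  filter_upwards [Ioc_mem_nhdsGT ha] with z hz
  rw [hπ.clock_eq_log ha hμa hz.1 hz.2, Function.comp_apply]
  ring

theorem drift_of_pos (μ : Measure ℝ) (π : ℝ → ℝ) {z : ℝ} (hz : 0 < z) :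
    drift μ π z = -(tailConv μ π z / π z) := by
  rw [drift, indicator_of_mem (show z ∈ Ioi (0 : ℝ) from hz)]

theorem isClock (hπ : TargetAssumptions π) (ha : 0 < a) (hμa : ∀ᵐ y ∂μ, a ≤ y) :
    IsClock (drift μ π) (clock μ π) where
  neg z hz := by
    rw [drift_of_pos μ π hz, neg_lt_zero]
    exact div_pos (tailConv_pos hπ ha hμa hz) (hπ.pos hz)
  measurable := by
    classical
    have h := (hπ.clock_continuousOn ha hμa).measurable_piecewise
      (continuousOn_const (c := (0 : ℝ))) measurableSet_Ioi
    convert h using 1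
    funext z
    rcases lt_or_ge 0 z with hz | hz
    · rw [piecewise_eq_of_mem _ _ _ (show z ∈ Ioi (0 : ℝ) from hz)]
    · rw [piecewise_eq_of_notMem _ _ _ (by simpa using hz), clock,
        indicator_of_notMem (by simpa using hz)]
  exists_countable := by
    obtain ⟨E, hE, hc⟩ := hπ.exists_countable_continuousAt
    refine ⟨E, hE, fun z hz hzE => ⟨?_, ?_⟩⟩
    · refine ContinuousAt.congr (f := fun z => -(tailConv μ π z / π z)) ?_ ?_
      · exact (((continuousOn_tailConv hπ ha hμa).continuousAt (Ioi_mem_nhds hz)).div (hc z hz hzE)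
          (hπ.pos hz).ne').neg
      · filter_upwards [Ioi_mem_nhds hz] with w hw using (drift_of_pos μ π hw).symm
    · rw [drift_of_pos μ π hz, inv_neg, neg_neg, inv_div]
      exact hπ.hasDerivAt_clock ha hμa hz (hc z hz hzE)
  continuousOn := hπ.clock_continuousOn ha hμa
  strictMonoOn := hπ.clock_strictMonoOn ha hμa
  tendsto_zero := hπ.clock_tendsto_zero ha hμa

/-- At a discontinuity of `π` the clock may fail to be differentiable. The left derivative always
exists, with the left limit of `π` in the numerator, and suffices because the flow approaches its
starting point from below. -/
theorem exists_hasDerivWithinAt_clock (hπ : TargetAssumptions π) (ha : 0 < a)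
    (hμa : ∀ᵐ y ∂μ, a ≤ y) {z : ℝ} (hz : 0 < z) :
    ∃ d > 0, HasDerivWithinAt (clock μ π) d (Iio z) z := by
  obtain ⟨w, ρ, hw, hwz, hρ, hρz, hEq⟩ := hπ.exists_left_extension hz
  have hgz := tailConv_pos hπ ha hμa hz
  have hg : ContinuousOn (tailConv μ π) (Ioi 0) := continuousOn_tailConv hπ ha hμa
  have hcont : ContinuousOn (fun u => ρ u / tailConv μ π u) (Ioi 0) :=
    hρ.continuousOn.div hg fun u hu => (tailConv_pos hπ ha hμa hu).ne'
  refine ⟨ρ z / tailConv μ π z, div_pos hρz hgz, ?_⟩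
  have h1 : HasDerivAt (fun u => clock μ π z + ∫ v in z..u, ρ v / tailConv μ π v)
      (ρ z / tailConv μ π z) z := by
    refine (intervalIntegral.integral_hasDerivAt_right (by simp) ?_
      (hcont.continuousAt (Ioi_mem_nhds hz))).const_add _
    exact ⟨Ioi 0, Ioi_mem_nhds hz, hcont.aestronglyMeasurable measurableSet_Ioi⟩
  refine h1.hasDerivWithinAt.congr_of_eventuallyEq ?_ (by simp)
  filter_upwards [Ioo_mem_nhdsLT hwz] with u hu
  rw [← sub_eq_iff_eq_add', hπ.clock_sub ha hμa hz (hw.trans hu.1)]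
  rw [intervalIntegral.integral_symm, intervalIntegral.integral_symm u z,
    intervalIntegral.integral_of_le hu.2.le, intervalIntegral.integral_of_le hu.2.le,
    integral_Ioc_eq_integral_Ioo, integral_Ioc_eq_integral_Ioo]
  congr 1
  refine setIntegral_congr_fun measurableSet_Ioo fun v hv => ?_
  simp only [hEq ⟨hu.1.trans hv.1, hv.2⟩]

end TargetAssumptions
end

noncomputable section

/-! ### The deterministic flow -/

open Classical in
/-- The inverse of the restriction of a clock to `(0,∞)`, with value `1` outside its range. -/
def clockInv (H : ℝ → ℝ) (r : ℝ) : ℝ :=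
  if h : ∃ w, 0 < w ∧ H w = r then h.choose else 1

/-- The position at time `t` of the flow with clock `H` that starts from `x > 0`. -/
def flow (H : ℝ → ℝ) (t x : ℝ) : ℝ := clockInv H (H x - t)

theorem clockInv_pos (H : ℝ → ℝ) (r : ℝ) : 0 < clockInv H r := by
  unfold clockInv
  split_ifs with h
  exacts [h.choose_spec.1, one_pos]

theorem flow_pos (H : ℝ → ℝ) (t x : ℝ) : 0 < flow H t x := clockInv_pos _ _

namespace IsClock

variable {φ H : ℝ → ℝ}

theorem clockInv_clock (hH : IsClock φ H) {w : ℝ} (hw : 0 < w) : clockInv H (H w) = w := by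
  have h : ∃ v, 0 < v ∧ H v = H w := ⟨w, hw, rfl⟩
  rw [clockInv, dif_pos h]
  exact hH.strictMonoOn.injOn h.choose_spec.1 hw h.choose_spec.2

/-- As `H → -∞` at `0`, every value below `H x` is attained: the flow lives in `(0,∞)` for all times
`t ≥ 0`. -/
theorem exists_clock_eq (hH : IsClock φ H) {x t : ℝ} (hx : 0 < x) (ht : 0 ≤ t) :
    ∃ w, 0 < w ∧ w ≤ x ∧ H w = H x - t := by
  obtain ⟨v, hv, hvx⟩ := ((hH.tendsto_zero.eventually (eventually_le_atBot (H x - t))).and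
    (Ioo_mem_nhdsGT hx)).exists
  have hc : ContinuousOn H (Icc v x) := hH.continuousOn.mono fun u hu => hvx.1.trans_le hu.1
  obtain ⟨w, hw, hwe⟩ := intermediate_value_Icc hvx.2.le hc ⟨hv, by linarith⟩
  exact ⟨w, hvx.1.trans_le hw.1, hw.2, hwe⟩

theorem clock_flow (hH : IsClock φ H) {x t : ℝ} (hx : 0 < x) (ht : 0 ≤ t) :
    H (flow H t x) = H x - t := by
  obtain ⟨w, hw, -, hwe⟩ := hH.exists_clock_eq hx ht
  rw [flow, ← hwe, hH.clockInv_clock hw]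

theorem eq_flow (hH : IsClock φ H) {x t w : ℝ} (hw : 0 < w) (h : H w = H x - t) :
    w = flow H t x := by
  rw [flow, ← h, hH.clockInv_clock hw]

theorem le_iff (hH : IsClock φ H) {x y : ℝ} (hx : 0 < x) (hy : 0 < y) : H x ≤ H y ↔ x ≤ y :=
  hH.strictMonoOn.le_iff_le hx hy

theorem lt_iff (hH : IsClock φ H) {x y : ℝ} (hx : 0 < x) (hy : 0 < y) : H x < H y ↔ x < y :=
  hH.strictMonoOn.lt_iff_lt hx hy

theorem flow_le (hH : IsClock φ H) {x t : ℝ} (hx : 0 < x) (ht : 0 ≤ t) : flow H t x ≤ x := by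
  rw [← hH.le_iff (flow_pos _ _ _) hx, hH.clock_flow hx ht]
  linarith

theorem tendsto_flow (hH : IsClock φ H) {x : ℝ} (hx : 0 < x) :
    Tendsto (fun t => flow H t x) (𝓝[>] 0) (𝓝 x) := by
  refine tendsto_order.2 ⟨fun w hw => ?_, fun w hw => ?_⟩
  · rcases le_or_gt w 0 with hw0 | hw0
    · exact Eventually.of_forall fun t => hw0.trans_lt (flow_pos _ _ _)
    · have : 0 < H x - H w := sub_pos.2 ((hH.lt_iff hw0 hx).2 hw)
      filter_upwards [Ioo_mem_nhdsGT this] with t ht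
      rw [← hH.lt_iff hw0 (flow_pos _ _ _), hH.clock_flow hx ht.1.le]
      linarith [ht.2]
  · filter_upwards [self_mem_nhdsWithin] with t ht
    exact (hH.flow_le hx (le_of_lt ht)).trans_lt hw

theorem measurable_clockInv (hH : IsClock φ H) : Measurable (clockInv H) := by
  have hR : MeasurableSet (H '' Ioi 0) :=
    ((isPreconnected_Ioi.image H hH.continuousOn).ordConnected).measurableSet
  refine measurable_of_Iic fun w => ?_
  rcases le_or_gt w 0 with hw | hw
  · convert MeasurableSet.empty
    ext r
    simpa using hw.trans_lt (clockInv_pos H r)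
  · have : clockInv H ⁻¹' Iic w =
        (H '' Ioi 0 ∩ Iic (H w)) ∪ ((H '' Ioi 0)ᶜ ∩ {_r | 1 ≤ w}) := by
      ext r
      by_cases hr : r ∈ H '' Ioi 0
      · obtain ⟨v, hv, rfl⟩ := hr
        have hv : 0 < v := hv
        simp only [mem_preimage, mem_Iic, hH.clockInv_clock hv, mem_union, mem_inter_iff,
          mem_image_of_mem H (show v ∈ Ioi (0 : ℝ) from hv), true_and, mem_compl_iff,
          not_true, false_and, or_false, hH.le_iff hv hw]
      · have h1 : clockInv H r = 1 := by
          rw [clockInv, dif_neg]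
          rintro ⟨v, hv, h⟩
          exact hr ⟨v, hv, h⟩
        simp [h1, hr]
    rw [this]
    exact (hR.inter measurableSet_Iic).union (hR.compl.inter (MeasurableSet.const _))

theorem measurable_flow (hH : IsClock φ H) : Measurable fun q : ℝ × ℝ => flow H q.1 q.2 :=
  hH.measurable_clockInv.comp ((hH.measurable.comp measurable_snd).sub measurable_fst)

/-! ### Solutions of the integral equation -/

theorem clock_eq_of_pos (hH : IsClock φ H) {V : ℝ → ℝ} {α β c : ℝ} (hαβ : α ≤ β)
    (hint : IntervalIntegrable (fun s => φ (V s)) volume α β)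
    (hV : ∀ r ∈ Icc α β, V r = c + ∫ s in α..r, φ (V s)) (hpos : ∀ r ∈ Icc α β, 0 < V r) :
    H (V β) = H c - (β - α) := by
  obtain ⟨E, hE, hd⟩ := hH.exists_countable
  have hVα : V α = c := by simpa using hV α (left_mem_Icc.2 hαβ)
  have hsubint : ∀ {r}, r ∈ Icc α β → IntervalIntegrable (fun s => φ (V s)) volume α r :=
    fun hr => hint.mono_set (by
      rw [uIcc_of_le hr.1, uIcc_of_le hαβ]; exact Icc_subset_Icc_right hr.2)
  have hVc : ContinuousOn V (Icc α β) := by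
    refine (continuousOn_const.add ?_).congr hV
    have := intervalIntegral.continuousOn_primitive_interval' hint left_mem_uIcc
    rwa [uIcc_of_le hαβ] at this
  have hanti : StrictAntiOn V (Icc α β) := by
    intro r hr s hs hrs
    have h1 : V s - V r = ∫ u in r..s, φ (V u) := by
      rw [hV r hr, hV s hs, add_sub_add_left_eq_sub,
        intervalIntegral.integral_interval_sub_left (hsubint hs) (hsubint hr)]
    have h2 : 0 < ∫ u in r..s, -φ (V u) := by
      refine intervalIntegral.intervalIntegral_pos_of_pos_on ?_ (fun u hu => ?_) hrs
      · exact (hint.mono_set (by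
          rw [uIcc_of_le hrs.le, uIcc_of_le hαβ]; exact Icc_subset_Icc hr.1 hs.2)).neg
      · exact neg_pos.2 (hH.neg _ (hpos u ⟨hr.1.trans hu.1.le, hu.2.le.trans hs.2⟩))
    rw [intervalIntegral.integral_neg] at h2
    linarith
  have hcount : (Icc α β ∩ V ⁻¹' E).Countable :=
    MapsTo.countable_of_injOn (t := E) (f := V) (fun r hr => hr.2)
      (hanti.injOn.mono inter_subset_left) hE
  have h := integral_eq_of_hasDerivAt_off_countable_of_le (fun r => H (V r)) (fun _ => -1) hαβ
    hcount (hH.continuousOn.comp hVc hpos) ?_ (by simp)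
  · rw [hVα] at h
    simp at h
    linarith
  · rintro r ⟨hr, hrE⟩
    have hr' : r ∈ Icc α β := Ioo_subset_Icc_self hr
    obtain ⟨hφ, hHd⟩ := hd (V r) (hpos r hr') fun h => hrE ⟨hr', h⟩
    have hVr : ContinuousAt V r := hVc.continuousAt (Icc_mem_nhds hr.1 hr.2)
    have hm : StronglyMeasurableAtFilter (fun s => φ (V s)) (𝓝 r) :=
      ⟨Ioc α β, Ioc_mem_nhds hr.1 hr.2, hint.1.aestronglyMeasurable⟩
    have hVd : HasDerivAt V (φ (V r)) r := by
      refine ((intervalIntegral.integral_hasDerivAt_right (hsubint hr') hm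
        (hφ.comp hVr)).const_add c).congr_of_eventuallyEq ?_
      filter_upwards [Icc_mem_nhds hr.1 hr.2] with s hs using hV s hs
    have := hHd.comp r hVd
    rwa [neg_mul, inv_mul_cancel₀ (hH.neg _ (hpos r hr')).ne] at this

/-- Solutions of the integral equation stay positive and run along the flow. -/
theorem eq_flow_of_integral (hH : IsClock φ H) {X V : ℝ → ℝ} {α β c : ℝ} (hαβ : α ≤ β)
    (hc : 0 < c) (hint : IntervalIntegrable (fun s => φ (X s)) volume α β)
    (hV : ∀ r ∈ Icc α β, V r = c + ∫ s in α..r, φ (X s)) (hXV : ∀ r ∈ Ioo α β, X r = V r) :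
    V β = flow H (β - α) c := by
  -- `X` may jump at the end points, so it is compared with the continuous path `V` on the open
  -- interval only; the integrals do not see the difference.
  have hcongr : ∀ r ∈ Icc α β, EqOn (fun s => φ (X s)) (fun s => φ (V s)) (Ioo α r) :=
    fun r hr s hs => by simp only [hXV s ⟨hs.1, hs.2.trans_le hr.2⟩]
  have hint' : IntervalIntegrable (fun s => φ (V s)) volume α β := by
    rw [intervalIntegrable_iff_integrableOn_Ioo_of_le hαβ] at hint ⊢
    exact hint.congr_fun (hcongr β (right_mem_Icc.2 hαβ)) measurableSet_Ioo
  have hV' : ∀ r ∈ Icc α β, V r = c + ∫ s in α..r, φ (V s) := fun r hr => by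
    rw [hV r hr, intervalIntegral.integral_of_le hr.1, intervalIntegral.integral_of_le hr.1,
      integral_Ioc_eq_integral_Ioo, integral_Ioc_eq_integral_Ioo,
      setIntegral_congr_fun measurableSet_Ioo (hcongr r hr)]
  have hVc : ContinuousOn V (Icc α β) := by
    refine (continuousOn_const.add ?_).congr hV'
    have := intervalIntegral.continuousOn_primitive_interval' hint' left_mem_uIcc
    rwa [uIcc_of_le hαβ] at this
  have hVα : V α = c := by simpa using hV α (left_mem_Icc.2 hαβ)
  have hkey : ∀ γ ∈ Icc α β, (∀ r ∈ Icc α γ, 0 < V r) → H (V γ) = H c - (γ - α) :=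
    fun γ hγ hpos => hH.clock_eq_of_pos hγ.1
      (hint'.mono_set (by
        rw [uIcc_of_le hγ.1, uIcc_of_le hαβ]; exact Icc_subset_Icc_right hγ.2))
      (fun r hr => hV' r ⟨hr.1, hr.2.trans hγ.2⟩) hpos
  -- The barrier `w` is where the flow would be one time unit after the end of the interval. At a
  -- first time `γ ≤ β` with `V γ = w` the clock would have dropped by `β - α + 1` during a time of
  -- at most `β - α`, so `V` stays above `w`.
  obtain ⟨w, hw, hwc, hwH⟩ := hH.exists_clock_eq (t := β - α + 1) hc (by linarith)
  have hwc' : w < c := by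
    rw [← hH.lt_iff hw hc]; linarith
  have hgt : ∀ r ∈ Icc α β, w < V r := by
    by_contra! hcon
    set T := {r ∈ Icc α β | V r ≤ w}
    have hTc : IsClosed T := hVc.preimage_isClosed_of_isClosed isClosed_Icc isClosed_Iic
    have hTb : BddBelow T := ⟨α, fun r hr => hr.1.1⟩
    obtain ⟨hγ, hγw⟩ : sInf T ∈ T := hTc.csInf_mem hcon hTb
    set γ := sInf T
    have hbelow : ∀ r ∈ Ico α γ, w < V r := fun r hr => not_le.1 fun h =>
      (csInf_le hTb (show r ∈ T from ⟨⟨hr.1, hr.2.le.trans hγ.2⟩, h⟩)).not_gt hr.2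
    have hαγ : α < γ := lt_of_le_of_ne hγ.1 fun h => by
      rw [← h, hVα] at hγw; linarith
    have hwγ : w ≤ V γ := by
      have hmem : γ ∈ closure (Ico α γ) := by
        rw [closure_Ico hαγ.ne]; exact right_mem_Icc.2 hγ.1
      have hc' : ContinuousWithinAt V (Ico α γ) γ := (hVc γ hγ).mono fun r hr =>
        ⟨hr.1, hr.2.le.trans hγ.2⟩
      have := mem_closure_iff_nhdsWithin_neBot.1 hmem
      exact ge_of_tendsto hc' (by
        filter_upwards [self_mem_nhdsWithin] with r hr using (hbelow r hr).le)
    have h := hkey γ hγ fun r hr => by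
      rcases hr.2.lt_or_eq with h | h
      · exact hw.trans (hbelow r ⟨hr.1, h⟩)
      · rw [h]; exact hw.trans_le hwγ
    rw [le_antisymm hγw hwγ, hwH] at h
    linarith [hγ.2]
  exact hH.eq_flow (hw.trans (hgt β (right_mem_Icc.2 hαβ)))
    (hkey β (right_mem_Icc.2 hαβ) fun r hr => hw.trans (hgt r hr))

end IsClock
end

noncomputable section

/-! ### Jump times of a counting path -/

/-- The first time in `[0, s]` at which the counting path `η` has reached `k`, and `s` if there is
none. It depends measurably on the values of `η` on a countable set of times. -/
def jumpTime (s : ℝ≥0) (η : ℝ≥0 → ℕ) (k : ℕ) : ℝ :=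
  ⨅ i : ℕ, if k ≤ η (min (TopologicalSpace.denseSeq ℝ≥0 i) s) then
    ((min (TopologicalSpace.denseSeq ℝ≥0 i) s : ℝ≥0) : ℝ) else s

theorem jumpTime_bddBelow (s : ℝ≥0) (η : ℝ≥0 → ℕ) (k : ℕ) :
    BddBelow (range fun i : ℕ => if k ≤ η (min (TopologicalSpace.denseSeq ℝ≥0 i) s) then
      ((min (TopologicalSpace.denseSeq ℝ≥0 i) s : ℝ≥0) : ℝ) else s) := by
  refine ⟨0, ?_⟩
  rintro _ ⟨i, rfl⟩
  dsimp only
  split_ifs <;> exact NNReal.coe_nonneg _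

theorem jumpTime_nonneg (s : ℝ≥0) (η : ℝ≥0 → ℕ) (k : ℕ) : 0 ≤ jumpTime s η k := by
  refine le_ciInf fun i => ?_
  split_ifs <;> exact NNReal.coe_nonneg _

theorem jumpTime_le (s : ℝ≥0) (η : ℝ≥0 → ℕ) (k : ℕ) : jumpTime s η k ≤ s := by
  refine (ciInf_le (jumpTime_bddBelow s η k) 0).trans ?_
  split_ifs
  · exact_mod_cast min_le_right _ _
  · exact le_rfl

theorem jumpTime_mono (s : ℝ≥0) (η : ℝ≥0 → ℕ) {k l : ℕ} (hkl : k ≤ l) :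
    jumpTime s η k ≤ jumpTime s η l := by
  refine ciInf_mono (jumpTime_bddBelow s η k) fun i => ?_
  split_ifs with h1 h2
  · exact le_rfl
  · exact_mod_cast min_le_right _ _
  · exact absurd (hkl.trans ‹_›) h1
  · exact le_rfl

/-- Only strict comparison with the jump time is made, here and in `le_of_jumpTime_lt`. The value of
`η` at the jump time itself never enters, so right continuity plays no role. -/
theorem lt_of_lt_jumpTime {s : ℝ≥0} {η : ℝ≥0 → ℕ} (hη : Monotone η) {k : ℕ} {r : ℝ≥0}
    (hr : r < jumpTime s η k) : η r < k := by
  by_contra! h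
  have h0 := jumpTime_nonneg s η k
  obtain ⟨_, ⟨i, rfl⟩, hi1, hi2⟩ := (TopologicalSpace.denseRange_denseSeq ℝ≥0).exists_between
    (show r < (⟨jumpTime s η k, h0⟩ : ℝ≥0) from hr)
  have hi2' : (TopologicalSpace.denseSeq ℝ≥0 i : ℝ) < jumpTime s η k := hi2
  have his : TopologicalSpace.denseSeq ℝ≥0 i ≤ s := by
    exact_mod_cast (hi2'.trans_le (jumpTime_le s η k)).le
  have := ciInf_le (jumpTime_bddBelow s η k) i
  simp only [min_eq_left his, if_pos (h.trans (hη hi1.le))] at this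
  exact absurd hi2' (not_lt.2 this)

theorem le_of_jumpTime_lt {s : ℝ≥0} {η : ℝ≥0 → ℕ} (hη : Monotone η) {k : ℕ} {r : ℝ≥0}
    (hrs : r ≤ s) (hr : jumpTime s η k < r) : k ≤ η r := by
  obtain ⟨i, hi⟩ := exists_lt_of_ciInf_lt hr
  split_ifs at hi with h
  · exact h.trans (hη (by exact_mod_cast hi.le))
  · exact absurd hi (not_lt.2 (by exact_mod_cast hrs))

theorem jumpTime_zero {s : ℝ≥0} {η : ℝ≥0 → ℕ} (hη : Monotone η) : jumpTime s η 0 = 0 := by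
  refine le_antisymm (not_lt.1 fun h => ?_) (jumpTime_nonneg _ _ _)
  exact absurd (lt_of_lt_jumpTime (r := 0) hη (by simpa using h)) (Nat.not_lt_zero _)

/-- The positions right after the jumps, for jump times `τ` and jump sizes `ζ`. -/
def jumpChain (H : ℝ → ℝ) (x : ℝ) (τ : ℕ → ℝ) (ζ : ℕ → ℝ) : ℕ → ℝ
  | 0 => x
  | k + 1 => flow H (τ (k + 1) - τ k) (jumpChain H x τ ζ k) + ζ k

theorem jumpChain_pos {H : ℝ → ℝ} {x : ℝ} {τ ζ : ℕ → ℝ} (hx : 0 < x) (hζ : ∀ k, 0 < ζ k) (k : ℕ) :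
    0 < jumpChain H x τ ζ k := by
  cases k with
  | zero => exact hx
  | succ k => exact add_pos (flow_pos _ _ _) (hζ k)

theorem jumpChain_congr {H : ℝ → ℝ} {x : ℝ} {τ ζ ζ' : ℕ → ℝ} {n : ℕ} (h : ∀ k < n, ζ k = ζ' k) :
    jumpChain H x τ ζ n = jumpChain H x τ ζ' n := by
  induction n with
  | zero => rfl
  | succ n ih => rw [jumpChain, jumpChain, ih fun k hk => h k (by omega), h n (by omega)]

/-- The position at time `s` after `n` jumps in `[0, s]`. -/
def jumpPosition (H : ℝ → ℝ) (s : ℝ≥0) (n : ℕ) (x : ℝ) (η : ℝ≥0 → ℕ) (ζ : ℕ → ℝ) : ℝ :=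
  flow H (s - jumpTime s η n) (jumpChain H x (jumpTime s η) ζ n)

theorem measurable_jumpTime (s : ℝ≥0) (k : ℕ) :
    Measurable fun η : ℝ≥0 → ℕ => jumpTime s η k := by
  refine Measurable.iInf fun i => Measurable.ite ?_ measurable_const measurable_const
  exact measurableSet_le measurable_const (measurable_pi_apply _)

/-- Makes the position at time `s` a function of the counting path stopped at `s`, hence independent
of later increments. -/
theorem jumpTime_stopped (s : ℝ≥0) (η : ℝ≥0 → ℕ) (k : ℕ) :
    jumpTime s (fun r => η (min r s)) k = jumpTime s η k := by
  simp [jumpTime]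

/-! ### Solutions along a path of the noise -/

/-- `X` solves the integral equation with initial value `x` and the noise that jumps by `ζ k` when
`η` counts from `k` to `k + 1`. -/
structure SolvesAlong (φ : ℝ → ℝ) (x : ℝ) (η : ℝ≥0 → ℕ) (ζ : ℕ → ℝ) (X : ℝ≥0 → ℝ) : Prop where
  start_pos : 0 < x
  mono : Monotone η
  jump_pos : ∀ k, 0 < ζ k
  integrable : ∀ t : ℝ≥0, IntervalIntegrable (fun s : ℝ => φ (X s.toNNReal)) volume 0 t
  eqn : ∀ t : ℝ≥0, X t = x + (∫ s in (0 : ℝ)..t, φ (X s.toNNReal)) + ∑ k ∈ Finset.range (η t), ζ k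

namespace IsClock

variable {φ H : ℝ → ℝ} (hH : IsClock φ H)

include hH

theorem measurable_jumpChain {n : ℕ} {α : Type*} [MeasurableSpace α] {x : α → ℝ} {τ ζ : α → ℕ → ℝ}
    (hx : Measurable x) (hτ : ∀ k, Measurable fun b => τ b k)
    (hζ : ∀ k < n, Measurable fun b => ζ b k) :
    Measurable fun b => jumpChain H (x b) (τ b) (ζ b) n := by
  induction n with
  | zero => exact hx
  | succ n ih =>
    exact (hH.measurable_flow.comp (((hτ (n + 1)).sub (hτ n)).prodMk
      (ih fun k hk => hζ k (by omega)))).add (hζ n (by omega))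

theorem measurable_jumpPosition (s : ℝ≥0) (n : ℕ) {α : Type*} [MeasurableSpace α] {x : α → ℝ}
    {η : α → ℝ≥0 → ℕ} {ζ : α → ℕ → ℝ} (hx : Measurable x) (hη : Measurable η)
    (hζ : Measurable ζ) :
    Measurable fun b => jumpPosition H s n (x b) (η b) (ζ b) := by
  refine hH.measurable_flow.comp ((measurable_const.sub
    ((measurable_jumpTime s n).comp hη)).prodMk ?_)
  exact hH.measurable_jumpChain hx (fun k => (measurable_jumpTime s k).comp hη)
    fun k _ => (measurable_pi_apply k).comp hζ

theorem flow_mono {x y t u : ℝ} (hx : 0 < x) (hxy : x ≤ y) (hu : 0 ≤ u) (hut : u ≤ t) :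
    flow H t x ≤ flow H u y := by
  have hy := hx.trans_le hxy
  rw [← hH.le_iff (flow_pos _ _ _) (flow_pos _ _ _), hH.clock_flow hx (hu.trans hut),
    hH.clock_flow hy hu]
  linarith [(hH.le_iff hx hy).2 hxy]

variable {x : ℝ} {η : ℝ≥0 → ℕ} {ζ : ℕ → ℝ} {X : ℝ≥0 → ℝ}

/-- Stated for the integral expression with `n` jumps rather than for `X`, because `X` at `β` may
already contain the next jump; the expression is then the left limit of `X`. -/
theorem segment (hX : SolvesAlong φ x η ζ X) {α β : ℝ} (hα : 0 ≤ α) (hαβ : α ≤ β) {n : ℕ}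
    (hn : ∀ r : ℝ≥0, α < r → r < β → η r = n)
    (hpos : 0 < x + (∫ s in (0 : ℝ)..α, φ (X s.toNNReal)) + ∑ k ∈ Finset.range n, ζ k) :
    x + (∫ s in (0 : ℝ)..β, φ (X s.toNNReal)) + ∑ k ∈ Finset.range n, ζ k =
      flow H (β - α) (x + (∫ s in (0 : ℝ)..α, φ (X s.toNNReal)) + ∑ k ∈ Finset.range n, ζ k) := by
  have hi : ∀ {r : ℝ}, 0 ≤ r → IntervalIntegrable (fun s : ℝ => φ (X s.toNNReal)) volume 0 r :=
    fun {r} hr => by simpa [Real.coe_toNNReal r hr] using hX.integrable r.toNNReal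
  refine hH.eq_flow_of_integral (X := fun s => X s.toNNReal)
    (V := fun r => x + (∫ s in (0 : ℝ)..r, φ (X s.toNNReal)) + ∑ k ∈ Finset.range n, ζ k)
    hαβ hpos ((hi hα).symm.trans (hi (hα.trans hαβ))) (fun r hr => ?_) fun r hr => ?_
  · have := intervalIntegral.integral_add_adjacent_intervals (hi hα)
      ((hi hα).symm.trans (hi (hα.trans hr.1)))
    rw [← this]
    ring
  · have hr0 : 0 ≤ r := hα.trans hr.1.le
    have hc : (r.toNNReal : ℝ) = r := Real.coe_toNNReal r hr0
    rw [hX.eqn, hn r.toNNReal (by rw [hc]; exact hr.1) (by rw [hc]; exact hr.2), hc]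

/-- The explicit form of the solution. -/
theorem eq_jumpPosition (hX : SolvesAlong φ x η ζ X) (s : ℝ≥0) :
    X s = jumpPosition H s (η s) x η ζ := by
  have hpos := fun k => jumpChain_pos (H := H) (τ := jumpTime s η) hX.start_pos hX.jump_pos k
  have hchain : ∀ k ≤ η s, x + (∫ u in (0 : ℝ)..(jumpTime s η k), φ (X u.toNNReal)) +
      ∑ i ∈ Finset.range k, ζ i = jumpChain H x (jumpTime s η) ζ k := by
    intro k hk
    induction k with
    | zero => simp [jumpTime_zero hX.mono, jumpChain]
    | succ k ih =>
      have ih := ih (by omega)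
      have h := hH.segment hX (n := k) (jumpTime_nonneg s η k)
        (jumpTime_mono s η (Nat.le_succ k)) (fun r hr1 hr2 => ?_) (by rw [ih]; exact hpos k)
      · rw [ih] at h
        rw [jumpChain, ← h, Finset.sum_range_succ]
        ring
      · have h1 := lt_of_lt_jumpTime hX.mono hr2
        have h2 := le_of_jumpTime_lt hX.mono
          (by exact_mod_cast (hr2.trans_le (jumpTime_le s η (k + 1))).le) hr1
        omega
  have ih := hchain _ le_rfl
  have h := hH.segment hX (n := η s) (jumpTime_nonneg s η (η s)) (jumpTime_le s η (η s))
    (fun r hr1 hr2 => ?_) (by rw [ih]; exact hpos _)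
  · rw [ih, ← hX.eqn] at h
    exact h
  · have hrs : r ≤ s := by exact_mod_cast hr2.le
    exact le_antisymm (hX.mono hrs) (le_of_jumpTime_lt hX.mono hrs hr1)

theorem solution_pos (hX : SolvesAlong φ x η ζ X) (s : ℝ≥0) : 0 < X s := by
  rw [hH.eq_jumpPosition hX s]
  exact flow_pos _ _ _

theorem eq_flow_of_no_jump (hX : SolvesAlong φ x η ζ X) {s h : ℝ≥0} (hη : η (s + h) = η s) :
    X (s + h) = flow H h (X s) := by
  have hp := hH.solution_pos hX s
  have hsh : (s : ℝ) ≤ (s + h : ℝ≥0) := by exact_mod_cast le_self_add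
  have hseg := hH.segment hX (n := η s) s.2 hsh (fun r hr1 hr2 => ?_)
    (by rw [NNReal.val_eq_coe, ← hX.eqn]; exact hp)
  · rw [NNReal.val_eq_coe, ← hX.eqn] at hseg
    rw [hX.eqn (s + h), hη, hseg]
    simp
  · refine le_antisymm ?_ (hX.mono (by exact_mod_cast hr1.le))
    rw [← hη]
    exact hX.mono (by exact_mod_cast hr2.le)

/-- The instant of the jump inside the window is unknown. Dropping the drift bounds the path from
above; letting the flow run for the full time `h` both before and after the jump bounds it from
below. Both bounds tend to `X s + ζ (η s)` as `h → 0`. -/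
theorem bounds_of_one_jump (hX : SolvesAlong φ x η ζ X) {s h : ℝ≥0}
    (hη : η (s + h) = η s + 1) :
    flow H h (flow H h (X s) + ζ (η s)) ≤ X (s + h) ∧ X (s + h) ≤ X s + ζ (η s) := by
  have hp := hH.solution_pos hX s
  set n := η s with hn
  set σ := jumpTime (s + h) η (n + 1)
  have hσ0 : 0 ≤ σ := jumpTime_nonneg _ _ _
  have hσh : σ ≤ (s + h : ℝ≥0) := jumpTime_le _ _ _
  have hsσ : (s : ℝ) ≤ σ := not_lt.1 fun hlt => by
    have := le_of_jumpTime_lt hX.mono (le_self_add (b := h)) hlt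
    omega
  have h1 := hH.segment hX (n := n) s.2 hsσ (fun r hr1 hr2 => ?_)
    (by rw [NNReal.val_eq_coe, ← hX.eqn]; exact hp)
  · rw [NNReal.val_eq_coe, ← hX.eqn] at h1
    have h1' : x + (∫ u in (0 : ℝ)..σ, φ (X u.toNNReal)) + ∑ k ∈ Finset.range (n + 1), ζ k =
        flow H (σ - s) (X s) + ζ n := by
      rw [Finset.sum_range_succ, ← add_assoc, h1]
    have hζ := hX.jump_pos n
    have h2 := hH.segment hX (n := n + 1) hσ0 hσh (fun r hr1 hr2 => ?_)
      (by rw [h1']; exact add_pos (flow_pos _ _ _) hζ)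
    · rw [← hη, ← hX.eqn, hη, h1'] at h2
      have e : ((s + h : ℝ≥0) : ℝ) = s + h := NNReal.coe_add s h
      have hle : flow H (σ - s) (X s) ≤ X s := hH.flow_le hp (by linarith)
      rw [h2]
      constructor
      · refine hH.flow_mono (add_pos (flow_pos _ _ _) hζ) ?_ (by linarith) (by linarith)
        gcongr
        exact hH.flow_mono hp le_rfl (by linarith) (by linarith)
      · exact (hH.flow_le (add_pos (flow_pos _ _ _) hζ) (by linarith)).trans (by linarith)
    · have hrs : r ≤ s + h := by exact_mod_cast hr2.le
      refine le_antisymm ?_ (le_of_jumpTime_lt hX.mono hrs hr1)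
      rw [← hη]
      exact hX.mono hrs
  · have := lt_of_lt_jumpTime hX.mono hr2
    have := hX.mono (show s ≤ r by exact_mod_cast hr1.le)
    omega

end IsClock
end

noncomputable section

/-! ### Independence of the past and the next jump -/

/-- Independent increments are used along a monotone sequence of times, so a finite set of times is
placed on a grid that starts at `0` and has `[s, u]` as its `m`-th step. -/
theorem exists_monotone_cover (J : Finset ℝ≥0) :
    ∀ s u : ℝ≥0, (∀ r ∈ J, r ≤ s) → s ≤ u → ∃ (τ : ℕ → ℝ≥0) (m : ℕ), Monotone τ ∧ τ 0 = 0 ∧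
      τ m = s ∧ τ (m + 1) = u ∧ ∀ r ∈ J, ∃ i ≤ m, τ i = r := by
  induction J using Finset.induction_on_max with
  | empty =>
    intro s u _ hsu
    refine ⟨fun i => if i = 0 then 0 else if i = 1 then s else u, 1,
      monotone_nat_of_le_succ fun i => ?_, by simp, by simp, by simp, by simp⟩
    rcases i with - | - | i <;> simp [hsu]
  | insert a J ha ih =>
    intro s u hs hsu
    obtain ⟨τ, m, hτ, h0, hm, hm1, hJ⟩ := ih a s (fun r hr => (ha r hr).le)
      (hs a (Finset.mem_insert_self a J))
    refine ⟨fun i => if i ≤ m + 1 then τ i else u, m + 1, fun i j hij => ?_, by simp [h0],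
      by simp [hm1], by simp, fun r hr => ?_⟩
    · dsimp only
      split_ifs with h1 h2
      · exact hτ hij
      · exact (hτ h1).trans (hm1.le.trans hsu)
      · omega
      · exact le_rfl
    · rcases Finset.mem_insert.1 hr with rfl | hr
      · exact ⟨m, by omega, by simp [hm]⟩
      · obtain ⟨i, hi, rfl⟩ := hJ r hr
        exact ⟨i, by omega, by simp [show i ≤ m + 1 by omega]⟩

variable {Ω : Type*} {mΩ : MeasurableSpace Ω} {P : Measure Ω} [IsProbabilityMeasure P]

/-- By finite-dimensional distributions: each value `N (min r s)` is a sum of grid increments of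
index below `m`, using `N 0 = 0`, while the increment after `s` has index `m`. -/
theorem IsUnitPoissonProcess.indepFun_stopped {N : ℝ≥0 → Ω → ℕ} (hN : IsUnitPoissonProcess N P)
    (s h : ℝ≥0) :
    IndepFun (fun ω (r : ℝ≥0) => N (min r s) ω) (fun ω => N (s + h) ω - N s ω) P := by
  have hNm : ∀ t, Measurable fun ω => (N t ω : ℝ) := fun t =>
    measurable_from_nat.comp (hN.measurable t)
  have hreal : IndepFun (fun ω (r : ℝ≥0) => (N (min r s) ω : ℝ))
      (fun ω => (N (s + h) ω : ℝ) - N s ω) P := by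
    refine IndepFun.process_indepFun (fun r => hNm _) ((hNm _).sub (hNm _)) fun I => ?_
    obtain ⟨τ, m, hτ, h0, hm, hm1, hJ⟩ := exists_monotone_cover (I.image fun r => min r s) s (s + h)
      (fun r hr => by
        obtain ⟨q, -, rfl⟩ := Finset.mem_image.1 hr
        exact min_le_right _ _) le_self_add
    have hJ' : ∀ i : I, ∃ j ≤ m, τ j = min (i : ℝ≥0) s := fun i =>
      hJ _ (Finset.mem_image_of_mem _ i.2)
    choose idx hidx hτidx using hJ'
    have hind := (hN.increments_indep.nat hτ).indepFun_finset (Finset.range m) {m} (by simp)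
      fun i => (hNm _).sub (hNm _)
    have hG : Measurable fun (v : Finset.range m → ℝ) (i : I) =>
        ∑ j : Finset.range m, if (j : ℕ) < idx i then v j else 0 := by
      refine measurable_pi_lambda _ fun i => Finset.measurable_sum _ fun j _ => ?_
      split_ifs
      · exact measurable_pi_apply j
      · exact measurable_const
    have hcomp := hind.comp hG (measurable_pi_apply (⟨m, Finset.mem_singleton_self m⟩ :
      ({m} : Finset ℕ)))
    refine hcomp.congr ?_ ?_
    · filter_upwards [hN.zero] with ω hω
      funext i
      simp only [Function.comp_apply]
      rw [Finset.sum_coe_sort (Finset.range m)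
        (fun j => if j < idx i then (N (τ (j + 1)) ω : ℝ) - N (τ j) ω else 0),
        ← Finset.sum_filter]
      have hf : (Finset.range m).filter (fun j => j < idx i) = Finset.range (idx i) := by
        ext j
        simp only [Finset.mem_filter, Finset.mem_range]
        have := hidx i
        omega
      rw [hf, Finset.sum_range_sub (fun j => (N (τ j) ω : ℝ)), hτidx, h0, hω]
      simp
    · refine ae_of_all _ fun ω => ?_
      simp [hm, hm1]
  -- The floor returns from the real-valued process to `ℕ`; by monotonicity the truncated difference
  -- of naturals is almost surely the real difference.
  have hfl : Measurable fun (v : ℝ≥0 → ℝ) (r : ℝ≥0) => ⌊v r⌋₊ :=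
    measurable_pi_lambda _ fun r => Nat.measurable_floor.comp (measurable_pi_apply r)
  refine (hreal.comp hfl Nat.measurable_floor).congr (ae_of_all _ fun ω => ?_) ?_
  · funext r
    simp
  · filter_upwards [hN.mono] with ω hω
    have hle : N s ω ≤ N (s + h) ω := hω le_self_add
    rw [Function.comp_apply, ← Nat.cast_sub hle, Nat.floor_natCast]

omit [IsProbabilityMeasure P] in
theorem IsUnitPoissonProcess.measure_increment {N : ℝ≥0 → Ω → ℕ} (hN : IsUnitPoissonProcess N P)
    (s h : ℝ≥0) (j : ℕ) : P {ω | N (s + h) ω - N s ω = j} = poissonMeasure h {j} := by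
  have hNm : ∀ t, Measurable fun ω => (N t ω : ℝ) := fun t =>
    measurable_from_nat.comp (hN.measurable t)
  have h1 := congrArg (fun ν : Measure ℝ => ν {(j : ℝ)}) (hN.increments_law s (s + h) le_self_add)
  simp only [add_tsub_cancel_left] at h1
  rw [Measure.map_apply ((hNm (s + h)).fun_sub (hNm s)) (measurableSet_singleton _),
    Measure.map_apply measurable_from_nat (measurableSet_singleton _)] at h1
  have e1 : (fun n : ℕ => (n : ℝ)) ⁻¹' {(j : ℝ)} = {j} := by ext; simp
  rw [e1] at h1
  rw [← h1]
  refine measure_congr ?_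
  filter_upwards [hN.mono] with ω hω
  have hle : N s ω ≤ N (s + h) ω := hω le_self_add
  refine propext ?_
  change N (s + h) ω - N s ω = j ↔ (N (s + h) ω : ℝ) - N s ω = j
  rw [← Nat.cast_sub hle, Nat.cast_inj]

/-- Used with `a` the earlier jump sizes, `b` the next one, `c` the stopped counting path and `d`
its next increment: restricting to events of `b` and `d` only scales the law of the past `(a, c)`.
Rectangles determine the measure. -/
theorem map_prodMk_restrict_of_indepFun {α β γ δ : Type*} [MeasurableSpace α] [MeasurableSpace β]
    [MeasurableSpace γ] [MeasurableSpace δ] {a : Ω → α} {b : Ω → β} {c : Ω → γ} {d : Ω → δ}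
    (ha : Measurable a) (hc : Measurable c)
    (hab : IndepFun a b P) (hcd : IndepFun c d P)
    (h : IndepFun (fun ω => (a ω, b ω)) (fun ω => (c ω, d ω)) P) {B : Set β} (hB : MeasurableSet B)
    {D : Set δ} (hD : MeasurableSet D) :
    (P.restrict (b ⁻¹' B ∩ d ⁻¹' D)).map (fun ω => (a ω, c ω)) =
      (P (b ⁻¹' B) * P (d ⁻¹' D)) • P.map fun ω => (a ω, c ω) := by
  have hac : IndepFun a c P := h.comp measurable_fst measurable_fst
  refine Measure.ext_prod fun {S T} hS hT => ?_
  rw [Measure.map_apply (ha.prodMk hc) (hS.prod hT), Measure.smul_apply,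
    Measure.map_apply (ha.prodMk hc) (hS.prod hT),
    Measure.restrict_apply ((ha.prodMk hc) (hS.prod hT))]
  have e1 : (fun ω => (a ω, c ω)) ⁻¹' S ×ˢ T ∩ (b ⁻¹' B ∩ d ⁻¹' D) =
      (fun ω => (a ω, b ω)) ⁻¹' S ×ˢ B ∩ (fun ω => (c ω, d ω)) ⁻¹' T ×ˢ D := by
    ext ω; simp; tauto
  have e2 : (fun ω => (a ω, b ω)) ⁻¹' S ×ˢ B = a ⁻¹' S ∩ b ⁻¹' B := by ext ω; simp
  have e3 : (fun ω => (c ω, d ω)) ⁻¹' T ×ˢ D = c ⁻¹' T ∩ d ⁻¹' D := by ext ω; simp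
  have e4 : (fun ω => (a ω, c ω)) ⁻¹' S ×ˢ T = a ⁻¹' S ∩ c ⁻¹' T := by ext ω; simp
  rw [e1, h.measure_inter_preimage_eq_mul _ _ (hS.prod hB) (hT.prod hD), e2, e3, e4,
    hab.measure_inter_preimage_eq_mul _ _ hS hB, hcd.measure_inter_preimage_eq_mul _ _ hT hD,
    hac.measure_inter_preimage_eq_mul _ _ hS hT, smul_eq_mul]
  ring

omit [IsProbabilityMeasure P] in
theorem measure_eq_tsum_inter {N : Ω → ℕ} (hN : Measurable N) {E : Set Ω} (hE : MeasurableSet E) :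
    P E = ∑' n, P (E ∩ {ω | N ω = n}) := by
  have hm : ∀ n, MeasurableSet {ω | N ω = n} := fun n => hN (measurableSet_singleton n)
  rw [← measure_iUnion _ fun n => hE.inter (hm n), ← inter_iUnion]
  · congr 1
    ext ω
    simp
  · intro i j hij
    refine disjoint_left.2 fun ω h1 h2 => hij (h1.2.symm.trans h2.2)

/-- The counting process and the jump sizes of a compound Poisson process. -/
structure IsJumpNoise (μ : Measure ℝ) (N : ℝ≥0 → Ω → ℕ) (ξ : ℕ → Ω → ℝ) (P : Measure Ω) :
    Prop where
  poisson : IsUnitPoissonProcess N P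
  measurable : ∀ k, Measurable (ξ k)
  law : ∀ k, P.map (ξ k) = μ
  iIndep : iIndepFun ξ P
  indep : IndepFun (fun ω k => ξ k ω) (fun ω t => N t ω) P

namespace IsJumpNoise

variable {μ : Measure ℝ} {N : ℝ≥0 → Ω → ℕ} {ξ : ℕ → Ω → ℝ}

/-- Sizes of index at least `n` are replaced by the dummy value `1`, so that the past is a function
of the first `n` sizes and independent of `ξ n`. By `jumpChain_congr` the dummy does not affect the
position after `n` jumps. -/
theorem map_restrict_past (hJ : IsJumpNoise μ N ξ P) (s h : ℝ≥0) (n j : ℕ) {B : Set ℝ}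
    (hB : MeasurableSet B) :
    (P.restrict ({ω | ξ n ω ∈ B} ∩ {ω | N (s + h) ω - N s ω = j})).map
        (fun ω => ((fun k => if k < n then ξ k ω else 1 : ℕ → ℝ), fun r => N (min r s) ω)) =
      (μ B * poissonMeasure h {j}) •
        P.map fun ω => ((fun k => if k < n then ξ k ω else 1 : ℕ → ℝ), fun r => N (min r s) ω) := by
  have hU : Measurable fun ω => (fun k => if k < n then ξ k ω else 1 : ℕ → ℝ) := by
    refine measurable_pi_lambda _ fun k => ?_
    split_ifs
    exacts [hJ.measurable k, measurable_const]
  have hη : Measurable fun ω (r : ℝ≥0) => N (min r s) ω :=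
    measurable_pi_lambda _ fun r => hJ.poisson.measurable _
  have hUξ : IndepFun (fun ω => (fun k => if k < n then ξ k ω else 1 : ℕ → ℝ)) (ξ n) P := by
    have h1 := hJ.iIndep.indepFun_finset (Finset.range n) {n} (by simp) hJ.measurable
    have hG : Measurable fun (v : Finset.range n → ℝ) (k : ℕ) =>
        if hk : k < n then v ⟨k, Finset.mem_range.2 hk⟩ else 1 := by
      refine measurable_pi_lambda _ fun k => ?_
      split_ifs
      exacts [measurable_pi_apply _, measurable_const]
    refine (h1.comp hG (measurable_pi_apply (⟨n, Finset.mem_singleton_self n⟩ :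
      ({n} : Finset ℕ)))).congr (ae_of_all _ fun ω => ?_) (ae_of_all _ fun ω => rfl)
    funext k
    simp
  have hjoint : IndepFun (fun ω => ((fun k => if k < n then ξ k ω else 1 : ℕ → ℝ), ξ n ω))
      (fun ω => ((fun r => N (min r s) ω), N (s + h) ω - N s ω)) P := by
    have hG1 : Measurable fun v : ℕ → ℝ => ((fun k => if k < n then v k else 1 : ℕ → ℝ), v n) := by
      refine Measurable.prodMk (measurable_pi_lambda _ fun k => ?_) (measurable_pi_apply n)
      split_ifs
      exacts [measurable_pi_apply _, measurable_const]
    have hG2 : Measurable fun v : ℝ≥0 → ℕ => ((fun r => v (min r s)), v (s + h) - v s) :=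
      Measurable.prodMk (measurable_pi_lambda _ fun r => measurable_pi_apply _)
        ((measurable_pi_apply _).sub (measurable_pi_apply _))
    exact hJ.indep.comp hG1 hG2
  have := map_prodMk_restrict_of_indepFun hU hη hUξ (hJ.poisson.indepFun_stopped s h) hjoint hB
    (measurableSet_singleton j)
  have e : P (ξ n ⁻¹' B) = μ B := by rw [← hJ.law n, Measure.map_apply (hJ.measurable n) hB]
  have e' : P ((fun ω => N (s + h) ω - N s ω) ⁻¹' {j}) = poissonMeasure h {j} :=
    hJ.poisson.measure_increment s h j
  rw [e, e'] at this
  exact this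

omit [IsProbabilityMeasure P] in
theorem measurable_nextJump (hJ : IsJumpNoise μ N ξ P) (s : ℝ≥0) :
    Measurable fun ω => ξ (N s ω) ω :=
  (measurable_from_prod_countable_right (f := fun q : ℕ × Ω => ξ q.1 q.2) hJ.measurable).comp
    ((hJ.poisson.measurable s).prodMk measurable_id)

variable [IsProbabilityMeasure μ] {φ H : ℝ → ℝ} {x : ℝ} {X : ℝ≥0 → Ω → ℝ}

/-- The Markov property in the form needed. The next jump has the random index `N s`, so the event
is split according to `N s = n`; on each piece `X s` is the explicit function of the past from
`IsClock.eq_jumpPosition`, and the pieces are summed again. -/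
theorem map_restrict_increment (hJ : IsJumpNoise μ N ξ P) (hH : IsClock φ H)
    (hXm : ∀ t, Measurable (X t))
    (hX : ∀ᵐ ω ∂P, SolvesAlong φ x (fun t => N t ω) (fun k => ξ k ω) (fun t => X t ω))
    (s h : ℝ≥0) (j : ℕ) :
    (P.restrict {ω | N (s + h) ω - N s ω = j}).map (fun ω => (X s ω, ξ (N s ω) ω)) =
      poissonMeasure h {j} • (P.map (X s)).prod μ := by
  have := Measure.isProbabilityMeasure_map (μ := P) (hXm s).aemeasurable
  have hξN := hJ.measurable_nextJump s
  have hΔ : MeasurableSet {ω | N (s + h) ω - N s ω = j} :=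
    ((hJ.poisson.measurable _).sub (hJ.poisson.measurable _)) (measurableSet_singleton j)
  refine Measure.ext_prod fun {A B} hA hB => ?_
  rw [Measure.map_apply ((hXm s).prodMk hξN) (hA.prod hB), Measure.smul_apply,
    Measure.prod_prod, Measure.map_apply (hXm s) hA,
    Measure.restrict_apply (((hXm s).prodMk hξN) (hA.prod hB)),
    measure_eq_tsum_inter (hJ.poisson.measurable s)
      ((((hXm s).prodMk hξN) (hA.prod hB)).inter hΔ),
    measure_eq_tsum_inter (hJ.poisson.measurable s) (hXm s hA), smul_eq_mul,
    ← ENNReal.tsum_mul_right, ← ENNReal.tsum_mul_left]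
  refine tsum_congr fun n => ?_
  set S : Set ((ℕ → ℝ) × (ℝ≥0 → ℕ)) := {q | jumpPosition H s n x q.2 q.1 ∈ A ∧ q.2 s = n}
  have hS : MeasurableSet S :=
    (hH.measurable_jumpPosition s n measurable_const measurable_snd measurable_fst hA).inter
      (measurableSet_eq_fun ((measurable_pi_apply s).comp measurable_snd) measurable_const)
  set Z : Ω → (ℕ → ℝ) × (ℝ≥0 → ℕ) := fun ω =>
    ((fun k => if k < n then ξ k ω else 1 : ℕ → ℝ), fun r => N (min r s) ω)
  have hZ : Measurable Z := by
    refine Measurable.prodMk (measurable_pi_lambda _ fun k => ?_)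
      (measurable_pi_lambda _ fun r => hJ.poisson.measurable _)
    split_ifs
    exacts [hJ.measurable k, measurable_const]
  have hZS : ∀ᵐ ω ∂P, (Z ω ∈ S ↔ X s ω ∈ A ∧ N s ω = n) := by
    filter_upwards [hX] with ω hω
    have hpos := hH.eq_jumpPosition hω s
    have e1 : jumpPosition H s n x (fun r => N (min r s) ω)
        (fun k => if k < n then ξ k ω else 1) =
        jumpPosition H s n x (fun r => N r ω) (fun k => ξ k ω) := by
      have e2 : jumpTime s (fun r => N (min r s) ω) = jumpTime s (fun r => N r ω) :=
        funext (jumpTime_stopped s fun r => N r ω)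
      rw [jumpPosition, jumpPosition, e2]
      congr 1
      exact jumpChain_congr fun k hk => if_pos hk
    change (jumpPosition H s n x (fun r => N (min r s) ω)
        (fun k => if k < n then ξ k ω else 1) ∈ A ∧ N (min s s) ω = n) ↔ _
    rw [e1, min_self]
    refine and_congr_left fun hn => ?_
    rw [hpos, hn]
  have hmain := congrArg (fun ν => ν S) (hJ.map_restrict_past s h n j hB)
  simp only [Measure.smul_apply, smul_eq_mul] at hmain
  rw [Measure.map_apply hZ hS, Measure.map_apply hZ hS, Measure.restrict_apply (hZ hS)] at hmain
  have e1 : P ((fun ω => (X s ω, ξ (N s ω) ω)) ⁻¹' A ×ˢ B ∩ {ω | N (s + h) ω - N s ω = j} ∩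
      {ω | N s ω = n}) = P (Z ⁻¹' S ∩ ({ω | ξ n ω ∈ B} ∩ {ω | N (s + h) ω - N s ω = j})) := by
    refine measure_congr ?_
    filter_upwards [hZS] with ω hω
    refine propext ?_
    change ((X s ω ∈ A ∧ ξ (N s ω) ω ∈ B) ∧ N (s + h) ω - N s ω = j) ∧ N s ω = n ↔
      Z ω ∈ S ∧ ξ n ω ∈ B ∧ N (s + h) ω - N s ω = j
    rw [hω]
    constructor
    · rintro ⟨⟨⟨h1, h2⟩, h3⟩, h4⟩
      exact ⟨⟨h1, h4⟩, h4 ▸ h2, h3⟩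
    · rintro ⟨⟨h1, h4⟩, h2, h3⟩
      exact ⟨⟨⟨h1, h4.symm ▸ h2⟩, h3⟩, h4⟩
  have e2 : P (X s ⁻¹' A ∩ {ω | N s ω = n}) = P (Z ⁻¹' S) := by
    refine measure_congr ?_
    filter_upwards [hZS] with ω hω
    exact propext hω.symm
  rw [e1, hmain, e2]
  ring

end IsJumpNoise
end

noncomputable section

/-! ### Small time increments -/

variable {Ω : Type*} {mΩ : MeasurableSpace Ω} {P : Measure Ω} [IsProbabilityMeasure P]

namespace IsJumpNoise

variable {μ : Measure ℝ} {N : ℝ≥0 → Ω → ℕ} {ξ : ℕ → Ω → ℝ}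

omit [IsProbabilityMeasure P] in
theorem measurableSet_increment (hJ : IsJumpNoise μ N ξ P) (s h : ℝ≥0) (A : Set ℕ) :
    MeasurableSet {ω | N (s + h) ω - N s ω ∈ A} :=
  ((hJ.poisson.measurable _).sub (hJ.poisson.measurable _)) (.of_discrete (s := A))

omit [IsProbabilityMeasure P] in
theorem real_increment_eq_zero (hJ : IsJumpNoise μ N ξ P) (s h : ℝ≥0) :
    P.real {ω | N (s + h) ω - N s ω = 0} = Real.exp (-h) := by
  rw [measureReal_def, hJ.poisson.measure_increment, ← measureReal_def,
    poissonMeasure_real_singleton]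
  simp

omit [IsProbabilityMeasure P] in
theorem real_increment_eq_one (hJ : IsJumpNoise μ N ξ P) (s h : ℝ≥0) :
    P.real {ω | N (s + h) ω - N s ω = 1} = h * Real.exp (-h) := by
  rw [measureReal_def, hJ.poisson.measure_increment, ← measureReal_def,
    poissonMeasure_real_singleton]
  simp [mul_comm]

omit [IsProbabilityMeasure P] in
theorem integral_eq_add_increment (hJ : IsJumpNoise μ N ξ P) (s h : ℝ≥0) {g : Ω → ℝ}
    (hg : Integrable g P) :
    ∫ ω, g ω ∂P = ∫ ω in {ω | N (s + h) ω - N s ω = 0}, g ω ∂P +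
      ∫ ω in {ω | N (s + h) ω - N s ω = 1}, g ω ∂P +
      ∫ ω in {ω | 2 ≤ N (s + h) ω - N s ω}, g ω ∂P := by
  have h1 : MeasurableSet {ω | N (s + h) ω - N s ω = 1} := hJ.measurableSet_increment s h {1}
  have h2 : MeasurableSet {ω | 2 ≤ N (s + h) ω - N s ω} :=
    hJ.measurableSet_increment s h (Ici 2)
  rw [← setIntegral_union _ h1 hg.integrableOn hg.integrableOn,
    ← setIntegral_union _ h2 hg.integrableOn hg.integrableOn, ← setIntegral_univ]
  · congr 2
    ext ω
    simp only [mem_univ, mem_union, mem_ofPred_eq, true_iff]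
    omega
  · refine disjoint_left.2 fun ω hω hω' => ?_
    simp only [mem_union, mem_ofPred_eq] at hω hω'
    omega
  · refine disjoint_left.2 fun ω hω hω' => ?_
    simp only [mem_ofPred_eq] at hω hω'
    omega

/-- The probability is `1 - (1 + h) e^{-h}`, and `e^{-h} ≥ 1 - h`. -/
theorem real_two_le_increment (hJ : IsJumpNoise μ N ξ P) (s h : ℝ≥0) :
    P.real {ω | 2 ≤ N (s + h) ω - N s ω} ≤ (h : ℝ) ^ 2 := by
  have h1 := hJ.integral_eq_add_increment s h (integrable_const (1 : ℝ))
  simp only [integral_const, measureReal_restrict_apply_univ, probReal_univ, smul_eq_mul,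
    mul_one, hJ.real_increment_eq_zero, hJ.real_increment_eq_one] at h1
  have h2 := Real.one_sub_le_exp_neg (h : ℝ)
  have h3 : (0 : ℝ) ≤ h := h.2
  nlinarith

theorem norm_setIntegral_two_le_increment_le (hJ : IsJumpNoise μ N ξ P) (s h : ℝ≥0) {g : Ω → ℝ}
    {C : ℝ} (hC : ∀ ω, |g ω| ≤ C) :
    |∫ ω in {ω | 2 ≤ N (s + h) ω - N s ω}, g ω ∂P| ≤ C * (h : ℝ) ^ 2 := by
  obtain ⟨ω₀⟩ : Nonempty Ω := nonempty_of_isProbabilityMeasure P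
  have hC0 : 0 ≤ C := (abs_nonneg _).trans (hC ω₀)
  rw [← Real.norm_eq_abs]
  refine (norm_setIntegral_le_of_norm_le_const (measure_lt_top P _) fun ω _ => hC ω).trans ?_
  exact mul_le_mul_of_nonneg_left (hJ.real_two_le_increment s h) hC0

variable [IsProbabilityMeasure μ] {φ H : ℝ → ℝ} {x : ℝ} {X : ℝ≥0 → Ω → ℝ}

theorem setIntegral_increment (hJ : IsJumpNoise μ N ξ P) (hH : IsClock φ H)
    (hXm : ∀ t, Measurable (X t))
    (hX : ∀ᵐ ω ∂P, SolvesAlong φ x (fun t => N t ω) (fun k => ξ k ω) (fun t => X t ω))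
    (s h : ℝ≥0) (j : ℕ) {f : ℝ × ℝ → ℝ} (hf : Measurable f) :
    ∫ ω in {ω | N (s + h) ω - N s ω = j}, f (X s ω, ξ (N s ω) ω) ∂P =
      P.real {ω | N (s + h) ω - N s ω = j} * ∫ q, f q ∂((P.map (X s)).prod μ) := by
  have h1 := hJ.map_restrict_increment hH hXm hX s h j
  rw [← integral_map (φ := fun ω => (X s ω, ξ (N s ω) ω)) (f := f)
    ((hXm s).prodMk (hJ.measurable_nextJump s)).aemeasurable hf.aestronglyMeasurable, h1,
    integral_smul_measure, measureReal_def, hJ.poisson.measure_increment, smul_eq_mul]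

/-- The two-sided bound for expectations of antitone functions after a small time step. -/
theorem forward_bounds (hJ : IsJumpNoise μ N ξ P) (hH : IsClock φ H)
    (hXm : ∀ t, Measurable (X t))
    (hX : ∀ᵐ ω ∂P, SolvesAlong φ x (fun t => N t ω) (fun k => ξ k ω) (fun t => X t ω))
    (s h : ℝ≥0) {c : ℝ → ℝ} (hc : Continuous c) (hanti : Antitone c) (h0 : ∀ r, 0 ≤ c r)
    (h1 : ∀ r, c r ≤ 1) :
    Real.exp (-h) * ∫ w, c (H w - h) ∂(P.map (X s)) +
        h * Real.exp (-h) * ∫ q, c (H (q.1 + q.2)) ∂((P.map (X s)).prod μ) ≤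
      ∫ w, c (H w) ∂(P.map (X (s + h))) ∧
    ∫ w, c (H w) ∂(P.map (X (s + h))) ≤
      Real.exp (-h) * ∫ w, c (H w - h) ∂(P.map (X s)) +
        h * Real.exp (-h) * ∫ q, c (H (flow H h q.1 + q.2) - h) ∂((P.map (X s)).prod μ) +
        (h : ℝ) ^ 2 := by
  have hHm := hH.measurable
  have hfm : Measurable fun w => flow H h w :=
    hH.measurable_flow.comp (measurable_const.prodMk measurable_id)
  have hcm := hc.measurable
  have hint : ∀ {g : Ω → ℝ}, Measurable g → Integrable (fun ω => c (g ω)) P := fun {g} hg =>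
    Integrable.of_bound (hcm.comp hg).aestronglyMeasurable 1 (ae_of_all _ fun ω => by
      rw [Real.norm_of_nonneg (h0 _)]; exact h1 _)
  have hgX := hint (hHm.comp (hXm (s + h)))
  have hξ := hJ.measurable_nextJump s
  have hs0 := hJ.measurableSet_increment s h {0}
  have hs1 := hJ.measurableSet_increment s h {1}
  rw [integral_map (f := fun w => c (H w)) (hXm (s + h)).aemeasurable
    (hcm.comp hHm).aestronglyMeasurable]
  have hsplit := hJ.integral_eq_add_increment s h hgX
  simp only [Function.comp_def] at hsplit
  have e0 : ∫ ω in {ω | N (s + h) ω - N s ω = 0}, c (H (X (s + h) ω)) ∂P =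
      Real.exp (-h) * ∫ w, c (H w - h) ∂(P.map (X s)) := by
    have := Measure.isProbabilityMeasure_map (μ := P) (hXm s).aemeasurable
    have hfst : ∫ q, c (H q.1 - h) ∂((P.map (X s)).prod μ) = ∫ w, c (H w - h) ∂(P.map (X s)) := by
      rw [integral_fun_fst (fun w => c (H w - h))]
      simp
    rw [← hfst, ← hJ.real_increment_eq_zero s h, ← hJ.setIntegral_increment hH hXm hX s h 0
      (f := fun q => c (H q.1 - h)) (hcm.comp ((hHm.comp measurable_fst).sub_const _))]
    refine setIntegral_congr_ae hs0 ?_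
    filter_upwards [hX] with ω hω hΔ
    have hle : N s ω ≤ N (s + h) ω := hω.mono le_self_add
    have hΔ : N (s + h) ω - N s ω = 0 := hΔ
    rw [hH.eq_flow_of_no_jump hω (by omega), hH.clock_flow (hH.solution_pos hω s) h.coe_nonneg]
  have hl := hJ.setIntegral_increment hH hXm hX s h 1 (f := fun q => c (H (q.1 + q.2)))
      (hcm.comp (hHm.comp (by fun_prop)))
  have hu := hJ.setIntegral_increment hH hXm hX s h 1
      (f := fun q => c (H (flow H h q.1 + q.2) - h))
      (hcm.comp ((hHm.comp ((hfm.comp measurable_fst).add measurable_snd)).sub_const _))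
  rw [hJ.real_increment_eq_one] at hl hu
  have e2 := hJ.norm_setIntegral_two_le_increment_le s h (g := fun ω => c (H (X (s + h) ω)))
    (C := 1) fun ω => by rw [abs_of_nonneg (h0 _)]; exact h1 _
  have e2' : 0 ≤ ∫ ω in {ω | 2 ≤ N (s + h) ω - N s ω}, c (H (X (s + h) ω)) ∂P :=
    integral_nonneg fun ω => h0 _
  -- `c ∘ H` is antitone on `(0,∞)`, so the upper bound for the path gives the lower bound for the
  -- expectation, and conversely in `b2`.
  have b1 : ∫ ω in {ω | N (s + h) ω - N s ω = 1}, c (H (X s ω + ξ (N s ω) ω)) ∂P ≤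
      ∫ ω in {ω | N (s + h) ω - N s ω = 1}, c (H (X (s + h) ω)) ∂P := by
    refine setIntegral_mono_ae_restrict (hint (hHm.comp ((hXm s).add hξ))).integrableOn
      hgX.integrableOn ?_
    refine (ae_restrict_iff' hs1).2 ?_
    filter_upwards [hX] with ω hω hΔ
    have hΔ : N (s + h) ω - N s ω = 1 := hΔ
    have hb := hH.bounds_of_one_jump (s := s) (h := h) hω (by omega)
    exact hanti ((hH.le_iff (hH.solution_pos hω _)
      (add_pos (hH.solution_pos hω _) (hω.jump_pos _))).2 hb.2)
  have b2 : ∫ ω in {ω | N (s + h) ω - N s ω = 1}, c (H (X (s + h) ω)) ∂P ≤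
      ∫ ω in {ω | N (s + h) ω - N s ω = 1}, c (H (flow H h (X s ω) + ξ (N s ω) ω) - h) ∂P := by
    refine setIntegral_mono_ae_restrict hgX.integrableOn
      (hint ((hHm.comp ((hfm.comp (hXm s)).add hξ)).sub_const _)).integrableOn ?_
    refine (ae_restrict_iff' hs1).2 ?_
    filter_upwards [hX] with ω hω hΔ
    have hΔ : N (s + h) ω - N s ω = 1 := hΔ
    have hb := hH.bounds_of_one_jump (s := s) (h := h) hω (by omega)
    refine hanti ?_
    have hp : 0 < flow H h (X s ω) + ξ (N s ω) ω := add_pos (flow_pos _ _ _) (hω.jump_pos _)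
    have := (hH.le_iff (flow_pos _ _ _) (hH.solution_pos hω _)).2 hb.1
    rw [hH.clock_flow hp h.coe_nonneg] at this
    exact this
  rw [hsplit, e0]
  rw [abs_le] at e2
  constructor <;> linarith [e2.2]

end IsJumpNoise
end

noncomputable section

/-! ### The forward equation -/

/-- The family `m` of probability measures on `(0,∞)` satisfies the two-sided bounds for small time
steps of the process that follows the flow with clock `H` and jumps at rate `1` with law `μ`. -/
structure IsForward (H : ℝ → ℝ) (μ : Measure ℝ) (m : ℝ≥0 → Measure ℝ) : Prop where
  prob : ∀ s, IsProbabilityMeasure (m s)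
  carried : ∀ s, ∀ᵐ w ∂(m s), 0 < w
  bounds : ∀ (s h : ℝ≥0) (c : ℝ → ℝ), Continuous c → Antitone c → (∀ r, 0 ≤ c r) →
    (∀ r, c r ≤ 1) →
    Real.exp (-h) * ∫ w, c (H w - h) ∂(m s) +
        h * Real.exp (-h) * ∫ q, c (H (q.1 + q.2)) ∂((m s).prod μ) ≤
      ∫ w, c (H w) ∂(m (s + h)) ∧
    ∫ w, c (H w) ∂(m (s + h)) ≤
      Real.exp (-h) * ∫ w, c (H w - h) ∂(m s) +
        h * Real.exp (-h) * ∫ q, c (H (flow H h q.1 + q.2) - h) ∂((m s).prod μ) +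
        (h : ℝ) ^ 2

namespace IsForward

variable {φ H : ℝ → ℝ} {μ : Measure ℝ} [IsProbabilityMeasure μ] {m : ℝ≥0 → Measure ℝ}

omit [IsProbabilityMeasure μ] in
theorem ae_prod_pos (hm : IsForward H μ m) (hμ : ∀ᵐ y ∂μ, 0 < y) (s : ℝ≥0) :
    ∀ᵐ q ∂((m s).prod μ), 0 < q.1 ∧ 0 < q.2 := by
  have := hm.prob s
  exact (Measure.quasiMeasurePreserving_fst.ae (hm.carried s)).and
    (Measure.quasiMeasurePreserving_snd.ae hμ)

omit [IsProbabilityMeasure μ] in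
/-- The increment of `s ↦ e^{-(t-s)} E c(H(X_s) - (t-s))`. -/
theorem increment_bounds (hm : IsForward H μ m) {c : ℝ → ℝ} (hc : Continuous c)
    (hanti : Antitone c) (h0 : ∀ r, 0 ≤ c r) (h1 : ∀ r, c r ≤ 1) {t s u : ℝ} (hs : 0 ≤ s)
    (hsu : s ≤ u) (hut : u ≤ t) :
    (u - s) * (Real.exp (-(t - s)) *
        ∫ q, c (H (q.1 + q.2) - (t - u)) ∂((m s.toNNReal).prod μ)) ≤
      Real.exp (-(t - u)) * ∫ w, c (H w - (t - u)) ∂(m u.toNNReal) -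
        Real.exp (-(t - s)) * ∫ w, c (H w - (t - s)) ∂(m s.toNNReal) ∧
    Real.exp (-(t - u)) * ∫ w, c (H w - (t - u)) ∂(m u.toNNReal) -
        Real.exp (-(t - s)) * ∫ w, c (H w - (t - s)) ∂(m s.toNNReal) ≤
      (u - s) * (Real.exp (-(t - s)) *
        ∫ q, c (H (flow H (u - s) q.1 + q.2) - (t - s)) ∂((m s.toNNReal).prod μ)) +
        (u - s) ^ 2 := by
  -- Shifting the test function by `t - u` puts both end points on the same curve `s ↦ e^{-(t-s)} E
  -- c(H(X_s) - (t-s))`; the no-jump term then cancels and only the one-jump term remains.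
  have hb := hm.bounds s.toNNReal (u - s).toNNReal (fun r => c (r - (t - u)))
    (hc.comp (by fun_prop)) (fun r r' h => hanti (by linarith)) (fun r => h0 _) (fun r => h1 _)
  have e1 : s.toNNReal + (u - s).toNNReal = u.toNNReal := by
    rw [← Real.toNNReal_add hs (by linarith)]; congr 1; ring
  have e2 : ((u - s).toNNReal : ℝ) = u - s := Real.coe_toNNReal _ (by linarith)
  simp only [e1, e2, sub_sub, show u - s + (t - u) = t - s by ring] at hb
  have e3 : Real.exp (-(t - u)) * Real.exp (-(u - s)) = Real.exp (-(t - s)) := by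
    rw [← Real.exp_add]; congr 1; ring
  have hp : 0 < Real.exp (-(t - u)) := Real.exp_pos _
  have hle : Real.exp (-(t - u)) ≤ 1 := Real.exp_le_one_iff.2 (by linarith)
  obtain ⟨hb1, hb2⟩ := hb
  constructor
  · have := mul_le_mul_of_nonneg_left hb1 hp.le
    rw [← e3]
    linarith
  · have h2 := mul_le_mul_of_nonneg_left hb2 hp.le
    have h3 := mul_le_mul_of_nonneg_right hle (sq_nonneg (u - s))
    rw [← e3]
    linarith

theorem integral_mem_Icc {α : Type*} [MeasurableSpace α] (ν : Measure α) [IsProbabilityMeasure ν]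
    {f : α → ℝ} (h0 : ∀ r, 0 ≤ f r) (h1 : ∀ r, f r ≤ 1) : ∫ x, f x ∂ν ∈ Icc (0 : ℝ) 1 := by
  refine ⟨integral_nonneg h0, ?_⟩
  by_cases hf : Integrable f ν
  · simpa using integral_mono hf (integrable_const 1) h1
  · rw [integral_undef hf]; exact zero_le_one

/-- The difference quotients are squeezed by `increment_bounds`. As these step forward in time, they
give a right derivative, which is enough for the fundamental theorem once continuity is known from
`continuousOn_aux`. -/
theorem hasDerivWithinAt (hm : IsForward H μ m) (hH : IsClock φ H) (hμ : ∀ᵐ y ∂μ, 0 < y)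
    {c : ℝ → ℝ} (hc : Continuous c)
    (hanti : Antitone c) (h0 : ∀ r, 0 ≤ c r) (h1 : ∀ r, c r ≤ 1) {t s : ℝ} (hs : 0 ≤ s)
    (hst : s < t) :
    HasDerivWithinAt (fun s => Real.exp (-(t - s)) * ∫ w, c (H w - (t - s)) ∂(m s.toNNReal))
      (Real.exp (-(t - s)) * ∫ q, c (H (q.1 + q.2) - (t - s)) ∂((m s.toNNReal).prod μ))
      (Ioi s) s := by
  have := hm.prob s.toNNReal
  have hpos := hm.ae_prod_pos hμ s.toNNReal
  have hflow : ∀ u, Measurable fun w => flow H u w := fun u =>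
    hH.measurable_flow.comp (measurable_const.prodMk measurable_id)
  have hu0 : Tendsto (fun u => u - s) (𝓝[>] s) (𝓝[>] 0) := by
    refine tendsto_nhdsWithin_iff.2 ⟨?_, ?_⟩
    · exact ((continuous_sub_right s).tendsto' s 0 (sub_self s)).mono_left nhdsWithin_le_nhds
    · filter_upwards [self_mem_nhdsWithin] with u hu using sub_pos.2 (mem_Ioi.1 hu)
  have hL : Tendsto (fun u => Real.exp (-(t - s)) *
      ∫ q, c (H (q.1 + q.2) - (t - u)) ∂((m s.toNNReal).prod μ)) (𝓝[>] s)
      (𝓝 (Real.exp (-(t - s)) * ∫ q, c (H (q.1 + q.2) - (t - s)) ∂((m s.toNNReal).prod μ))) := by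
    refine Tendsto.const_mul _ (tendsto_integral_filter_of_dominated_convergence (fun _ => 1)
      (Eventually.of_forall fun u => ?_) (Eventually.of_forall fun u => ae_of_all _ fun q => ?_)
      (integrable_const _) (ae_of_all _ fun q => ?_))
    · exact (hc.measurable.comp
        ((hH.measurable.comp (by fun_prop)).sub_const _)).aestronglyMeasurable
    · rw [Real.norm_of_nonneg (h0 _)]; exact h1 _
    · have : Continuous fun u => c (H (q.1 + q.2) - (t - u)) := by fun_prop
      exact (this.tendsto s).mono_left nhdsWithin_le_nhds
  have hU : Tendsto (fun u => Real.exp (-(t - s)) *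
      ∫ q, c (H (flow H (u - s) q.1 + q.2) - (t - s)) ∂((m s.toNNReal).prod μ) + (u - s)) (𝓝[>] s)
      (𝓝 (Real.exp (-(t - s)) * ∫ q, c (H (q.1 + q.2) - (t - s)) ∂((m s.toNNReal).prod μ))) := by
    rw [← add_zero (Real.exp (-(t - s)) * _)]
    refine Tendsto.add (Tendsto.const_mul _ (tendsto_integral_filter_of_dominated_convergence
      (fun _ => 1) (Eventually.of_forall fun u => ?_)
      (Eventually.of_forall fun u => ae_of_all _ fun q => ?_)
      (integrable_const _) ?_)) (hu0.mono_right nhdsWithin_le_nhds)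
    · exact (hc.measurable.comp ((hH.measurable.comp (((hflow _).comp measurable_fst).add
        measurable_snd)).sub_const _)).aestronglyMeasurable
    · rw [Real.norm_of_nonneg (h0 _)]; exact h1 _
    · filter_upwards [hpos] with q hq
      have h2 := (((hH.tendsto_flow hq.1).comp hu0).add_const q.2)
      have h3 : ContinuousAt H (q.1 + q.2) :=
        hH.continuousOn.continuousAt (Ioi_mem_nhds (add_pos hq.1 hq.2))
      exact (hc.tendsto _).comp ((h3.tendsto.comp h2).sub_const _)
  rw [hasDerivWithinAt_iff_tendsto_slope' (by simp)]
  refine tendsto_of_tendsto_of_tendsto_of_le_of_le' hL hU ?_ ?_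
  · filter_upwards [Ioc_mem_nhdsGT hst] with u hu
    have := (hm.increment_bounds hc hanti h0 h1 hs hu.1.le hu.2).1
    rw [slope_def_field, le_div_iff₀ (sub_pos.2 hu.1)]
    linarith
  · filter_upwards [Ioc_mem_nhdsGT hst] with u hu
    have := (hm.increment_bounds hc hanti h0 h1 hs hu.1.le hu.2).2
    rw [slope_def_field, div_le_iff₀ (sub_pos.2 hu.1)]
    linarith

/-- The same increment bounds give the Lipschitz constant `1 + t`: at most `1` from the jump term,
and `t` from `(u - s)^2 ≤ t * (u - s)`. -/
theorem continuousOn_aux (hm : IsForward H μ m) {c : ℝ → ℝ} (hc : Continuous c)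
    (hanti : Antitone c) (h0 : ∀ r, 0 ≤ c r) (h1 : ∀ r, c r ≤ 1) (t : ℝ) :
    ContinuousOn (fun s => Real.exp (-(t - s)) * ∫ w, c (H w - (t - s)) ∂(m s.toNNReal))
      (Icc 0 t) := by
  have key : ∀ s ∈ Icc 0 t, ∀ u ∈ Icc 0 t, s ≤ u →
      |(Real.exp (-(t - u)) * ∫ w, c (H w - (t - u)) ∂(m u.toNNReal)) -
        Real.exp (-(t - s)) * ∫ w, c (H w - (t - s)) ∂(m s.toNNReal)| ≤ (1 + t) * (u - s) := by
    intro s hs u hu hsu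
    have := hm.prob s.toNNReal
    obtain ⟨hb1, hb2⟩ := hm.increment_bounds hc hanti h0 h1 hs.1 hsu hu.2
    have h2 := integral_mem_Icc ((m s.toNNReal).prod μ)
      (f := fun q => c (H (q.1 + q.2) - (t - u))) (fun _ => h0 _) fun _ => h1 _
    have h3 := integral_mem_Icc ((m s.toNNReal).prod μ)
      (f := fun q => c (H (flow H (u - s) q.1 + q.2) - (t - s))) (fun _ => h0 _) fun _ => h1 _
    have hle : Real.exp (-(t - s)) ≤ 1 := Real.exp_le_one_iff.2 (by linarith [hs.2])
    have hus : 0 ≤ u - s := by linarith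
    have h4 := mul_le_one₀ hle h3.1 h3.2
    have h5 := mul_le_mul_of_nonneg_left h4 hus
    have h6 : 0 ≤ (u - s) * (Real.exp (-(t - s)) *
        ∫ q, c (H (q.1 + q.2) - (t - u)) ∂((m s.toNNReal).prod μ)) :=
      mul_nonneg hus (mul_nonneg (Real.exp_pos _).le h2.1)
    have h7 : (u - s) ^ 2 ≤ t * (u - s) := by
      rw [sq]; exact mul_le_mul_of_nonneg_right (by linarith [hs.1, hu.2]) hus
    rw [abs_le]
    constructor
    · have : 0 ≤ (1 + t) * (u - s) := mul_nonneg (by linarith [hs.1, hs.2]) hus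
      linarith
    · linarith
  rcases lt_or_ge t 0 with ht | ht
  · rw [Icc_eq_empty (not_le.2 ht)]
    exact continuousOn_empty _
  refine LipschitzOnWith.continuousOn (K := (1 + t).toNNReal) ?_
  refine LipschitzOnWith.of_dist_le_mul fun s hs u hu => ?_
  rw [Real.coe_toNNReal _ (by linarith), Real.dist_eq, Real.dist_eq]
  rcases le_total s u with h | h
  · have := key s hs u hu h
    rwa [abs_sub_comm, abs_sub_comm s, abs_of_nonneg (sub_nonneg.2 h)]
  · have := key u hu s hs h
    rwa [abs_of_nonneg (sub_nonneg.2 h)]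

/-- Variation of constants for antitone continuous test functions. -/
theorem duhamel_continuous (hm : IsForward H μ m) (hH : IsClock φ H) (hμ : ∀ᵐ y ∂μ, 0 < y)
    {c : ℝ → ℝ} (hc : Continuous c)
    (hanti : Antitone c) (h0 : ∀ r, 0 ≤ c r) (h1 : ∀ r, c r ≤ 1) (t : ℝ≥0) :
    IntervalIntegrable (fun s : ℝ => Real.exp (-(t - s)) *
      ∫ q, c (H (q.1 + q.2) - (t - s)) ∂((m s.toNNReal).prod μ)) volume 0 t ∧
    ∫ w, c (H w) ∂(m t) = Real.exp (-t) * ∫ w, c (H w - t) ∂(m 0) +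
      ∫ s in (0 : ℝ)..t, Real.exp (-(t - s)) *
        ∫ q, c (H (q.1 + q.2) - (t - s)) ∂((m s.toNNReal).prod μ) := by
  have hd := fun s (hs : s ∈ Ioo (0 : ℝ) t) =>
    hm.hasDerivWithinAt hH hμ hc hanti h0 h1 hs.1.le hs.2
  have hi : IntervalIntegrable (fun s : ℝ => Real.exp (-(t - s)) *
      ∫ q, c (H (q.1 + q.2) - (t - s)) ∂((m s.toNNReal).prod μ)) volume 0 t := by
    rw [intervalIntegrable_iff_integrableOn_Ioo_of_le t.coe_nonneg]
    refine Integrable.of_bound (C := 1) ?_ ?_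
    -- No measurability of `s ↦ m s` is assumed; the integrand is measurable because it is a right
    -- derivative.
    · refine AEStronglyMeasurable.congr
        (measurable_derivWithin_Ioi (fun s => Real.exp (-(t - s)) *
          ∫ w, c (H w - (t - s)) ∂(m s.toNNReal))).aestronglyMeasurable ?_
      filter_upwards [ae_restrict_mem measurableSet_Ioo] with s hs
      exact (hd s hs).derivWithin (uniqueDiffWithinAt_Ioi s)
    · filter_upwards [ae_restrict_mem measurableSet_Ioo] with s hs
      have := hm.prob s.toNNReal
      have h2 := integral_mem_Icc ((m s.toNNReal).prod μ)
        (f := fun q => c (H (q.1 + q.2) - (t - s))) (fun _ => h0 _) fun _ => h1 _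
      rw [Real.norm_of_nonneg (mul_nonneg (Real.exp_pos _).le h2.1)]
      exact mul_le_one₀ (Real.exp_le_one_iff.2 (by linarith [hs.2])) h2.1 h2.2
  refine ⟨hi, ?_⟩
  have := intervalIntegral.integral_eq_sub_of_hasDeriv_right_of_le t.2
    (hm.continuousOn_aux hc hanti h0 h1 t) hd hi
  rw [NNReal.val_eq_coe] at this
  rw [this]
  simp

/-- The distribution of a sum, seen through the clock. -/
def jumpCdf (H : ℝ → ℝ) (μ ν : Measure ℝ) (r : ℝ) : ℝ :=
  (ν.prod μ).real {q : ℝ × ℝ | H (q.1 + q.2) ≤ r}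

/-- The ramp equals `1` up to and including `r`, so its limit is the indicator of the closed
half-line, even if the law has an atom there. -/
theorem tendsto_ramp (r x : ℝ) :
    Tendsto (fun n : ℕ => max 0 (min 1 (1 - n * (x - r)))) atTop
      (𝓝 ((Iic r).indicator (fun _ => (1 : ℝ)) x)) := by
  rcases le_or_gt x r with h | h
  · rw [indicator_of_mem (show x ∈ Iic r from h)]
    refine tendsto_const_nhds.congr fun n => ?_
    have : (n : ℝ) * (x - r) ≤ 0 := mul_nonpos_of_nonneg_of_nonpos n.cast_nonneg (by linarith)
    rw [min_eq_left (by linarith), max_eq_right zero_le_one]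
  · rw [indicator_of_notMem (by simpa using h)]
    refine tendsto_const_nhds.congr' ?_
    have hx : 0 < x - r := sub_pos.2 h
    filter_upwards [(tendsto_natCast_atTop_atTop (R := ℝ)).eventually_ge_atTop (1 / (x - r))]
      with n hn
    rw [div_le_iff₀ hx] at hn
    rw [max_eq_left]
    exact (min_le_right _ _).trans (by linarith)

/-- Variation of constants for the distribution functions. -/
theorem duhamel (hm : IsForward H μ m) (hH : IsClock φ H) (hμ : ∀ᵐ y ∂μ, 0 < y) (t : ℝ≥0)
    (r : ℝ) :
    IntervalIntegrable (fun s : ℝ => Real.exp (-(t - s)) *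
      jumpCdf H μ (m s.toNNReal) (r + (t - s))) volume 0 t ∧
    (m t).real {w | H w ≤ r} = Real.exp (-t) * (m 0).real {w | H w ≤ r + t} +
      ∫ s in (0 : ℝ)..t, Real.exp (-(t - s)) * jumpCdf H μ (m s.toNNReal) (r + (t - s)) := by
  set c : ℕ → ℝ → ℝ := fun n x => max 0 (min 1 (1 - n * (x - r)))
  have hc : ∀ n, Continuous (c n) := fun n => by fun_prop
  have hanti : ∀ n, Antitone (c n) := fun n x y hxy => by
    have : (n : ℝ) * (x - r) ≤ n * (y - r) := by gcongr
    exact max_le_max le_rfl (min_le_min le_rfl (by linarith))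
  have h0 : ∀ n x, 0 ≤ c n x := fun n x => le_max_left _ _
  have h1 : ∀ n x, c n x ≤ 1 := fun n x => max_le zero_le_one (min_le_left _ _)
  have hlim : ∀ x, Tendsto (fun n => c n x) atTop (𝓝 ((Iic r).indicator (fun _ => (1 : ℝ)) x)) :=
    tendsto_ramp r
  have key : ∀ {α : Type} [MeasurableSpace α] (ν : Measure α) [IsProbabilityMeasure ν] {g : α → ℝ}
      (_ : Measurable g) (d : ℝ), Tendsto (fun n => ∫ x, c n (g x - d) ∂ν) atTop
        (𝓝 (ν.real {x | g x ≤ r + d})) := by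
    intro α _ ν _ g hg d
    have hS : MeasurableSet {x | g x ≤ r + d} := measurableSet_le hg measurable_const
    have e : ν.real {x | g x ≤ r + d} =
        ∫ x, (Iic r).indicator (fun _ => (1 : ℝ)) (g x - d) ∂ν := by
      rw [← integral_indicator_one hS]
      refine integral_congr_ae (ae_of_all _ fun x => ?_)
      simp only [indicator, mem_ofPred_eq, mem_Iic, sub_le_iff_le_add, Pi.one_apply]
    rw [e]
    refine tendsto_integral_of_dominated_convergence (fun _ => 1) (fun n => ?_)
      (integrable_const _) (fun n => ae_of_all _ fun x => ?_) (ae_of_all _ fun x => hlim _)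
    · exact ((hc n).measurable.comp (hg.sub_const d)).aestronglyMeasurable
    · rw [Real.norm_of_nonneg (h0 _ _)]; exact h1 _ _
  have hD := fun n => hm.duhamel_continuous hH hμ (hc n) (hanti n) (h0 n) (h1 n) t
  have hpt : ∀ s : ℝ, Tendsto (fun n => Real.exp (-(t - s)) *
      ∫ q, c n (H (q.1 + q.2) - (t - s)) ∂((m s.toNNReal).prod μ)) atTop
      (𝓝 (Real.exp (-(t - s)) * jumpCdf H μ (m s.toNNReal) (r + (t - s)))) := fun s => by
    have := hm.prob s.toNNReal
    exact (key ((m s.toNNReal).prod μ) (hH.measurable.comp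
      (measurable_fst.add measurable_snd)) (t - s)).const_mul _
  have hbd : ∀ (n : ℕ) (s : ℝ), s ∈ uIoc (0 : ℝ) t → ‖Real.exp (-(t - s)) *
      ∫ q, c n (H (q.1 + q.2) - (t - s)) ∂((m s.toNNReal).prod μ)‖ ≤ 1 := fun n s hs => by
    rw [uIoc_of_le t.coe_nonneg] at hs
    have := hm.prob s.toNNReal
    have h2 := integral_mem_Icc ((m s.toNNReal).prod μ)
      (f := fun q => c n (H (q.1 + q.2) - (t - s))) (fun _ => h0 _ _) fun _ => h1 _ _
    rw [Real.norm_of_nonneg (mul_nonneg (Real.exp_pos _).le h2.1)]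
    exact mul_le_one₀ (Real.exp_le_one_iff.2 (by linarith [hs.2])) h2.1 h2.2
  constructor
  · rw [intervalIntegrable_iff_integrableOn_Ioc_of_le t.coe_nonneg, ← uIoc_of_le t.coe_nonneg]
    have : IsFiniteMeasure (volume.restrict (uIoc (0 : ℝ) t)) := by
      rw [uIoc_of_le t.coe_nonneg]; infer_instance
    refine Integrable.of_bound (C := 1) ?_ ?_
    · exact aestronglyMeasurable_of_tendsto_ae atTop
        (fun n => (intervalIntegrable_iff.1 (hD n).1).aestronglyMeasurable)
        (ae_of_all _ hpt)
    · filter_upwards [ae_restrict_mem measurableSet_uIoc] with s hs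
      exact le_of_tendsto (hpt s).norm (Eventually.of_forall fun n => hbd n s hs)
  · have hp := hm.prob t
    have hp0 := hm.prob 0
    have hlhs := key (m t) hH.measurable 0
    simp only [sub_zero, add_zero] at hlhs
    refine tendsto_nhds_unique hlhs ?_
    simp only [(hD _).2]
    refine ((key (m 0) hH.measurable t).const_mul _).add ?_
    refine intervalIntegral.tendsto_integral_filter_of_dominated_convergence (fun _ => 1)
      (Eventually.of_forall fun n => (intervalIntegrable_iff.1 (hD n).1).aestronglyMeasurable)
      (Eventually.of_forall fun n => ae_of_all _ fun s hs => hbd n s hs) (by simp)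
      (ae_of_all _ fun s _ => hpt s)

end IsForward
end

noncomputable section

/-! ### The marginals for a random initial value -/

variable {Ω : Type*} {mΩ : MeasurableSpace Ω} {P : Measure Ω} [IsProbabilityMeasure P]

/-- `X x` is the solution that starts from `x > 0`, with the noise given by `N` and `ξ`. -/
structure IsSolutionFamily (φ : ℝ → ℝ) (N : ℝ≥0 → Ω → ℕ) (ξ : ℕ → Ω → ℝ) (P : Measure Ω)
    (X : ℝ → ℝ≥0 → Ω → ℝ) : Prop where
  measurable : ∀ x > 0, ∀ t, Measurable (X x t)
  solves : ∀ x > 0, ∀ᵐ ω ∂P,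
    SolvesAlong φ x (fun t => N t ω) (fun k => ξ k ω) (fun t => X x t ω)

/-- The law at time `s` of the process with initial distribution `ν`. -/
def marginal (H : ℝ → ℝ) (N : ℝ≥0 → Ω → ℕ) (ξ : ℕ → Ω → ℝ) (P : Measure Ω) (ν : Measure ℝ)
    (s : ℝ≥0) : Measure ℝ :=
  (ν.prod P).map fun q =>
    jumpPosition H s (N s q.2) q.1 (fun t => N t q.2) (fun k => ξ k q.2)

namespace IsSolutionFamily

variable {φ H : ℝ → ℝ} {μ : Measure ℝ} {N : ℝ≥0 → Ω → ℕ} {ξ : ℕ → Ω → ℝ}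
  {X : ℝ → ℝ≥0 → Ω → ℝ} {ν : Measure ℝ} [IsProbabilityMeasure ν]

omit [IsProbabilityMeasure P] in
-- `X x s ω` is not assumed jointly measurable in `(x, ω)`. The explicit formula is, and for each
-- fixed `x > 0` it agrees with `X x s` almost surely; this is why `marginal` is defined through it.
theorem measurable_explicit (hJ : IsJumpNoise μ N ξ P) (hH : IsClock φ H) (s : ℝ≥0) :
    Measurable fun q : ℝ × Ω =>
      jumpPosition H s (N s q.2) q.1 (fun t => N t q.2) (fun k => ξ k q.2) := by
  have hη : Measurable fun q : ℝ × Ω => fun t => N t q.2 :=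
    measurable_pi_lambda _ fun t => (hJ.poisson.measurable t).comp measurable_snd
  have hξ : Measurable fun q : ℝ × Ω => fun k => ξ k q.2 :=
    measurable_pi_lambda _ fun k => (hJ.measurable k).comp measurable_snd
  have h0 : ∀ n, Measurable fun q : ℝ × Ω =>
      jumpPosition H s n q.1 (fun t => N t q.2) (fun k => ξ k q.2) := fun n =>
    hH.measurable_jumpPosition (x := fun q : ℝ × Ω => q.1) (η := fun q t => N t q.2)
      (ζ := fun q k => ξ k q.2) s n measurable_fst hη hξ
  have h1 : Measurable fun p : ℕ × (ℝ × Ω) =>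
      jumpPosition H s p.1 p.2.1 (fun t => N t p.2.2) (fun k => ξ k p.2.2) :=
    measurable_from_prod_countable_right h0
  have h2 : Measurable fun q : ℝ × Ω => (N s q.2, q) :=
    ((hJ.poisson.measurable s).comp measurable_snd).prodMk measurable_id'
  have h3 := h1.comp h2
  simp only [Function.comp_def] at h3
  exact h3

omit [IsProbabilityMeasure P] in
theorem ae_eq_explicit (hX : IsSolutionFamily φ N ξ P X) (hH : IsClock φ H) {x : ℝ} (hx : 0 < x)
    (s : ℝ≥0) : X x s =ᵐ[P]
      fun ω => jumpPosition H s (N s ω) x (fun t => N t ω) (fun k => ξ k ω) := by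
  filter_upwards [hX.solves x hx] with ω hω using hH.eq_jumpPosition hω s

theorem integral_marginal (hX : IsSolutionFamily φ N ξ P X) (hJ : IsJumpNoise μ N ξ P)
    (hH : IsClock φ H) (hν : ∀ᵐ x ∂ν, 0 < x) (s : ℝ≥0) {f : ℝ → ℝ} (hf : Measurable f)
    {C : ℝ} (hC : ∀ w, |f w| ≤ C) :
    Integrable (fun x => ∫ w, f w ∂(P.map (X x s))) ν ∧
      ∫ w, f w ∂(marginal H N ξ P ν s) = ∫ x, ∫ w, f w ∂(P.map (X x s)) ∂ν := by
  have he := measurable_explicit hJ hH s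
  have hint : Integrable (fun q : ℝ × Ω =>
      f (jumpPosition H s (N s q.2) q.1 (fun t => N t q.2) (fun k => ξ k q.2))) (ν.prod P) :=
    Integrable.of_bound (hf.comp he).aestronglyMeasurable C (ae_of_all _ fun q => hC _)
  have hae : (fun x => ∫ w, f w ∂(P.map (X x s))) =ᵐ[ν] fun x =>
      ∫ ω, f (jumpPosition H s (N s ω) x (fun t => N t ω) (fun k => ξ k ω)) ∂P := by
    filter_upwards [hν] with x hx
    rw [integral_map (hX.measurable x hx s).aemeasurable hf.aestronglyMeasurable]
    refine integral_congr_ae ?_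
    filter_upwards [hX.ae_eq_explicit hH hx s] with ω hω
    rw [hω]
  refine ⟨hint.integral_prod_left.congr hae.symm, ?_⟩
  rw [marginal, integral_map he.aemeasurable hf.aestronglyMeasurable, integral_prod _ hint,
    integral_congr_ae hae]

omit [IsProbabilityMeasure ν] in
theorem marginal_apply (hX : IsSolutionFamily φ N ξ P X) (hJ : IsJumpNoise μ N ξ P)
    (hH : IsClock φ H) (hν : ∀ᵐ x ∂ν, 0 < x) (s : ℝ≥0) {B : Set ℝ} (hB : MeasurableSet B) :
    marginal H N ξ P ν s B = ∫⁻ x in Ioi (0 : ℝ), P {ω | X x s ω ∈ B} ∂ν := by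
  have he := measurable_explicit hJ hH s
  have hIoi : ν.restrict (Ioi 0) = ν := Measure.restrict_eq_self_of_ae_mem hν
  rw [marginal, Measure.map_apply he hB, Measure.prod_apply (he hB), hIoi]
  refine lintegral_congr_ae ?_
  filter_upwards [hν] with x hx
  refine measure_congr ?_
  filter_upwards [hX.ae_eq_explicit hH hx s] with ω hω
  refine propext ?_
  change jumpPosition H s (N s ω) x (fun t => N t ω) (fun k => ξ k ω) ∈ B ↔ X x s ω ∈ B
  rw [hω]

omit [IsProbabilityMeasure P] [IsProbabilityMeasure ν] in
theorem marginal_pos (hJ : IsJumpNoise μ N ξ P) (hH : IsClock φ H) (s : ℝ≥0) :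
    ∀ᵐ w ∂(marginal H N ξ P ν s), 0 < w := by
  rw [marginal, ae_map_iff (measurable_explicit hJ hH s).aemeasurable measurableSet_Ioi]
  exact ae_of_all _ fun q => flow_pos _ _ _

theorem isProbabilityMeasure_marginal (hJ : IsJumpNoise μ N ξ P) (hH : IsClock φ H) (s : ℝ≥0) :
    IsProbabilityMeasure (marginal H N ξ P ν s) :=
  Measure.isProbabilityMeasure_map (measurable_explicit hJ hH s).aemeasurable

theorem isForward_marginal [IsProbabilityMeasure μ] (hX : IsSolutionFamily φ N ξ P X)
    (hJ : IsJumpNoise μ N ξ P) (hH : IsClock φ H) (hν : ∀ᵐ x ∂ν, 0 < x) :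
    IsForward H μ (marginal H N ξ P ν) where
  prob := isProbabilityMeasure_marginal hJ hH
  carried := marginal_pos hJ hH
  bounds s h c hc hanti h0 h1 := by
    have hm := isProbabilityMeasure_marginal (ν := ν) hJ hH s
    have hHm := hH.measurable
    have hcm := hc.measurable
    have hfm : Measurable fun w => flow H h w :=
      hH.measurable_flow.comp (measurable_const.prodMk measurable_id)
    have hC : ∀ r, |c r| ≤ 1 := fun r => by rw [abs_of_nonneg (h0 r)]; exact h1 r
    have hprod : ∀ {g : ℝ × ℝ → ℝ}, Measurable g →
        Integrable (fun x => ∫ q, c (g q) ∂((P.map (X x s)).prod μ)) ν ∧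
        ∫ q, c (g q) ∂((marginal H N ξ P ν s).prod μ) =
          ∫ x, ∫ q, c (g q) ∂((P.map (X x s)).prod μ) ∂ν := by
      intro g hg
      have hsm : Measurable fun w => ∫ y, c (g (w, y)) ∂μ :=
        (StronglyMeasurable.integral_prod_right (f := fun w y => c (g (w, y)))
          (hcm.comp hg).stronglyMeasurable).measurable
      have hb : ∀ w, |∫ y, c (g (w, y)) ∂μ| ≤ 1 := fun w => by
        have := IsForward.integral_mem_Icc μ (f := fun y => c (g (w, y))) (fun _ => h0 _)
          fun _ => h1 _
        rw [abs_of_nonneg this.1]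
        exact this.2
      have hfub : ∀ (ρ : Measure ℝ) [IsProbabilityMeasure ρ],
          ∫ q, c (g q) ∂(ρ.prod μ) = ∫ w, ∫ y, c (g (w, y)) ∂μ ∂ρ := fun ρ _ =>
        integral_prod _ (Integrable.of_bound (hcm.comp hg).aestronglyMeasurable 1
          (ae_of_all _ fun q => hC _))
      have hae : (fun x => ∫ q, c (g q) ∂((P.map (X x s)).prod μ)) =ᵐ[ν]
          fun x => ∫ w, ∫ y, c (g (w, y)) ∂μ ∂(P.map (X x s)) := by
        filter_upwards [hν] with x hx
        have := Measure.isProbabilityMeasure_map (μ := P) (hX.measurable x hx s).aemeasurable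
        exact hfub _
      obtain ⟨hi, he⟩ := hX.integral_marginal hJ hH hν s hsm hb
      exact ⟨hi.congr hae.symm, by rw [hfub, he, integral_congr_ae hae]⟩
    obtain ⟨i1, e1⟩ := hX.integral_marginal hJ hH hν s (hcm.comp (hHm.sub_const h)) fun _ => hC _
    obtain ⟨i2, e2⟩ := hX.integral_marginal hJ hH hν (s + h) (hcm.comp hHm) fun _ => hC _
    obtain ⟨i3, e3⟩ := hprod (g := fun q => H (q.1 + q.2)) (hHm.comp (by fun_prop))
    obtain ⟨i4, e4⟩ := hprod (g := fun q => H (flow H h q.1 + q.2) - h)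
      ((hHm.comp ((hfm.comp measurable_fst).add measurable_snd)).sub_const _)
    simp only [Function.comp_def] at i1 e1 i2 e2
    rw [e1, e2, e3, e4]
    have hb := fun x (hx : 0 < x) =>
      hJ.forward_bounds hH (hX.measurable x hx) (hX.solves x hx) s h hc hanti h0 h1
    constructor
    · rw [← integral_const_mul, ← integral_const_mul,
        ← integral_add (i1.const_mul _) (i3.const_mul _)]
      refine integral_mono_ae ((i1.const_mul _).add (i3.const_mul _)) i2 ?_
      filter_upwards [hν] with x hx using (hb x hx).1
    · rw [← integral_const_mul, ← integral_const_mul,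
        ← integral_add (i1.const_mul _) (i4.const_mul _)]
      have e5 : (h : ℝ) ^ 2 = ∫ _, (h : ℝ) ^ 2 ∂ν := by simp
      have i5 := (i1.const_mul (Real.exp (-h))).fun_add (i4.const_mul (h * Real.exp (-h)))
      rw [e5, ← integral_add i5 (integrable_const _)]
      refine integral_mono_ae i2 (i5.fun_add (integrable_const _)) ?_
      filter_upwards [hν] with x hx using (hb x hx).2

end IsSolutionFamily
end

noncomputable section

/-! ### Distribution functions in the time scale of the clock -/

theorem monotone_jumpCdf (H : ℝ → ℝ) (μ ν : Measure ℝ) [IsProbabilityMeasure μ]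
    [IsProbabilityMeasure ν] : Monotone (IsForward.jumpCdf H μ ν) :=
  fun _ _ h => measureReal_mono fun _ hq => le_trans hq h

theorem intervalIntegrable_exp_mul_jumpCdf (H : ℝ → ℝ) (μ ν : Measure ℝ) [IsProbabilityMeasure μ]
    [IsProbabilityMeasure ν] (t r x y : ℝ) :
    IntervalIntegrable (fun s => Real.exp (-(t - s)) * IsForward.jumpCdf H μ ν (r + (t - s)))
      volume x y := by
  refine IntervalIntegrable.continuousOn_mul ?_ (by fun_prop)
  exact Antitone.intervalIntegrable fun s u h => monotone_jumpCdf H μ ν (by linarith)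

/-- The distribution function of `ν` in the time scale of the clock solves the stationary forward
equation. -/
def IsStationary (H : ℝ → ℝ) (μ ν : Measure ℝ) : Prop :=
  ∀ (t : ℝ≥0) (r : ℝ), ν.real {w | H w ≤ r} = Real.exp (-t) * ν.real {w | H w ≤ r + t} +
    ∫ s in (0 : ℝ)..t, Real.exp (-(t - s)) * IsForward.jumpCdf H μ ν (r + (t - s))

namespace IsClock

variable {φ H : ℝ → ℝ} {μ ν : Measure ℝ}

/-- The range of `H` is closed downwards. The second case occurs when `H` is bounded above, that is,
when the flow comes down from infinity in finite time. -/
theorem eq_or_lt (hH : IsClock φ H) (r : ℝ) : (∃ w > 0, H w = r) ∨ ∀ w > 0, H w < r := by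
  by_cases h : ∀ w > 0, H w < r
  · exact Or.inr h
  · push Not at h
    obtain ⟨x, hx, hrx⟩ := h
    obtain ⟨w, hw, -, hwr⟩ := hH.exists_clock_eq (t := H x - r) hx (by linarith)
    exact Or.inl ⟨w, hw, by linarith⟩

theorem real_le_clock (hH : IsClock φ H) (hν : ∀ᵐ x ∂ν, 0 < x) {w : ℝ} (hw : 0 < w) :
    ν.real {v | H v ≤ H w} = ν.real (Iic w) := by
  refine measureReal_congr ?_
  filter_upwards [hν] with v hv
  exact propext (hH.le_iff hv hw)

theorem real_le_of_lt [IsProbabilityMeasure ν] (hν : ∀ᵐ x ∂ν, 0 < x) {r : ℝ}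
    (hr : ∀ w > 0, H w < r) : ν.real {v | H v ≤ r} = 1 := by
  rw [← probReal_univ (μ := ν)]
  refine measureReal_congr ?_
  filter_upwards [hν] with v hv
  exact propext ⟨fun _ => trivial, fun _ => (hr v hv).le⟩

variable [IsProbabilityMeasure μ] [IsProbabilityMeasure ν]

theorem measurable_real_Iic (ν : Measure ℝ) [IsProbabilityMeasure ν] (w : ℝ) :
    Measurable fun y => ν.real (Iic (w - y)) :=
  Antitone.measurable fun _ _ h => measureReal_mono (Iic_subset_Iic.2 (by linarith))

theorem integrable_real_Iic (μ ν : Measure ℝ) [IsProbabilityMeasure μ] [IsProbabilityMeasure ν]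
    (w : ℝ) : Integrable (fun y => ν.real (Iic (w - y))) μ :=
  Integrable.of_bound (measurable_real_Iic ν w).aestronglyMeasurable 1 (ae_of_all _ fun y => by
    rw [Real.norm_of_nonneg measureReal_nonneg]; exact measureReal_le_one)

theorem jumpCdf_clock (hH : IsClock φ H) (hν : ∀ᵐ x ∂ν, 0 < x) (hμ : ∀ᵐ y ∂μ, 0 < y) {w : ℝ}
    (hw : 0 < w) :
    IsForward.jumpCdf H μ ν (H w) = ∫ y, ν.real (Iic (w - y)) ∂μ := by
  have hpos : ∀ᵐ q ∂(ν.prod μ), 0 < q.1 ∧ 0 < q.2 :=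
    (Measure.quasiMeasurePreserving_fst.ae hν).and (Measure.quasiMeasurePreserving_snd.ae hμ)
  have hS : MeasurableSet {q : ℝ × ℝ | q.1 + q.2 ≤ w} :=
    measurableSet_le (by fun_prop) measurable_const
  have h1 : (ν.prod μ) {q | H (q.1 + q.2) ≤ H w} = (ν.prod μ) {q | q.1 + q.2 ≤ w} := by
    refine measure_congr ?_
    filter_upwards [hpos] with q hq
    exact propext (hH.le_iff (add_pos hq.1 hq.2) hw)
  rw [IsForward.jumpCdf, measureReal_def, h1, Measure.prod_apply_symm hS,
    integral_eq_lintegral_of_nonneg_ae (ae_of_all _ fun y => measureReal_nonneg)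
      (measurable_real_Iic ν w).aestronglyMeasurable]
  congr 1
  refine lintegral_congr fun y => ?_
  rw [ofReal_measureReal]
  congr 1
  ext x
  simp [le_sub_iff_add_le]

theorem jumpCdf_of_lt (hν : ∀ᵐ x ∂ν, 0 < x) (hμ : ∀ᵐ y ∂μ, 0 < y) {r : ℝ}
    (hr : ∀ w > 0, H w < r) : IsForward.jumpCdf H μ ν r = 1 := by
  have hpos : ∀ᵐ q ∂(ν.prod μ), 0 < q.1 ∧ 0 < q.2 :=
    (Measure.quasiMeasurePreserving_fst.ae hν).and (Measure.quasiMeasurePreserving_snd.ae hμ)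
  rw [IsForward.jumpCdf, ← probReal_univ (μ := ν.prod μ)]
  refine measureReal_congr ?_
  filter_upwards [hpos] with q hq
  exact propext ⟨fun _ => trivial, fun _ => (hr _ (add_pos hq.1 hq.2)).le⟩

theorem continuousAt_clockInv (hH : IsClock φ H) {w : ℝ} (hw : 0 < w) :
    ContinuousAt (clockInv H) (H w) := by
  have hev : ∀ {v}, w < v → ∀ᶠ ρ in 𝓝 (H w), ∃ u > 0, H u = ρ ∧ u < v := fun {v} hv => by
    have hv0 : 0 < v := hw.trans hv
    filter_upwards [Iio_mem_nhds ((hH.lt_iff hw hv0).2 hv)] with ρ hρ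
    have hρ : ρ < H v := hρ
    obtain ⟨u, hu, -, h⟩ := hH.exists_clock_eq (t := H v - ρ) hv0 (by linarith)
    have h : H u = ρ := by linarith
    exact ⟨u, hu, h, (hH.lt_iff hu hv0).1 (by linarith)⟩
  rw [ContinuousAt, hH.clockInv_clock hw]
  refine tendsto_order.2 ⟨fun v hv => ?_, fun v hv => ?_⟩
  · rcases le_or_gt v 0 with hv0 | hv0
    · exact Eventually.of_forall fun ρ => hv0.trans_lt (clockInv_pos _ _)
    · filter_upwards [hev (lt_add_one w), Ioi_mem_nhds ((hH.lt_iff hv0 hw).2 hv)] with ρ hρ hρ'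
      obtain ⟨u, hu, rfl, -⟩ := hρ
      rw [hH.clockInv_clock hu]
      exact (hH.lt_iff hv0 hu).1 hρ'
  · filter_upwards [hev hv] with ρ hρ
    obtain ⟨u, hu, rfl, huv⟩ := hρ
    rwa [hH.clockInv_clock hu]

theorem continuous_real_le (hH : IsClock φ H) (hν : ∀ᵐ x ∂ν, 0 < x) (hatom : ∀ x, ν {x} = 0) :
    Continuous fun r => ν.real {w | H w ≤ r} := by
  have e : ∀ r, ν.real {w | H w ≤ r} = ∫ w, (Iic r).indicator (fun _ => (1 : ℝ)) (H w) ∂ν :=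
    fun r => by
      rw [← integral_indicator_one (measurableSet_le hH.measurable measurable_const)]
      rfl
  simp only [e]
  refine continuous_iff_continuousAt.2 fun r => continuousAt_of_dominated (bound := fun _ => 1)
    (Eventually.of_forall fun ρ => ?_) (Eventually.of_forall fun ρ => ae_of_all _ fun w => ?_)
    (integrable_const _) ?_
  · exact ((measurable_const.indicator measurableSet_Iic).comp hH.measurable).aestronglyMeasurable
  · by_cases h : H w ≤ ρ <;> simp [indicator, h]
  · have hne : ∀ᵐ w ∂ν, H w ≠ r := by
      rcases hH.eq_or_lt r with ⟨v, hv, rfl⟩ | h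
      · filter_upwards [hν, compl_mem_ae_iff.2 (hatom v)] with w hw hwv h
        exact hwv (hH.strictMonoOn.injOn hw hv h)
      · filter_upwards [hν] with w hw using (h w hw).ne
    filter_upwards [hne] with w hw
    rcases lt_or_gt_of_ne hw with h | h
    · refine ContinuousAt.congr (continuousAt_const (y := (1 : ℝ))) ?_
      filter_upwards [Ioi_mem_nhds h] with ρ hρ
      rw [indicator_of_mem (show H w ∈ Iic ρ from (mem_Ioi.1 hρ).le)]
    · refine ContinuousAt.congr (continuousAt_const (y := (0 : ℝ))) ?_
      filter_upwards [Iio_mem_nhds h] with ρ hρ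
      rw [indicator_of_notMem (show H w ∉ Iic ρ from not_le.2 (mem_Iio.1 hρ))]

end IsClock

/-! ### Stationarity of the target measure -/

namespace TargetAssumptions

variable {π : ℝ → ℝ} {μ : Measure ℝ} [IsProbabilityMeasure μ] {a : ℝ}

theorem ae_pos_targetMeasure (π : ℝ → ℝ) : ∀ᵐ x ∂(targetMeasure π), 0 < x := by
  have := measure_eq_zero_iff_ae_notMem.1 (targetMeasure_Iic_zero π)
  filter_upwards [this] with x hx
  simpa using hx

/-- Change of variables: in clock time the density is `π / H'`, and `H' = π / tailConv`, so `π`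
cancels. -/
theorem hasDerivAt_real_le_clock (hπ : TargetAssumptions π) (ha : 0 < a)
    (hμa : ∀ᵐ y ∂μ, a ≤ y) {w : ℝ} (hw : 0 < w) (hc : ContinuousAt π w) :
    HasDerivAt (fun r => (targetMeasure π).real {v | clock μ π v ≤ r}) (tailConv μ π w)
      (clock μ π w) := by
  have hH := hπ.isClock ha hμa
  have hinv : clockInv (clock μ π) (clock μ π w) = w := hH.clockInv_clock hw
  have hev : ∀ᶠ ρ in 𝓝 (clock μ π w), ∃ u > 0, clock μ π u = ρ := by
    have hw1 : 0 < w + 1 := by linarith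
    filter_upwards [Iio_mem_nhds ((hH.lt_iff hw hw1).2 (lt_add_one w))] with ρ hρ
    have hρ : ρ < clock μ π (w + 1) := hρ
    obtain ⟨u, hu, -, h⟩ := hH.exists_clock_eq (t := clock μ π (w + 1) - ρ) hw1 (by linarith)
    exact ⟨u, hu, by linarith⟩
  have h1 : HasDerivAt (clockInv (clock μ π)) (π w / tailConv μ π w)⁻¹ (clock μ π w) := by
    refine HasDerivAt.of_local_left_inverse (hH.continuousAt_clockInv hw)
      (by rw [hinv]; exact hπ.hasDerivAt_clock ha hμa hw hc) (hπ.rate_pos ha hμa hw).ne' ?_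
    filter_upwards [hev] with ρ hρ
    obtain ⟨u, hu, rfl⟩ := hρ
    rw [hH.clockInv_clock hu]
  have h2 := hπ.hasDerivAt_real_Iic hw hc
  rw [← hinv] at h2
  have h3 := h2.comp (clock μ π w) h1
  rw [hinv, inv_div, mul_div_cancel₀ _ (hπ.pos hw).ne'] at h3
  refine h3.congr_of_eventuallyEq ?_
  filter_upwards [hev] with ρ hρ
  obtain ⟨u, hu, rfl⟩ := hρ
  rw [hH.real_le_clock (ae_pos_targetMeasure π) hu, Function.comp_apply, hH.clockInv_clock hu]

/-- By `tailConv_eq`, the derivative of `A` is `A - Q`, so `e^{r-ρ} A ρ` has derivative `-e^{r-ρ} Q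
ρ`. Above the range of the clock both `A` and `Q` are `1`. Integration from `r` to `r + t` gives the
claim. -/
theorem isStationary_targetMeasure (hπ : TargetAssumptions π) (ha : 0 < a)
    (hμa : ∀ᵐ y ∂μ, a ≤ y) : IsStationary (clock μ π) μ (targetMeasure π) := by
  have := hπ.isProbabilityMeasure
  have hH := hπ.isClock ha hμa
  have hν := ae_pos_targetMeasure π
  have hμ : ∀ᵐ y ∂μ, 0 < y := hμa.mono fun y hy => ha.trans_le hy
  obtain ⟨E, hE, hc⟩ := hπ.exists_countable_continuousAt
  intro t r
  set A : ℝ → ℝ := fun r => (targetMeasure π).real {v | clock μ π v ≤ r}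
  set Q : ℝ → ℝ := IsForward.jumpCdf (clock μ π) μ (targetMeasure π)
  -- The end of the clock's range, where differentiability of `A` may fail. If the range is
  -- unbounded, `M` is the default value `0` and excluding it is harmless.
  set M := sSup (clock μ π '' Ioi 0)
  have hAc : Continuous A := hH.continuous_real_le hν fun x =>
    targetMeasure_absolutelyContinuous π (measure_singleton x)
  have hderiv : ∀ ρ, ρ ∉ clock μ π '' E ∪ {M} → HasDerivAt A (A ρ - Q ρ) ρ := by
    intro ρ hρ
    rcases hH.eq_or_lt ρ with ⟨w, hw, rfl⟩ | h
    · have hwE : w ∉ E := fun h => hρ (Or.inl ⟨w, h, rfl⟩)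
      have h1 := hπ.hasDerivAt_real_le_clock ha hμa hw (hc w hw hwE)
      have h2 : A (clock μ π w) - Q (clock μ π w) = tailConv μ π w := by
        rw [tailConv_eq hπ ha hμa hw, ← hH.jumpCdf_clock hν hμ hw, ← hH.real_le_clock hν hw]
      rwa [h2]
    · have hbdd : BddAbove (clock μ π '' Ioi 0) :=
        ⟨ρ, by rintro _ ⟨w, hw, rfl⟩; exact (h w hw).le⟩
      have hMρ : M ≤ ρ := csSup_le ⟨_, mem_image_of_mem _ (mem_Ioi.2 one_pos)⟩
        (by rintro _ ⟨w, hw, rfl⟩; exact (h w hw).le)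
      have hMlt : M < ρ := lt_of_le_of_ne hMρ fun h => hρ (Or.inr h.symm)
      have hone : ∀ ρ' > M, A ρ' = 1 := fun ρ' hρ' => IsClock.real_le_of_lt hν fun w hw =>
        (le_csSup hbdd (mem_image_of_mem _ (mem_Ioi.2 hw))).trans_lt hρ'
      have h2 : A ρ - Q ρ = 0 := by
        rw [hone ρ hMlt, show Q ρ = 1 from IsClock.jumpCdf_of_lt hν hμ h, sub_self]
      rw [h2]
      refine (hasDerivAt_const ρ (1 : ℝ)).congr_of_eventuallyEq ?_
      filter_upwards [Ioi_mem_nhds hMlt] with ρ' hρ' using hone ρ' hρ'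
  have ht : r ≤ r + t := by linarith [t.coe_nonneg]
  have hftc := integral_eq_of_hasDerivAt_off_countable_of_le (fun ρ => Real.exp (r - ρ) * A ρ)
    (fun ρ => -(Real.exp (r - ρ) * Q ρ)) ht ((hE.image (clock μ π)).union (countable_singleton M))
    (by fun_prop) ?_ ?_
  · have hsub := intervalIntegral.integral_comp_sub_left
      (fun ρ => -(Real.exp (r - ρ) * Q ρ)) (a := 0) (b := t) (r + t)
    rw [sub_zero, add_sub_cancel_right, hftc] at hsub
    have e1 : ∀ s : ℝ, -(Real.exp (r - (r + t - s)) * Q (r + t - s)) =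
        -(Real.exp (-(t - s)) * Q (r + (t - s))) := fun s => by
      congr 3 <;> ring
    simp only [e1, intervalIntegral.integral_neg, sub_self, Real.exp_zero, one_mul,
      sub_add_cancel_left] at hsub
    linarith
  · intro ρ hρ
    have h1 := ((hasDerivAt_id ρ).const_sub r).exp.mul (hderiv ρ hρ.2)
    refine h1.congr_deriv ?_
    simp only [id]
    ring
  · refine (IntervalIntegrable.continuousOn_mul ?_ (by fun_prop)).neg
    exact (monotone_jumpCdf _ _ _).intervalIntegrable

end TargetAssumptions
end

noncomputable section

/-! ### Stationary solutions of the forward equation -/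

namespace IsForward

variable {φ H : ℝ → ℝ} {μ ν : Measure ℝ} [IsProbabilityMeasure μ] [IsProbabilityMeasure ν]
  {m : ℝ≥0 → Measure ℝ}

theorem real_Iic_of_nonpos {ν : Measure ℝ} (hν : ∀ᵐ x ∂ν, 0 < x) {w : ℝ} (hw : w ≤ 0) :
    ν.real (Iic w) = 0 := by
  rw [measureReal_def, measure_eq_zero_iff_ae_notMem.2, ENNReal.toReal_zero]
  filter_upwards [hν] with x hx
  simpa using hw.trans_lt hx

omit [IsProbabilityMeasure ν] in
theorem isStationary_of_const (hm : IsForward H μ fun _ => ν) (hH : IsClock φ H)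
    (hμ : ∀ᵐ y ∂μ, 0 < y) : IsStationary H μ ν :=
  fun t r => (hm.duhamel hH hμ t r).2

/-- Adding an independent jump averages translates of the distribution function, which does not
increase sup distances. -/
theorem abs_jumpCdf_sub_le (hH : IsClock φ H) (hμ : ∀ᵐ y ∂μ, 0 < y) {ν' : Measure ℝ}
    [IsProbabilityMeasure ν'] (hν : ∀ᵐ x ∂ν, 0 < x) (hν' : ∀ᵐ x ∂ν', 0 < x) {δ : ℝ} (hδ : 0 ≤ δ)
    (h : ∀ w, |ν.real (Iic w) - ν'.real (Iic w)| ≤ δ) (r : ℝ) :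
    |jumpCdf H μ ν r - jumpCdf H μ ν' r| ≤ δ := by
  rcases hH.eq_or_lt r with ⟨w, hw, rfl⟩ | hr
  · rw [hH.jumpCdf_clock hν hμ hw, hH.jumpCdf_clock hν' hμ hw,
      ← integral_sub (IsClock.integrable_real_Iic μ ν w) (IsClock.integrable_real_Iic μ ν' w)]
    rw [← Real.norm_eq_abs]
    refine (norm_integral_le_of_norm_le_const (C := δ) (ae_of_all _ fun y => h _)).trans ?_
    simp
  · rw [IsClock.jumpCdf_of_lt hν hμ hr, IsClock.jumpCdf_of_lt hν' hμ hr]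
    simpa

/-- A solution of the forward equation that starts from a stationary distribution is constant. -/
theorem eq_of_isStationary (hm : IsForward H μ m) (hH : IsClock φ H) (hμ : ∀ᵐ y ∂μ, 0 < y)
    (hν : ∀ᵐ x ∂ν, 0 < x) (hst : IsStationary H μ ν) (h0 : m 0 = ν) (T : ℝ≥0) : m T = ν := by
  -- The contraction factor `∫₀ᵀ e^{-(T-s)} ds`. Each pass through Duhamel's formula multiplies the
  -- bound on the sup distance, uniform over `t ≤ T`, by `q`.
  set q : ℝ := 1 - Real.exp (-T)
  have hq0 : 0 ≤ q := by
    have : Real.exp (-T) ≤ 1 := Real.exp_le_one_iff.2 (by simp)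
    linarith
  have hq1 : q < 1 := by
    have := Real.exp_pos (-(T : ℝ))
    linarith
  have key : ∀ n : ℕ, ∀ t ≤ T, ∀ w, |(m t).real (Iic w) - ν.real (Iic w)| ≤ q ^ n := by
    intro n
    induction n with
    | zero =>
      intro t _ w
      have := hm.prob t
      have h1 : (m t).real (Iic w) ≤ 1 := measureReal_le_one
      have h2 : ν.real (Iic w) ≤ 1 := measureReal_le_one
      have h3 : 0 ≤ (m t).real (Iic w) := measureReal_nonneg
      have h4 : 0 ≤ ν.real (Iic w) := measureReal_nonneg
      rw [pow_zero, abs_le]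
      constructor <;> linarith
    | succ n ih =>
      intro t ht w
      have hqn : 0 ≤ q ^ n := pow_nonneg hq0 n
      rcases le_or_gt w 0 with hw | hw
      · rw [real_Iic_of_nonpos (hm.carried t) hw, real_Iic_of_nonpos hν hw, sub_self, abs_zero]
        positivity
      obtain ⟨hi, hD⟩ := hm.duhamel hH hμ t (H w)
      have hS := hst t (H w)
      rw [← hH.real_le_clock (hm.carried t) hw, ← hH.real_le_clock hν hw, hD, hS, h0,
        add_sub_add_left_eq_sub,
        ← intervalIntegral.integral_sub hi (intervalIntegrable_exp_mul_jumpCdf H μ ν t (H w) 0 t)]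
      have hb := intervalIntegral.norm_integral_le_of_norm_le (μ := volume) (a := 0) (b := t)
        (f := fun s : ℝ => Real.exp (-(t - s)) * jumpCdf H μ (m s.toNNReal) (H w + (t - s)) -
          Real.exp (-(t - s)) * jumpCdf H μ ν (H w + (t - s)))
        (g := fun s => q ^ n * Real.exp (s - t)) t.coe_nonneg
        (ae_of_all _ fun s hs => ?_) (Continuous.intervalIntegrable (by fun_prop) _ _)
      · refine hb.trans ?_
        have hexp : ∫ s in (0 : ℝ)..t, Real.exp (s - t) = 1 - Real.exp (-t) := by
          rw [intervalIntegral.integral_comp_sub_right (fun s => Real.exp s), integral_exp]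
          simp
        rw [intervalIntegral.integral_const_mul, hexp, pow_succ]
        refine mul_le_mul_of_nonneg_left ?_ hqn
        have : Real.exp (-T) ≤ Real.exp (-t) :=
          Real.exp_le_exp.2 (neg_le_neg (by exact_mod_cast ht))
        linarith
      · have hp := hm.prob s.toNNReal
        have hsT : s.toNNReal ≤ T := (Real.toNNReal_le_iff_le_coe.2 hs.2).trans ht
        rw [← mul_sub, norm_mul, Real.norm_of_nonneg (Real.exp_pos _).le, neg_sub, mul_comm]
        exact mul_le_mul_of_nonneg_right (abs_jumpCdf_sub_le hH hμ (hm.carried _) hν hqn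
          (ih _ hsT) _) (Real.exp_pos _).le
  have hp := hm.prob T
  refine Measure.ext_of_Iic _ _ fun w => ?_
  have hle : |(m T).real (Iic w) - ν.real (Iic w)| ≤ 0 :=
    ge_of_tendsto' (tendsto_pow_atTop_nhds_zero_of_lt_one hq0 hq1) fun n => key n T le_rfl w
  rw [← measureReal_eq_measureReal_iff]
  exact sub_eq_zero.1 (abs_nonpos_iff.1 hle)

end IsForward

/-- Stationary distributions are unique. -/
theorem IsStationary.eq {φ H : ℝ → ℝ} {μ ν ν' : Measure ℝ} [IsProbabilityMeasure μ]
    [IsProbabilityMeasure ν] [IsProbabilityMeasure ν'] (hH : IsClock φ H) {a : ℝ} (ha : 0 < a)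
    (hμa : ∀ᵐ y ∂μ, a ≤ y) (hν : ∀ᵐ x ∂ν, 0 < x) (hν' : ∀ᵐ x ∂ν', 0 < x)
    (hst : IsStationary H μ ν) (hst' : IsStationary H μ ν') (hpos : ν'.real (Iic a) ≠ 0) :
    ν = ν' := by
  have hμ : ∀ᵐ y ∂μ, 0 < y := hμa.mono fun y hy => ha.trans_le hy
  -- The only possible proportionality factor: it makes the two laws agree at level `a`.
  set C := ν.real (Iic a) / ν'.real (Iic a)
  have key : ∀ k : ℕ, ∀ w ≤ k * a, ν.real (Iic w) = C * ν'.real (Iic w) := by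
    intro k
    induction k with
    | zero =>
      intro w hw
      have hw : w ≤ 0 := by simpa using hw
      rw [IsForward.real_Iic_of_nonpos hν hw, IsForward.real_Iic_of_nonpos hν' hw, mul_zero]
    | succ k ih =>
      have hka : a ≤ ((k + 1 : ℕ) : ℝ) * a := by
        push_cast
        nlinarith [(Nat.cast_nonneg k : (0 : ℝ) ≤ k)]
      -- A jump is at least `a`, so below `(k + 1) * a` the jump terms involve the laws only up to
      -- `k * a`, where the induction hypothesis holds.
      have hQ : ∀ v > 0, v ≤ ((k + 1 : ℕ) : ℝ) * a →
          IsForward.jumpCdf H μ ν (H v) = C * IsForward.jumpCdf H μ ν' (H v) := by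
        intro v hv hvk
        rw [hH.jumpCdf_clock hν hμ hv, hH.jumpCdf_clock hν' hμ hv, ← integral_const_mul]
        refine integral_congr_ae ?_
        filter_upwards [hμa] with y hy
        refine ih _ ?_
        push_cast at hvk
        linarith
      -- With proportional jump terms, the difference `ν - C ν'` satisfies the homogeneous equation,
      -- so its values at any two levels of this range differ by a positive factor. Being zero at
      -- `a`, it vanishes throughout.
      have hstep : ∀ w > 0, ∀ w', w ≤ w' → w' ≤ ((k + 1 : ℕ) : ℝ) * a →
          ν.real (Iic w) - C * ν'.real (Iic w) =
            Real.exp (-(H w' - H w)) * (ν.real (Iic w') - C * ν'.real (Iic w')) := by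
        intro w hw w' hww' hw'
        have hw0' := hw.trans_le hww'
        have hHle : H w ≤ H w' := (hH.le_iff hw hw0').2 hww'
        have h1 := hst (H w' - H w).toNNReal (H w)
        have h2 := hst' (H w' - H w).toNNReal (H w)
        rw [Real.coe_toNNReal _ (sub_nonneg.2 hHle), add_sub_cancel, hH.real_le_clock hν hw,
          hH.real_le_clock hν hw0'] at h1
        rw [Real.coe_toNNReal _ (sub_nonneg.2 hHle), add_sub_cancel, hH.real_le_clock hν' hw,
          hH.real_le_clock hν' hw0'] at h2
        have h3 : ∫ s in (0 : ℝ)..(H w' - H w), Real.exp (-(H w' - H w - s)) *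
              IsForward.jumpCdf H μ ν (H w + (H w' - H w - s)) =
            C * ∫ s in (0 : ℝ)..(H w' - H w), Real.exp (-(H w' - H w - s)) *
              IsForward.jumpCdf H μ ν' (H w + (H w' - H w - s)) := by
          rw [← intervalIntegral.integral_const_mul]
          refine intervalIntegral.integral_congr fun s hs => ?_
          rw [uIcc_of_le (sub_nonneg.2 hHle)] at hs
          obtain ⟨v, hv, hvw, hvH⟩ := hH.exists_clock_eq hw0' hs.1
          rw [show H w + (H w' - H w - s) = H v by rw [hvH]; ring, hQ v hv (hvw.trans hw')]
          ring
        rw [h3] at h1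
        rw [h1, h2]
        ring
      have hbase : ν.real (Iic a) - C * ν'.real (Iic a) = 0 := by
        rw [div_mul_cancel₀ _ hpos, sub_self]
      intro w hw
      rcases le_or_gt w 0 with hw0 | hw0
      · rw [IsForward.real_Iic_of_nonpos hν hw0, IsForward.real_Iic_of_nonpos hν' hw0, mul_zero]
      rcases le_total w a with hwa | hwa
      · have := hstep w hw0 a hwa hka
        rw [hbase, mul_zero] at this
        linarith
      · have := hstep a ha w hwa hw
        rw [hbase, zero_eq_mul] at this
        linarith [this.resolve_left (Real.exp_pos _).ne']
  have hall : ∀ w, ν.real (Iic w) = C * ν'.real (Iic w) := fun w => by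
    obtain ⟨k, hk⟩ := exists_nat_ge (w / a)
    exact key k w ((div_le_iff₀ ha).1 hk)
  have htop : ∀ (ρ : Measure ℝ) [IsProbabilityMeasure ρ],
      Tendsto (fun w => ρ.real (Iic w)) atTop (𝓝 1) := fun ρ _ => by
    have := (ENNReal.tendsto_toReal (measure_ne_top ρ univ)).comp (tendsto_measure_Iic_atTop ρ)
    simpa [Function.comp_def, measureReal_def] using this
  have hC : C = 1 := by
    have h1 := (htop ν').const_mul C
    simp only [← hall, mul_one] at h1
    exact tendsto_nhds_unique h1 (htop ν)
  refine Measure.ext_of_Iic _ _ fun w => ?_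
  rw [← measureReal_eq_measureReal_iff, hall, hC, one_mul]

end

noncomputable section

/-! ### The generator on test functions -/

/-- The slope of `f` is divided by the slope of `H` between `flow H t x` and `x`; the increment of
`H` is exactly `-t`. -/
theorem IsClock.tendsto_slope_flow {φ H f : ℝ → ℝ} (hH : IsClock φ H) {x d f' : ℝ} (hx : 0 < x)
    (hd : 0 < d) (hHd : HasDerivWithinAt H d (Iio x) x) (hf : HasDerivAt f f' x) :
    Tendsto (fun t => (f (flow H t x) - f x) / t) (𝓝[>] 0) (𝓝 (f' * -d⁻¹)) := by
  have hlt : ∀ t > 0, flow H t x < x := fun t ht => by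
    rw [← hH.lt_iff (flow_pos _ _ _) hx, hH.clock_flow hx ht.le]
    linarith
  have hfl : Tendsto (fun t => flow H t x) (𝓝[>] 0) (𝓝[<] x) :=
    tendsto_nhdsWithin_iff.2 ⟨hH.tendsto_flow hx, by
      filter_upwards [self_mem_nhdsWithin] with t ht using hlt t ht⟩
  have h1 := ((hasDerivWithinAt_iff_tendsto_slope' self_notMem_Iio).1 hHd).comp hfl
  have h2 := ((hasDerivWithinAt_iff_tendsto_slope' self_notMem_Iio).1
    (hf.hasDerivWithinAt (s := Iio x))).comp hfl
  refine (h2.mul (h1.inv₀ hd.ne').neg).congr' ?_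
  filter_upwards [self_mem_nhdsWithin] with t ht
  have ht : 0 < t := ht
  have hne : flow H t x - x ≠ 0 := (sub_neg.2 (hlt t ht)).ne
  simp only [Function.comp_apply, slope_def_field, hH.clock_flow hx ht.le]
  have : H x - t - H x ≠ 0 := by linarith
  field_simp
  ring

namespace IsTestFunction

variable {f : ℝ → ℝ} (hf : IsTestFunction f)
include hf

theorem exists_abs_le : ∃ B, ∀ w, |f w| ≤ B :=
  hf.compact.exists_bound_of_continuous hf.smooth.continuous

/-- Test functions are Lipschitz with respect to the clock: on the support of `f` the rate `π /
tailConv` is at least `ε`, because `tailConv ≤ 1`, and off it `deriv f` vanishes. With `|deriv f| ≤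
D` the constant is `D / ε`. -/
theorem exists_abs_sub_le {π : ℝ → ℝ} {μ : Measure ℝ} [IsProbabilityMeasure μ] {a : ℝ}
    (hπ : TargetAssumptions π) (ha : 0 < a) (hμa : ∀ᵐ y ∂μ, a ≤ y) :
    ∃ C ≥ 0, ∀ w x, 0 < w → w ≤ x → |f x - f w| ≤ C * (clock μ π x - clock μ π w) := by
  obtain ⟨ε, hε, hπε⟩ := hπ.inf_pos (tsupport f) hf.compact hf.support
  have hdc : Continuous (deriv f) := hf.smooth.continuous_deriv (by simp)
  obtain ⟨D, hD⟩ := hf.compact.deriv.exists_bound_of_continuous hdc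
  have hD0 : 0 ≤ D := (norm_nonneg _).trans (hD 0)
  refine ⟨D / ε, by positivity, fun w x hw hwx => ?_⟩
  have hx := hw.trans_le hwx
  have hftc : f x - f w = ∫ u in w..x, deriv f u :=
    (intervalIntegral.integral_deriv_eq_sub (f := f)
      (fun u _ => hf.smooth.differentiable (by simp) u)
      (hdc.intervalIntegrable _ _)).symm
  rw [hftc, hπ.clock_sub ha hμa hw hx, ← intervalIntegral.integral_const_mul,
    ← Real.norm_eq_abs]
  refine intervalIntegral.norm_integral_le_of_norm_le hwx (ae_of_all _ fun u hu => ?_)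
    ((hπ.integrableOn_rate ha hμa hw hx).const_mul _)
  have hu0 : 0 < u := hw.trans hu.1
  have hg := TargetAssumptions.tailConv_pos hπ ha hμa hu0
  have hg1 := TargetAssumptions.tailConv_le_one hπ ha hμa hu0
  by_cases hut : u ∈ tsupport f
  · refine (hD u).trans ?_
    have h1 : ε ≤ π u / tailConv μ π u := by
      rw [le_div_iff₀ hg]
      exact (mul_le_of_le_one_right hε.le hg1).trans (hπε u hut)
    calc D = D / ε * ε := by field_simp
      _ ≤ _ := by gcongr
  · have : deriv f u = 0 :=
      image_eq_zero_of_notMem_tsupport fun h => hut (tsupport_deriv_subset h)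
    rw [this, norm_zero]
    exact mul_nonneg (by positivity) (hπ.rate_pos ha hμa hu0).le

end IsTestFunction

variable {Ω : Type*} {mΩ : MeasurableSpace Ω} {P : Measure Ω} [IsProbabilityMeasure P]

/-! ### Short-time expansion of the expectation of a test function -/

namespace IsSolutionFamily

variable {φ H : ℝ → ℝ} {μ : Measure ℝ} {N : ℝ≥0 → Ω → ℕ} {ξ : ℕ → Ω → ℝ}
  {X : ℝ → ℝ≥0 → Ω → ℝ} {ν : Measure ℝ} [IsProbabilityMeasure μ]

omit [IsProbabilityMeasure P] [IsProbabilityMeasure μ] in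
theorem ae_zero_eq (hX : IsSolutionFamily φ N ξ P X) (hJ : IsJumpNoise μ N ξ P) {x : ℝ}
    (hx : 0 < x) : ∀ᵐ ω ∂P, X x 0 ω = x := by
  filter_upwards [hX.solves x hx, hJ.poisson.zero] with ω hω h0
  simpa [h0] using hω.eqn 0

omit [IsProbabilityMeasure μ] in
theorem map_zero (hX : IsSolutionFamily φ N ξ P X) (hJ : IsJumpNoise μ N ξ P) {x : ℝ}
    (hx : 0 < x) : P.map (X x 0) = Measure.dirac x := by
  rw [Measure.map_congr (g := fun _ => x) (hX.ae_zero_eq hJ hx), Measure.map_const]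
  simp

variable {f : ℝ → ℝ} {B C : ℝ}

omit [IsProbabilityMeasure P] [IsProbabilityMeasure μ] in
theorem setIntegral_no_jump (hX : IsSolutionFamily φ N ξ P X) (hJ : IsJumpNoise μ N ξ P)
    (hH : IsClock φ H) {x : ℝ} (hx : 0 < x) (h : ℝ≥0) :
    ∫ ω in {ω | N (0 + h) ω - N 0 ω = 0}, f (X x (0 + h) ω) ∂P =
      Real.exp (-h) * f (flow H h x) := by
  rw [← hJ.real_increment_eq_zero 0 h, ← smul_eq_mul, ← setIntegral_const]
  refine setIntegral_congr_ae (hJ.measurableSet_increment 0 h {0}) ?_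
  filter_upwards [hX.solves x hx, hX.ae_zero_eq hJ hx] with ω hω h0 hΔ
  have hle : N 0 ω ≤ N (0 + h) ω := hω.mono le_self_add
  have hΔ : N (0 + h) ω - N 0 ω = 0 := hΔ
  rw [hH.eq_flow_of_no_jump hω (by omega), h0]

theorem setIntegral_one_jump (hX : IsSolutionFamily φ N ξ P X) (hJ : IsJumpNoise μ N ξ P)
    (hH : IsClock φ H) {x : ℝ} (hx : 0 < x) (h : ℝ≥0) {g : ℝ × ℝ → ℝ} (hg : Measurable g) :
    ∫ ω in {ω | N (0 + h) ω - N 0 ω = 1}, g (X x 0 ω, ξ (N 0 ω) ω) ∂P =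
      h * Real.exp (-h) * ∫ y, g (x, y) ∂μ := by
  rw [hJ.setIntegral_increment hH (hX.measurable x hx) (hX.solves x hx) 0 h 1 hg,
    hJ.real_increment_eq_one, hX.map_zero hJ hx, Measure.dirac_prod,
    integral_map (by fun_prop) hg.aestronglyMeasurable]

omit [IsProbabilityMeasure μ] in
-- The domination for the generator, uniform in `x`. `C` comes from the flow without jumps; one `B`
-- each comes from the lost probability `1 - e^{-h}`, from one jump, and from two or more jumps,
-- where `h^2 ≤ h`.
theorem abs_integral_sub_le (hX : IsSolutionFamily φ N ξ P X) (hJ : IsJumpNoise μ N ξ P)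
    (hH : IsClock φ H) (hf : Measurable f) (hB : ∀ w, |f w| ≤ B)
    (hC : ∀ w x, 0 < w → w ≤ x → |f x - f w| ≤ C * (H x - H w)) {x : ℝ} (hx : 0 < x) {h : ℝ≥0}
    (hh : h ≤ 1) : |∫ ω, f (X x h ω) ∂P - f x| ≤ (C + 3 * B) * h := by
  have hB0 : 0 ≤ B := (abs_nonneg _).trans (hB 0)
  have hh0 : (0 : ℝ) ≤ h := h.2
  have hh1 : (h : ℝ) ≤ 1 := by exact_mod_cast hh
  have hint : Integrable (fun ω => f (X x (0 + h) ω)) P :=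
    Integrable.of_bound (hf.comp (hX.measurable x hx _)).aestronglyMeasurable B
      (ae_of_all _ fun ω => hB _)
  have hs := hJ.integral_eq_add_increment 0 h hint
  rw [hX.setIntegral_no_jump hJ hH hx h] at hs
  have h2 := hJ.norm_setIntegral_two_le_increment_le 0 h (g := fun ω => f (X x (0 + h) ω))
    fun ω => hB _
  have h1 : |∫ ω in {ω | N (0 + h) ω - N 0 ω = 1}, f (X x (0 + h) ω) ∂P| ≤
      B * (h * Real.exp (-h)) := by
    rw [← hJ.real_increment_eq_one 0 h]
    exact norm_setIntegral_le_of_norm_le_const (f := fun ω => f (X x (0 + h) ω))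
      (measure_lt_top P _) fun ω _ => hB _
  have h0 := hC (flow H h x) x (flow_pos _ _ _) (hH.flow_le hx hh0)
  rw [hH.clock_flow hx hh0, sub_sub_cancel] at h0
  simp only [zero_add] at hs h1 h2
  have e1 := Real.one_sub_le_exp_neg (h : ℝ)
  have e2 : Real.exp (-h) ≤ 1 := Real.exp_le_one_iff.2 (neg_nonpos.2 hh0)
  have e0 := Real.exp_pos (-h : ℝ)
  have hfB := hB (flow H h x)
  rw [hs, abs_le]
  rw [abs_le] at h0 h1 h2 hfB
  have b1 : B * (h * Real.exp (-h)) ≤ B * h := by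
    gcongr
    exact mul_le_of_le_one_right hh0 e2
  have b2 : B * (h : ℝ) ^ 2 ≤ B * h := by
    gcongr
    nlinarith
  have b3 : |(Real.exp (-h) - 1) * f (flow H h x)| ≤ h * B := by
    rw [abs_mul]
    refine mul_le_mul ?_ (hB _) (abs_nonneg _) hh0
    rw [abs_le]
    constructor <;> linarith
  rw [abs_le] at b3
  constructor <;> linarith [h0.1, h0.2, h1.1, h1.2, h2.1, h2.2, b3.1, b3.2]

/-- Replaces the position after one jump by `x + ξ`. The error is at most `C` times the clock
distance between the two bounds of `bounds_of_one_jump`; the cap `2 * B` allows dominated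
convergence as `h → 0`. -/
theorem abs_setIntegral_one_jump_sub_le (hX : IsSolutionFamily φ N ξ P X)
    (hJ : IsJumpNoise μ N ξ P)
    (hH : IsClock φ H) (hf : Measurable f) (hB : ∀ w, |f w| ≤ B) (hC0 : 0 ≤ C)
    (hC : ∀ w x, 0 < w → w ≤ x → |f x - f w| ≤ C * (H x - H w)) {x : ℝ} (hx : 0 < x) (h : ℝ≥0) :
    |∫ ω in {ω | N (0 + h) ω - N 0 ω = 1}, f (X x (0 + h) ω) ∂P -
        h * Real.exp (-h) * ∫ y, f (x + y) ∂μ| ≤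
      h * Real.exp (-h) * ∫ y, min (2 * B) |C * (H (x + y) - (H (flow H h x + y) - h))| ∂μ := by
  have hHm := hH.measurable
  have hB0 : 0 ≤ B := (abs_nonneg _).trans (hB 0)
  have hξ := hJ.measurable_nextJump 0
  have hx0 := hX.measurable x hx 0
  have hg1 : Measurable fun q : ℝ × ℝ => f (q.1 + q.2) := hf.comp (by fun_prop)
  have hg2 : Measurable fun q : ℝ × ℝ =>
      min (2 * B) |C * (H (x + q.2) - (H (flow H h x + q.2) - h))| := by fun_prop
  have e1 := hX.setIntegral_one_jump hJ hH hx h hg1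
  have e2 := hX.setIntegral_one_jump hJ hH hx h hg2
  have i0 : Integrable (fun ω => f (X x (0 + h) ω)) P :=
    Integrable.of_bound (hf.comp (hX.measurable x hx _)).aestronglyMeasurable B
      (ae_of_all _ fun ω => hB _)
  have i1 : Integrable (fun ω => f (X x 0 ω + ξ (N 0 ω) ω)) P :=
    Integrable.of_bound (hf.comp (hx0.add hξ)).aestronglyMeasurable B
      (ae_of_all _ fun ω => hB _)
  have i2 : Integrable (fun ω => min (2 * B)
      |C * (H (x + ξ (N 0 ω) ω) - (H (flow H h x + ξ (N 0 ω) ω) - h))|) P :=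
    Integrable.of_bound (hg2.comp (hx0.prodMk hξ)).aestronglyMeasurable (2 * B)
      (ae_of_all _ fun ω => by
      rw [Real.norm_of_nonneg (le_min (by positivity) (abs_nonneg _))]
      exact min_le_left _ _)
  simp only at e1 e2
  rw [← e1, ← e2, ← integral_sub i0.integrableOn i1.integrableOn, ← Real.norm_eq_abs]
  refine norm_integral_le_of_norm_le i2.integrableOn ?_
  refine (ae_restrict_iff' (hJ.measurableSet_increment 0 h {1})).2 ?_
  filter_upwards [hX.solves x hx, hX.ae_zero_eq hJ hx] with ω hω h0 hΔ
  have hΔ : N (0 + h) ω - N 0 ω = 1 := hΔ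
  have hb := hH.bounds_of_one_jump (s := 0) (h := h) hω (by omega)
  have hξp := hω.jump_pos (N 0 ω)
  have hXp := hH.solution_pos hω (0 + h)
  simp only [h0] at hb ⊢
  have hfp : 0 < flow H h x + ξ (N 0 ω) ω := add_pos (flow_pos _ _ _) hξp
  have hc := (hH.le_iff (flow_pos _ _ _) hXp).2 hb.1
  rw [hH.clock_flow hfp h.coe_nonneg] at hc
  refine le_min ?_ ?_
  · have := abs_sub (f (X x (0 + h) ω)) (f (x + ξ (N 0 ω) ω))
    rw [Real.norm_eq_abs]
    linarith [hB (X x (0 + h) ω), hB (x + ξ (N 0 ω) ω)]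
  · rw [Real.norm_eq_abs, abs_sub_comm]
    refine (hC _ _ hXp hb.2).trans (le_trans ?_ (le_abs_self _))
    gcongr

theorem exists_tendsto_genQuotient (hX : IsSolutionFamily φ N ξ P X) (hJ : IsJumpNoise μ N ξ P)
    (hH : IsClock φ H) (hμ : ∀ᵐ y ∂μ, 0 < y) (hf : Measurable f) (hB : ∀ w, |f w| ≤ B)
    (hC0 : 0 ≤ C) (hC : ∀ w x, 0 < w → w ≤ x → |f x - f w| ≤ C * (H x - H w)) {x d f' : ℝ}
    (hx : 0 < x) (hd : 0 < d) (hHd : HasDerivWithinAt H d (Iio x) x) (hfd : HasDerivAt f f' x) :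
    ∃ l, Tendsto (genQuotient X P f x) (𝓝[>] 0) (𝓝 l) := by
  have hHm := hH.measurable
  have hB0 : 0 ≤ B := (abs_nonneg _).trans (hB 0)
  have hcoe : Tendsto (fun h : ℝ≥0 => (h : ℝ)) (𝓝[>] 0) (𝓝[>] 0) := by
    refine tendsto_nhdsWithin_iff.2 ⟨?_, ?_⟩
    · exact (NNReal.continuous_coe.tendsto' 0 0 rfl).mono_left nhdsWithin_le_nhds
    · filter_upwards [self_mem_nhdsWithin] with h hh
      exact_mod_cast hh
  have hcoe0 := hcoe.mono_right nhdsWithin_le_nhds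
  set m := ∫ y, f (x + y) ∂μ
  set G : ℝ≥0 → ℝ → ℝ := fun h y => min (2 * B) |C * (H (x + y) - (H (flow H h x + y) - h))|
  have hG : Tendsto (fun h : ℝ≥0 => ∫ y, G h y ∂μ) (𝓝[>] 0) (𝓝 0) := by
    have : (0 : ℝ) = ∫ _, (0 : ℝ) ∂μ := by simp
    rw [this]
    refine tendsto_integral_filter_of_dominated_convergence (fun _ => 2 * B)
      (Eventually.of_forall fun h => ?_) (Eventually.of_forall fun h => ae_of_all _ fun y => ?_)
      (integrable_const _) ?_
    · exact Measurable.aestronglyMeasurable (by fun_prop)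
    · rw [Real.norm_of_nonneg (le_min (by positivity) (abs_nonneg _))]
      exact min_le_left _ _
    · filter_upwards [hμ] with y hy
      have hy0 : 0 < x + y := add_pos hx hy
      have h1 : Tendsto (fun h : ℝ≥0 => flow H h x + y) (𝓝[>] 0) (𝓝 (x + y)) :=
        ((hH.tendsto_flow hx).comp hcoe).add_const y
      have h2 := ((hH.continuousOn.continuousAt (Ioi_mem_nhds hy0)).tendsto.comp h1)
      have h3 := (((h2.sub hcoe0).const_sub (H (x + y))).const_mul C).abs
      have h4 := (tendsto_const_nhds (x := 2 * B)).min h3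
      simpa [G, abs_mul, hB0] using h4
  have he : Tendsto (fun h : ℝ≥0 => Real.exp (-h)) (𝓝[>] 0) (𝓝 1) := by
    simpa [Function.comp_def] using (Real.continuous_exp.tendsto _).comp hcoe0.neg
  have he' : Tendsto (fun h : ℝ≥0 => (Real.exp (-h) - 1) / h) (𝓝[>] 0) (𝓝 (-1)) := by
    have h1 : HasDerivAt (fun t : ℝ => Real.exp (-t)) (-1) 0 := by
      simpa using (hasDerivAt_neg (0 : ℝ)).exp
    have h2 := (h1.tendsto_slope_zero_right).comp hcoe
    refine h2.congr fun h => ?_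
    simp [div_eq_inv_mul]
  -- The three terms give the limit `-f' / d - f x + m`: drift, loss by jumping, and gain after a
  -- jump. The remainder is shown to vanish below.
  have hq := ((he.mul ((hH.tendsto_slope_flow hx hd hHd hfd).comp hcoe)).add
    (he'.mul_const (f x))).add (he.mul_const m)
  refine ⟨_, (hq.add (g := fun h : ℝ≥0 => genQuotient X P f x h - (Real.exp (-h) *
    ((f (flow H h x) - f x) / h) + (Real.exp (-h) - 1) / h * f x + Real.exp (-h) * m))
    (b := 0) ?_).congr fun h => ?_⟩
  swap
  · simp only [Function.comp_apply]
    ring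
  have hε : Tendsto (fun h : ℝ≥0 => Real.exp (-h) * ∫ y, G h y ∂μ + B * h) (𝓝[>] 0) (𝓝 0) := by
    simpa using (he.mul hG).add (hcoe0.const_mul B)
  refine squeeze_zero_norm' ?_ hε
  filter_upwards [self_mem_nhdsWithin] with h hh
  have hh : (0 : ℝ) < h := by exact_mod_cast hh
  have hint : Integrable (fun ω => f (X x (0 + h) ω)) P :=
    Integrable.of_bound (hf.comp (hX.measurable x hx _)).aestronglyMeasurable B
      (ae_of_all _ fun ω => hB _)
  have hs := hJ.integral_eq_add_increment 0 h hint
  rw [hX.setIntegral_no_jump hJ hH hx h] at hs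
  have h2 := hJ.norm_setIntegral_two_le_increment_le 0 h (g := fun ω => f (X x (0 + h) ω))
    fun ω => hB _
  have h1 := hX.abs_setIntegral_one_jump_sub_le hJ hH hf hB hC0 hC hx h
  set I1 := ∫ ω in {ω | N (0 + h) ω - N 0 ω = 1}, f (X x (0 + h) ω) ∂P
  set I2 := ∫ ω in {ω | 2 ≤ N (0 + h) ω - N 0 ω}, f (X x (0 + h) ω) ∂P
  simp only [zero_add] at hs
  have key : genQuotient X P f x h - (Real.exp (-h) * ((f (flow H h x) - f x) / h) +
      (Real.exp (-h) - 1) / h * f x + Real.exp (-h) * m) =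
      ((I1 - h * Real.exp (-h) * m) + I2) / h := by
    rw [genQuotient, hs]
    field_simp
    ring
  rw [key, Real.norm_eq_abs, abs_div, abs_of_pos hh, div_le_iff₀ hh]
  refine (abs_add_le _ _).trans ((add_le_add h1 h2).trans (le_of_eq ?_))
  ring

end IsSolutionFamily
end

noncomputable section

/-! ### Invariance -/

variable {Ω : Type*} {mΩ : MeasurableSpace Ω} {P : Measure Ω} [IsProbabilityMeasure P]

omit [IsProbabilityMeasure P] in
theorem IsInvariantDistribution.ae_pos {X : ℝ → ℝ≥0 → Ω → ℝ} {ν : Measure ℝ}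
    (hν : IsInvariantDistribution X P ν) : ∀ᵐ x ∂ν, 0 < x := by
  rw [ae_iff]
  simpa using! hν.carried

theorem IsTestFunction.tendsto_zero {f : ℝ → ℝ} (hf : IsTestFunction f) :
    Tendsto f (𝓝[>] 0) (𝓝 0) := by
  have h0 : f 0 = 0 := image_eq_zero_of_notMem_tsupport fun h => lt_irrefl (0 : ℝ) (hf.support h)
  have := (hf.smooth.continuous.tendsto 0).mono_left (nhdsWithin_le_nhds (s := Ioi 0))
  rwa [h0] at this

namespace IsSolutionFamily

variable {φ H : ℝ → ℝ} {μ : Measure ℝ} {N : ℝ≥0 → Ω → ℕ} {ξ : ℕ → Ω → ℝ}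
  {X : ℝ → ℝ≥0 → Ω → ℝ} {ν : Measure ℝ}

theorem marginal_eq_iff (hX : IsSolutionFamily φ N ξ P X) (hJ : IsJumpNoise μ N ξ P)
    (hH : IsClock φ H) (hν : ∀ᵐ x ∂ν, 0 < x) (t : ℝ≥0) : marginal H N ξ P ν t = ν ↔
      ∀ B : Set ℝ, MeasurableSet B → B ⊆ Ioi 0 →
        ∫⁻ x in Ioi (0 : ℝ), P {ω | X x t ω ∈ B} ∂ν = ν B := by
  constructor
  · intro h B hB _
    rw [← hX.marginal_apply hJ hH hν t hB, h]
  · intro h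
    have e1 := Measure.restrict_eq_self_of_ae_mem (s := Ioi (0 : ℝ)) hν
    have e2 := Measure.restrict_eq_self_of_ae_mem (s := Ioi (0 : ℝ))
      (marginal_pos (ν := ν) hJ hH t)
    ext B hB
    have hB' := hB.inter (measurableSet_Ioi (a := (0 : ℝ)))
    rw [← e2, Measure.restrict_apply hB, hX.marginal_apply hJ hH hν t hB',
      h _ hB' inter_subset_right, ← Measure.restrict_apply hB, e1]

variable {f : ℝ → ℝ} {B C : ℝ}

/-- Invariance makes every difference quotient integrate to `0`, and the uniform bound `C + 3 * B`
allows passing to the limit along `1 / (n + 1)`. -/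
theorem integral_generator (hX : IsSolutionFamily φ N ξ P X) (hJ : IsJumpNoise μ N ξ P)
    (hH : IsClock φ H) (hν : IsInvariantDistribution X P ν) (hf : Measurable f)
    (hB : ∀ w, |f w| ≤ B) (hC : ∀ w x, 0 < w → w ≤ x → |f x - f w| ≤ C * (H x - H w))
    (hlim : ∀ x > 0, ∃ l, Tendsto (genQuotient X P f x) (𝓝[>] 0) (𝓝 l)) :
    IntegrableOn (generator X P f) (Ioi 0) ν ∧
      ∫ x in Ioi (0 : ℝ), generator X P f x ∂ν = 0 := by
  have := hν.prob
  have hpos := hν.ae_pos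
  have e := Measure.restrict_eq_self_of_ae_mem (s := Ioi (0 : ℝ)) hpos
  rw [IntegrableOn, e]
  set t : ℕ → ℝ≥0 := fun n => 1 / ((n : ℝ≥0) + 1)
  have ht0 : ∀ n, 0 < t n := fun n => by positivity
  have ht1 : ∀ n, t n ≤ 1 := fun n => div_le_one_of_le₀ (by simp) (by simp)
  have ht : Tendsto t atTop (𝓝[>] 0) := tendsto_nhdsWithin_iff.2
    ⟨tendsto_one_div_add_atTop_nhds_zero_nat, Eventually.of_forall ht0⟩
  have hgen : ∀ x > 0, Tendsto (fun n => genQuotient X P f x (t n)) atTop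
      (𝓝 (generator X P f x)) := fun x hx => (tendsto_nhds_limUnder (hlim x hx)).comp ht
  have hbd : ∀ n, ∀ x > 0, ‖genQuotient X P f x (t n)‖ ≤ C + 3 * B := fun n x hx => by
    have htn : (0 : ℝ) < t n := by exact_mod_cast ht0 n
    rw [genQuotient, Real.norm_eq_abs, abs_div, abs_of_pos htn, div_le_iff₀ htn]
    exact hX.abs_integral_sub_le hJ hH hf hB hC hx (ht1 n)
  have hfi : Integrable f ν := Integrable.of_bound hf.aestronglyMeasurable B (ae_of_all _ hB)
  have hq : ∀ n, Integrable (fun x => genQuotient X P f x (t n)) ν ∧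
      ∫ x, genQuotient X P f x (t n) ∂ν = 0 := fun n => by
    obtain ⟨i1, i2⟩ := hX.integral_marginal hJ hH hpos (t n) hf hB
    rw [(hX.marginal_eq_iff hJ hH hpos (t n)).2 (hν.invariant (t n))] at i2
    have hae : (fun x => (∫ w, f w ∂(P.map (X x (t n))) - f x) / (t n : ℝ)) =ᵐ[ν]
        fun x => genQuotient X P f x (t n) := by
      filter_upwards [hpos] with x hx
      rw [genQuotient, integral_map (hX.measurable x hx _).aemeasurable hf.aestronglyMeasurable]
    refine ⟨((i1.sub hfi).div_const _).congr hae, ?_⟩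
    rw [← integral_congr_ae hae, integral_div, integral_sub i1 hfi, ← i2, sub_self, zero_div]
  have hmeas : AEStronglyMeasurable (generator X P f) ν :=
    aestronglyMeasurable_of_tendsto_ae atTop (fun n => (hq n).1.aestronglyMeasurable) <| by
      filter_upwards [hpos] with x hx using hgen x hx
  refine ⟨Integrable.of_bound hmeas (C + 3 * B) ?_, ?_⟩
  · filter_upwards [hpos] with x hx
    exact le_of_tendsto (hgen x hx).norm (Eventually.of_forall fun n => hbd n x hx)
  · refine tendsto_nhds_unique (tendsto_integral_of_dominated_convergence (fun _ => C + 3 * B)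
      (fun n => (hq n).1.aestronglyMeasurable) (integrable_const _) (fun n => ?_) ?_) ?_
    · filter_upwards [hpos] with x hx using hbd n x hx
    · filter_upwards [hpos] with x hx using hgen x hx
    · simp only [fun n => (hq n).2, tendsto_const_nhds_iff]

variable [IsProbabilityMeasure μ] {π : ℝ → ℝ} {a : ℝ}

theorem isInfinitesimallyInvariant (hπ : TargetAssumptions π) (ha : 0 < a)
    (hμa : ∀ᵐ y ∂μ, a ≤ y) (hX : IsSolutionFamily (drift μ π) N ξ P X)
    (hJ : IsJumpNoise μ N ξ P) (hν : IsInvariantDistribution X P ν) :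
    IsInfinitesimallyInvariant X P ν := by
  have hH := hπ.isClock ha hμa
  have hμ : ∀ᵐ y ∂μ, 0 < y := hμa.mono fun y hy => ha.trans_le hy
  have hlim : ∀ f, IsTestFunction f → ∀ x > 0,
      ∃ l, Tendsto (genQuotient X P f x) (𝓝[>] 0) (𝓝 l) := fun f hf x hx => by
    obtain ⟨B, hB⟩ := hf.exists_abs_le
    obtain ⟨C, hC0, hC⟩ := hf.exists_abs_sub_le hπ ha hμa
    obtain ⟨d, hd, hHd⟩ := hπ.exists_hasDerivWithinAt_clock ha hμa hx
    exact hX.exists_tendsto_genQuotient hJ hH hμ hf.smooth.continuous.measurable hB hC0 hC hx hd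
      hHd (hf.smooth.differentiable (by simp) x).hasDerivAt
  have key : ∀ f, IsTestFunction f → IntegrableOn (generator X P f) (Ioi 0) ν ∧
      ∫ x in Ioi (0 : ℝ), generator X P f x ∂ν = 0 := fun f hf => by
    obtain ⟨B, hB⟩ := hf.exists_abs_le
    obtain ⟨C, -, hC⟩ := hf.exists_abs_sub_le hπ ha hμa
    exact hX.integral_generator hJ hH hν hf.smooth.continuous.measurable hB hC (hlim f hf)
  exact {
    prob := hν.prob
    carried := hν.carried
    mem_domain := fun f hf => {
      continuousOn := hf.smooth.continuous.continuousOn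
      zero_at_zero := hf.tendsto_zero
      zero_at_top := hf.compact.is_zero_at_infty.mono_left atTop_le_cocompact
      exists_lim := hlim f hf }
    integrable := fun f hf => (key f hf).1
    integral_eq_zero := fun f hf => (key f hf).2 }

theorem isInvariantDistribution_targetMeasure (hπ : TargetAssumptions π) (ha : 0 < a)
    (hμa : ∀ᵐ y ∂μ, a ≤ y) (hX : IsSolutionFamily (drift μ π) N ξ P X)
    (hJ : IsJumpNoise μ N ξ P) : IsInvariantDistribution X P (targetMeasure π) := by
  have hprob := hπ.isProbabilityMeasure
  have hH := hπ.isClock ha hμa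
  have hpos := TargetAssumptions.ae_pos_targetMeasure π
  have hμ : ∀ᵐ y ∂μ, 0 < y := hμa.mono fun y hy => ha.trans_le hy
  have h0 : marginal (clock μ π) N ξ P (targetMeasure π) 0 = targetMeasure π := by
    rw [hX.marginal_eq_iff hJ hH hpos]
    intro B hB _
    rw [Measure.restrict_eq_self_of_ae_mem (s := Ioi (0 : ℝ)) hpos, ← lintegral_indicator_one hB]
    refine lintegral_congr_ae ?_
    filter_upwards [hpos] with x hx
    change P (X x 0 ⁻¹' B) = _
    rw [← Measure.map_apply (hX.measurable x hx 0) hB, hX.map_zero hJ hx,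
      Measure.dirac_apply' _ hB]
  refine ⟨hprob, TargetAssumptions.targetMeasure_Iic_zero π, fun t => ?_⟩
  rw [← hX.marginal_eq_iff hJ hH hpos]
  exact (hX.isForward_marginal hJ hH hpos).eq_of_isStationary hH hμ hpos
    (hπ.isStationary_targetMeasure ha hμa) h0 t

/-- Invariance makes the marginals a constant solution of the forward bounds, hence stationary.
Uniqueness applies because the target charges `(0, a]`. -/
theorem eq_targetMeasure (hπ : TargetAssumptions π) (ha : 0 < a)
    (hμa : ∀ᵐ y ∂μ, a ≤ y) (hX : IsSolutionFamily (drift μ π) N ξ P X)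
    (hJ : IsJumpNoise μ N ξ P) (hν : IsInvariantDistribution X P ν) : ν = targetMeasure π := by
  have hprob := hπ.isProbabilityMeasure
  have hprobν := hν.prob
  have hH := hπ.isClock ha hμa
  have hpos := TargetAssumptions.ae_pos_targetMeasure π
  have hμ : ∀ᵐ y ∂μ, 0 < y := hμa.mono fun y hy => ha.trans_le hy
  have hm := hX.isForward_marginal hJ hH hν.ae_pos
  have hconst : marginal (clock μ π) N ξ P ν = fun _ => ν := funext fun t =>
    (hX.marginal_eq_iff hJ hH hν.ae_pos t).2 (hν.invariant t)
  rw [hconst] at hm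
  have h1 := hπ.real_Iic_strictMono ha ha
  rw [TargetAssumptions.real_Iic_of_nonpos π le_rfl] at h1
  exact (hm.isStationary_of_const hH hμ).eq hH ha hμa hν.ae_pos hpos
    (hπ.isStationary_targetMeasure ha hμa) h1.ne'

end IsSolutionFamily

/-! ### From strong solutions to paths driven by the jump noise -/

theorem ae_sInf_support_le {μ : Measure ℝ} (h : 0 < sInf μ.support) :
    ∀ᵐ y ∂μ, sInf μ.support ≤ y := by
  -- The infimum of a set unbounded below is `0` by convention, so its positivity forces a lower
  -- bound.
  have hbdd : BddBelow μ.support := by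
    by_contra hb
    rw [Real.sInf_of_not_bddBelow hb] at h
    exact lt_irrefl _ h
  filter_upwards [Measure.support_mem_ae (μ := μ)] with y hy using csInf_le hbdd hy

omit [IsProbabilityMeasure P] in
theorem isSolutionFamily_of_isStrongSolution {φ : ℝ → ℝ} {μ : Measure ℝ} {N : ℝ≥0 → Ω → ℕ}
    {ξ : ℕ → Ω → ℝ} {L : ℝ≥0 → Ω → ℝ} {𝓕 : Filtration ℝ≥0 mΩ} {X : ℝ → ℝ≥0 → Ω → ℝ}
    (hJ : IsJumpNoise μ N ξ P) (hμ : ∀ᵐ y ∂μ, 0 < y)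
    (hL : ∀ᵐ ω ∂P, ∀ t, L t ω = ∑ k ∈ Finset.range (N t ω), ξ k ω)
    (hX : ∀ x > 0, IsStrongSolution φ L 𝓕 P x (X x)) : IsSolutionFamily φ N ξ P X where
  measurable x hx t := ((hX x hx).adapted t).mono (𝓕.le t) le_rfl
  solves x hx := by
    have hξ : ∀ᵐ ω ∂P, ∀ k, 0 < ξ k ω := ae_all_iff.2 fun k => by
      rw [← hJ.law k, ae_map_iff (hJ.measurable k).aemeasurable measurableSet_Ioi] at hμ
      exact hμ
    filter_upwards [(hX x hx).eqn, hL, hJ.poisson.mono, hξ] with ω h1 h2 h3 h4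
    exact ⟨hx, h3, h4, fun t => (h1 t).1, fun t => by rw [(h1 t).2, h2]⟩

end
end LevyLangevin

theorem mainTheorem5 {Ω : Type*} {mΩ : MeasurableSpace Ω} (P : Measure Ω) [IsProbabilityMeasure P]
    (𝓕 : Filtration ℝ≥0 mΩ) (h𝓕 : UsualConditions 𝓕 P)
    (π : ℝ → ℝ) (hπ : TargetAssumptions π)
    (μ : Measure ℝ) [IsProbabilityMeasure μ] (hμ : μ (Iic 0) = 0)
    (hμsupp : 0 < sInf μ.support)
    (L : ℝ≥0 → Ω → ℝ) (hLadapted : Adapted 𝓕 L) (hL : IsCompoundPoisson μ L P)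
    (X : ℝ → ℝ≥0 → Ω → ℝ)
    (hX : ∀ x > 0, IsStrongSolution (drift μ π) L 𝓕 P x (X x)) :
    (∀ ν : Measure ℝ, IsInvariantDistribution X P ν → IsInfinitesimallyInvariant X P ν) ∧
      IsInvariantDistribution X P (targetMeasure π) ∧
      ∀ ν : Measure ℝ, IsInvariantDistribution X P ν → ν = targetMeasure π := by
  obtain ⟨N, ξ, hN, hξm, hξμ, hξi, hξN, hLe⟩ := hL
  have hJ : IsJumpNoise μ N ξ P := ⟨hN, hξm, hξμ, hξi, hξN⟩
  have hμa := ae_sInf_support_le hμsupp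
  have hS := isSolutionFamily_of_isStrongSolution hJ
    (hμa.mono fun y hy => hμsupp.trans_le hy) hLe hX
  exact ⟨fun ν hν => hS.isInfinitesimallyInvariant hπ hμsupp hμa hJ hν,
    hS.isInvariantDistribution_targetMeasure hπ hμsupp hμa hJ,
    fun ν hν => hS.eq_targetMeasure hπ hμsupp hμa hJ hν⟩
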